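/- A \emph{blink} is a finite plane graph (loops, parallel edges, several components, isolated vertices and the empty graph are allowed) with an arbitrary partition of its edges into black and gray ones; blinks that differ by an isotopy of the plane are the same. A \emph{coin} with $k$ attachment vertices is a plane graph with black and gray edges drawn in a closed disk that meets the boundary circle exactly in $k$ distinct vertices $a_0,\dots,a_{k-1}$, in counterclockwise order (in one case, marked below, the disk is pinched so that two of these points coincide). A blink \emph{contains} a coin if an orientation preserving copy of the disk can be placed in the plane so that the blink meets it in the coin; the rest of the blink lies outside of the disk and meets it at most in the $k$ distinct attachment vertices, and is otherwise arbitrary. A \emph{move} replaces a coin by its mate (with the same $k$) and leaves the exterior unchanged. There are eight families of moves. Each is generated by one pair of mates (left, right): 1. $\mu_{20},\mu_{02}$ ($k=2$): a path $a_0wa_1$ with $a_0w$ black and $wa_1$ gray; its mate is a single vertex, with no edges, into which $a_0$ and $a_1$ are merged (pinched disk). 2. $\mu_{33}^{\pm1}$ ($k=3$): a star with center $w$ and rays $wa_0,wa_1$ black, $wa_2$ gray; its mate is the triangle $a_0a_1a_2$ in which the edge opposite to $a_j$ has the color different from that of $wa_j$. 3. $\mu_{10},\mu_{01}$ ($k=0$):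 an isolated black edge with its two ends; its mate is the empty coin. 4. $\mu_{11}^{\pm1}$ ($k=1$, the ribbon moves): a black pendant edge at $a_0$; its mate is a gray loop at $a_0$ with empty interior. 5. $\mu_{31},\mu_{13}$ ($k=1$): two parallel black edges $a_0w$, with empty face between them, and a black pendant edge at $w$ outside of that face; its mate is a gray pendant edge at $a_0$. 6. $\mu_{54},\mu_{45}$ ($k=2$): a 4-cycle $a_0xa_1y$ with empty interior, with $x$ on the side of the boundary arc that runs counterclockwise from $a_0$ to $a_1$, the edges at $x$ black and those at $y$ gray, and a black pendant edge at $x$ outside of the cycle; its mate is a path $a_0wa_1$ of two black edges together with two gray pendant edges at $a_0$, one on either side of the path. 7. $\mu_{66}^{\pm1}$ ($k=3$): inner vertices $m,x,y$, edges $ma_1,mx,xa_2$ black and $ma_0,my,ya_2$ gray, with counterclockwise order $a_0,a_1,x,y$ around $m$, and $y,x$ around $a_2$ (starting from outside); its mate is the same graph with the colors of $ma_0$ and $ma_1$ changed. 8. $\mu_{99}^{\pm1}$ ($k=4$): inner vertices $m,x,y$, edges $ma_1,a_0a_3,mx,xa_2$ and two parallel edges $ya_3$ (with empty face between them) black, $ma_0,my,ya_2$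 gray, with counterclockwise orders $a_0,a_1,x,y$ around $m$; $a_3,m,a_2,a_3$ around $y$; and, starting from outside, $m,a_3$ around $a_0$; $y,x$ around $a_2$; $a_0,y,y$ around $a_3$; its mate is the same graph with the colors of $ma_1,ma_0,a_0a_3$ changed. The \emph{negative} of a coin is obtained by interchanging black and gray. The \emph{dual} (or \emph{starred}) coin is obtained by passing to the plane dual and interchanging black and gray: the regions of the coin become vertices, and, for $k\ge1$, the region at the boundary arc from $a_i$ to $a_{i+1}$ becomes the $i$-th attachment vertex. (For $\mu_{10}$ the dual of the edge is an isolated vertex with a loop, and the dual of the empty coin is empty.) Mates of negative or dual coins are the negatives or duals of mates. In each family a move and its inverse, positive or negative, starred or not, give $8$ moves, so there are $64$ named coins (not necessarily distinct) and $64$ moves, each replacing one named coin by its mate. The \emph{reduced} set consists of the moves without star and of the moves $\pm\mu_{20}^\star,\pm\mu_{02}^\star$. \textbf{Statement.} The reduced set consists of $36$ moves on $36$ named coins. For any set of moves, call $B'$ obtainable from $B$ if it results from $B$ by a finite sequence of moves of the set (and isotopies of the plane). Obtainability by the reduced moves is an equivalence relation on blinks, and for all blinks $B,B'$: $B'$ is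 obtainable from $B$ by the $36$ reduced moves if and only if it is obtainable from $B$ by all $64$ moves. -/

import Mathlib

namespace BlinkCalculus

/-! ## Blinks

A plane graph (finite; loops, parallel edges, several components and isolated vertices allowed; the
empty graph included), up to isotopy of the oriented plane, is encoded by the combinatorial data of
its embedding.

* Each edge gives two darts (half-edges), exchanged by `opp`.
* `rot` sends a dart to the next dart counterclockwise around the same vertex. The vertices are the
  cycles of `rot`.
* `face d` is the face that contains the corner immediately counterclockwise after `d`, in other
  words the face on the left of `d` when one leaves the vertex along `d`.
* `outer` is the unbounded face.
* A dart with `opp d = d` is a *blank*: it belongs to no edge and only marks a corner at a vertex.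
  An isolated vertex is a cycle consisting of blanks. Blanks at other vertices carry no
  information; `Isotopic` ignores them.

Faces are recorded separately, and not as orbits of darts, because a face of a disconnected plane
graph has several boundary components. -/

/-- The data of a graph with two-coloured edges on a surface with a marked face. -/
structure PreBlink where
  Dart : Type
  Face : Type
  rot : Equiv.Perm Dart
  opp : Dart → Dart
  black : Dart → Bool
  face : Dart → Face
  outer : Face

namespace PreBlink

variable (B : PreBlink)

/-- The vertices: the cycles of `rot`. -/
def Vertex : Type := Quotient (Equiv.Perm.SameCycle.setoid B.rot)

/-- The vertex from which a dart leaves. -/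
def vertex (d : B.Dart) : B.Vertex := Quotient.mk (Equiv.Perm.SameCycle.setoid B.rot) d

/-- The darts that belong to edges; the number of edges is half their number. -/
def EdgeDart : Type := {d : B.Dart // B.opp d ≠ d}

/-- The connected components of the graph. -/
def Component : Type := Quot fun d d' : B.Dart => d' = B.rot d ∨ d' = B.opp d

/-- `e` is the first dart of an edge after `d` counterclockwise around the vertex of `d`. -/
def NextEdgeDart (d e : B.EdgeDart) : Prop :=
  ∃ n : ℕ, (B.rot ^ (n + 1)) d.1 = e.1 ∧
    ∀ m < n, B.opp ((B.rot ^ (m + 1)) d.1) = (B.rot ^ (m + 1)) d.1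

/-- The vertex `v` lies on the boundary of the face `f`. -/
def Incident (v : B.Vertex) (f : B.Face) : Prop := ∃ d, B.vertex d = v ∧ B.face d = f

/-- The data describe a graph embedded in the plane. Walking along the boundary of a face one stays
in that face; the components and the faces form a connected pattern (one can go from each face to
each other face through components that are incident with both); and Euler's formula
`V - E + F = 1 + C` holds, where `C` is the number of components. -/
structure IsPlane : Prop where
  finite_dart : Finite B.Dart
  finite_face : Finite B.Face
  opp_opp : ∀ d, B.opp (B.opp d) = d
  black_opp : ∀ d, B.black (B.opp d) = B.black d
  face_walk : ∀ d, B.face (B.rot⁻¹ (B.opp d)) = B.face d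
  connected : ∀ f g : B.Face, Relation.EqvGen
    (fun f g => ∃ d, B.face d = f ∧ (B.face (B.rot d) = g ∨ B.face (B.opp d) = g)) f g
  euler : 2 * Nat.card B.Vertex + 2 * Nat.card B.Face =
    Nat.card B.EdgeDart + 2 * Nat.card B.Component + 2

/-- The two data describe the same two-coloured plane graph up to isotopy of the plane:
there are bijections of vertices, of darts of edges and of faces that preserve the ends of
edges, colours, the counterclockwise order around each vertex, the face on the left of each dart,
the position of the isolated vertices, and the unbounded face. -/
def Isotopic (B C : PreBlink) : Prop :=
  ∃ (eV : B.Vertex ≃ C.Vertex) (eD : B.EdgeDart ≃ C.EdgeDart) (eF : B.Face ≃ C.Face),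
    (∀ d, C.vertex (eD d).1 = eV (B.vertex d.1)) ∧
    (∀ d d', B.opp d.1 = d'.1 ↔ C.opp (eD d).1 = (eD d').1) ∧
    (∀ d, C.black (eD d).1 = B.black d.1) ∧
    (∀ d d', B.NextEdgeDart d d' ↔ C.NextEdgeDart (eD d) (eD d')) ∧
    (∀ d, C.face (eD d).1 = eF (B.face d.1)) ∧
    (∀ v f, B.Incident v f ↔ C.Incident (eV v) (eF f)) ∧
    C.outer = eF B.outer

end PreBlink

/-- A blink: a finite plane graph with a bipartition of its edges into black and gray ones. -/
structure Blink extends PreBlink where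
  plane : toPreBlink.IsPlane

/-! ## Coins and their exteriors

A coin lies in a closed disk and meets the boundary of the disk in `k` attachment vertices,
numbered `0, …, k-1` counterclockwise. At each attachment vertex there is a blank, the *port*, that
points from the coin across the boundary of the disk. Likewise the exterior of the disk has at each
attachment vertex a port that points into the disk. -/

/-- A part of a plane graph, with ports at its `k` attachment vertices. The field `hole` matters
only if `k = 0`; then it is the face that contains the boundary of the disk. -/
structure Patch (k : ℕ) where
  Dart : Type
  Face : Type
  rot : Equiv.Perm Dart
  opp : Dart → Dart
  black : Dart → Bool
  face : Dart → Face
  port : Fin k → Dart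
  hole : Face

/-- The exterior of a disk in which a coin is to be placed: an arbitrary two-coloured plane graph
drawn outside of the disk that meets the boundary of the disk in (at most) the `k` distinct
attachment vertices. By `port_walk` the region between two consecutive attachment vertices
is bounded by their ports. -/
structure Exterior (k : ℕ) extends Patch k where
  outer : Face
  finite_dart : Finite Dart
  finite_face : Finite Face
  opp_opp : ∀ d, opp (opp d) = d
  black_opp : ∀ d, black (opp d) = black d
  opp_port : ∀ i, opp (port i) = port i
  port_distinct : ∀ i j, rot.SameCycle (port i) (port j) → i = j
  face_walk : ∀ d, (∀ i, d ≠ port i) → face (rot⁻¹ (opp d)) = face d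
  port_walk : ∀ i, face (port (finRotate k i)) = face (rot⁻¹ (port i))

section Fill

variable {k : ℕ} (X : Exterior k) (T : Patch k)

/-- The involution that exchanges corresponding ports of the exterior and of the coin. -/
noncomputable def crossPorts : Equiv.Perm (X.Dart ⊕ T.Dart) :=
  letI := Classical.decEq (X.Dart ⊕ T.Dart)
  ((List.finRange k).map fun i => Equiv.swap (Sum.inl (X.port i)) (Sum.inr (T.port i))).prod

/-- The identification of faces along the boundary of the disk: on either side of an attachment
vertex a region of the exterior continues as a region of the coin. -/
inductive Seam : X.Face ⊕ T.Face → X.Face ⊕ T.Face → Prop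
  | left (i : Fin k) : Seam (Sum.inl (X.face (X.rot⁻¹ (X.port i)))) (Sum.inr (T.face (T.port i)))
  | right (i : Fin k) : Seam (Sum.inl (X.face (X.port i))) (Sum.inr (T.face (T.rot⁻¹ (T.port i))))
  | hole : k = 0 → Seam (Sum.inl X.hole) (Sum.inr T.hole)

/-- The graph obtained by placing the coin `T` in the exterior `X`. Around an attachment vertex
the darts of the exterior are followed by those of the coin, which are inserted at the port. The
ports remain as blanks. -/
noncomputable def fill : PreBlink where
  Dart := X.Dart ⊕ T.Dart
  Face := Quot (Seam X T)
  rot := Equiv.sumCongr X.rot T.rot * crossPorts X T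
  opp := Sum.map X.opp T.opp
  black := Sum.elim X.black T.black
  face := fun d => Quot.mk _ (Sum.map X.face T.face (crossPorts X T d))
  outer := Quot.mk _ (Sum.inl X.outer)

end Fill

/-- `B'` arises from `B` by replacing one occurrence of the coin `L` by the coin `R`. -/
def Replaces {k : ℕ} (L R : Patch k) (B B' : Blink) : Prop :=
  ∃ X : Exterior k, B.Isotopic (fill X L) ∧ B'.Isotopic (fill X R)

/-! ## The coins -/

/-- The darts of a coin with `e` edges and `k` attachment vertices: the two ends of each edge,
and the ports. -/
abbrev CoinDart (e k : ℕ) : Type := (Fin e × Bool) ⊕ Fin k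

/-- A coin, given by the counterclockwise order of darts at its vertices and by the colours of its
edges. `outside` is a dart (if there is any) on whose left there is a face that meets the boundary
of the disk. -/
structure Coin (k : ℕ) where
  edges : ℕ
  rot : Equiv.Perm (CoinDart edges k)
  black : Fin edges → Bool
  outside : Option (CoinDart edges k)

namespace Coin

variable {k : ℕ} (c : Coin k)

/-- Exchanges the two darts of each edge, and moves each port to the next port. -/
def turn : Equiv.Perm (CoinDart c.edges k) :=
  Equiv.sumCongr (Equiv.prodCongr (Equiv.refl _) Equiv.boolNot) (finRotate k)

/-- The regions of a coin, obtained by walking around their boundaries. From the port of an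
attachment vertex one continues along the boundary of the disk to the next attachment vertex. -/
inductive Walk : Option (CoinDart c.edges k) → Option (CoinDart c.edges k) → Prop
  | step (d) : Walk (some d) (some (c.rot⁻¹ (c.turn d)))
  | outside : Walk none c.outside

/-- The coin as a part of a plane graph. -/
def toPatch : Patch k where
  Dart := CoinDart c.edges k
  Face := Quot c.Walk
  rot := c.rot
  opp := Sum.map (Prod.map id not) id
  black := Sum.elim (fun d => c.black d.1) fun _ => false
  face := fun d => Quot.mk _ (some d)
  port := Sum.inr
  hole := Quot.mk _ none

/-- The coin with the colours interchanged. -/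
def neg : Coin k := { c with black := fun e => !c.black e }

/-- The plane dual of a coin, with the colours interchanged. The vertices of the dual are the
regions of the coin; the region between the attachment vertices `i` and `i + 1` becomes the
attachment vertex `i`. -/
def dual : Coin k where
  edges := c.edges
  rot := c.rot⁻¹ * c.turn
  black := fun e => !c.black e
  outside := c.outside

end Coin

/-- The dart of the edge `j` at its first end. -/
abbrev o {e k : ℕ} (j : Fin e) : CoinDart e k := Sum.inl (j, false)

/-- The dart of the edge `j` at its second end. -/
abbrev i {e k : ℕ} (j : Fin e) : CoinDart e k := Sum.inl (j, true)

/-- The port at the attachment vertex `j`. -/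
abbrev p {e k : ℕ} (j : Fin k) : CoinDart e k := Sum.inr j

/-- The permutation with the given disjoint cycles. -/
def cycles {e k : ℕ} (l : List (List (CoinDart e k))) : Equiv.Perm (CoinDart e k) :=
  (l.map List.formPerm).prod

/-- The eight families of moves; `m a b` replaces a coin with `a` edges by one with `b` edges. -/
inductive Family
  | m20 | m33 | m10 | m11 | m31 | m54 | m66 | m99
  deriving DecidableEq

instance : Fintype Family where
  elems := {.m20, .m33, .m10, .m11, .m31, .m54, .m66, .m99}
  complete := by intro f; cases f <;> decide

/-- The number of attachment vertices. -/
def Family.arity : Family → ℕ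
  | m20 => 2
  | m33 => 3
  | m10 => 0
  | m11 => 1
  | m31 => 1
  | m54 => 2
  | m66 => 3
  | m99 => 4

/-- The left coins (positive, not starred). -/
def Family.left : (f : Family) → Coin f.arity
  | m20 => -- a path of two edges of different colours between the attachment vertices
    { edges := 2
      rot := cycles (k := 2) [[p 0, o 0], [i 0, o 1], [i 1, p 1]]
      black := ![true, false]
      outside := some (p (k := 2) 0) }
  | m33 => -- a star with three rays, two black and one gray
    { edges := 3
      rot := cycles (k := 3) [[p 0, o 0], [p 1, o 1], [p 2, o 2], [i 0, i 1, i 2]]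
      black := ![true, true, false]
      outside := some (p (k := 3) 0) }
  | m10 => -- an isolated edge
    { edges := 1
      rot := cycles (k := 0) [[o 0], [i 0]]
      black := ![true]
      outside := some (o 0) }
  | m11 => -- a pendant edge
    { edges := 1
      rot := cycles (k := 1) [[p 0, o 0], [i 0]]
      black := ![true]
      outside := some (p (k := 1) 0) }
  | m31 => -- two parallel edges to a vertex that carries a pendant edge
    { edges := 3
      rot := cycles (k := 1) [[p 0, o 0, o 1], [i 1, i 0, o 2], [i 2]]
      black := ![true, true, true]
      outside := some (p (k := 1) 0) }
  | m54 => -- a 4-cycle, whose first new vertex carries a pendant edge on the outside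
    { edges := 5
      rot := cycles (k := 2) [[p 0, o 0, o 2], [p 1, i 3, i 1], [o 4, o 1, i 0], [i 2, o 3], [i 4]]
      black := ![true, true, false, false, true]
      outside := some (p (k := 2) 0) }
  | m66 =>
    { edges := 6
      rot := cycles (k := 3) [[p 0, o 1], [p 1, o 0], [p 2, i 5, i 3], [i 1, i 0, o 2, o 4],
        [i 2, o 3], [i 4, o 5]]
      black := ![true, false, true, true, false, false]
      outside := some (p (k := 3) 0) }
  | m99 =>
    { edges := 9
      rot := cycles (k := 4) [[p 0, o 1, o 2], [p 1, o 0], [p 2, i 7, i 6], [p 3, i 2, i 5, i 8],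
        [i 1, i 0, o 3, o 4], [i 3, o 6], [o 5, i 4, o 7, o 8]]
      black := ![true, false, true, true, false, true, true, false, true]
      outside := some (p (k := 4) 0) }

/-- The right coins (positive, not starred). -/
def Family.right : (f : Family) → Coin f.arity
  | m20 => -- a single vertex, which fills both attachment vertices
    { edges := 0
      rot := cycles (k := 2) [[p 0, p 1]]
      black := ![]
      outside := some (p (k := 2) 0) }
  | m33 => -- the triangle, each edge coloured differently from the ray to the opposite vertex
    { edges := 3
      rot := cycles (k := 3) [[p 0, o 2, i 1], [p 1, o 0, i 2], [p 2, o 1, i 0]]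
      black := ![false, false, true]
      outside := some (p (k := 3) 0) }
  | m10 => -- the empty coin
    { edges := 0
      rot := cycles (k := 0) []
      black := ![]
      outside := none }
  | m11 => -- a loop
    { edges := 1
      rot := cycles (k := 1) [[p 0, o 0, i 0]]
      black := ![false]
      outside := some (p (k := 1) 0) }
  | m31 => -- a pendant edge
    { edges := 1
      rot := cycles (k := 1) [[p 0, o 0], [i 0]]
      black := ![false]
      outside := some (p (k := 1) 0) }
  | m54 => -- a path of two edges, and at its first vertex a pendant edge on either side
    { edges := 4
      rot := cycles (k := 2) [[p 0, o 2, o 0, o 3], [i 0, o 1], [p 1, i 1], [i 2], [i 3]]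
      black := ![true, true, false, false]
      outside := some (p (k := 2) 0) }
  | m66 => -- the left coin with the colours of the edges 0 and 1 changed
    { edges := 6
      rot := cycles (k := 3) [[p 0, o 1], [p 1, o 0], [p 2, i 5, i 3], [i 1, i 0, o 2, o 4],
        [i 2, o 3], [i 4, o 5]]
      black := ![false, true, true, true, false, false]
      outside := some (p (k := 3) 0) }
  | m99 => -- the left coin with the colours of the edges 0, 1 and 2 changed
    { edges := 9
      rot := cycles (k := 4) [[p 0, o 1, o 2], [p 1, o 0], [p 2, i 7, i 6], [p 3, i 2, i 5, i 8],
        [i 1, i 0, o 3, o 4], [i 3, o 6], [o 5, i 4, o 7, o 8]]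
      black := ![false, true, false, true, false, true, true, false, true]
      outside := some (p (k := 4) 0) }

/-! ## The moves -/

/-- The name of one of the 64 coins. -/
structure CoinName where
  family : Family
  isRight : Bool
  negative : Bool
  starred : Bool
  deriving DecidableEq, Fintype

/-- The other coin of the left-right pair. -/
def CoinName.mate (n : CoinName) : CoinName := { n with isRight := !n.isRight }

/-- The coin with a given name. -/
def CoinName.coin (n : CoinName) : Coin n.family.arity :=
  let c := if n.isRight then n.family.right else n.family.left
  let c := if n.negative then c.neg else c
  if n.starred then c.dual else c

/-- One of the 64 moves: it replaces the coin `source` by its mate. -/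
structure Move where
  source : CoinName
  deriving DecidableEq, Fintype

/-- The coin that a move puts in place of its source. -/
def Move.target (m : Move) : CoinName := m.source.mate

/-- The blink `B'` arises from `B` by the move `m`. -/
def Move.Applies (m : Move) (B B' : Blink) : Prop :=
  Replaces m.source.coin.toPatch m.target.coin.toPatch B B'

/-- All moves of the coin calculus. -/
def allMoves : Finset Move := Finset.univ

/-- The moves of the reduced coin calculus: those that are not starred, and the starred moves of
the family `m20`. -/
def reducedMoves : Finset Move :=
  Finset.univ.filter fun m => m.source.starred = false ∨ m.source.family = Family.m20

/-- The coins that occur in a set of moves. -/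
def coinsOf (S : Finset Move) : Finset CoinName :=
  S.image Move.source ∪ S.image Move.target

/-- `B'` can be obtained from `B` by a finite sequence of isotopies of the plane and of moves
from `S`. -/
def Obtainable (S : Finset Move) : Blink → Blink → Prop :=
  Relation.ReflTransGen fun B B' => B.Isotopic B'.toPreBlink ∨ ∃ m ∈ S, m.Applies B B'

end BlinkCalculus

namespace BlinkCalculus

open Equiv Function

/-! ## Crossing the boundary of a disk -/

section Cross

variable {α β ι : Type} [DecidableEq (α ⊕ β)] {a : ι → α} {b : ι → β}

theorem prod_swap_apply_of_forall_ne (l : List ι) (z : α ⊕ β) (hz : ∀ t ∈ l, z ≠ Sum.inl (a t))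
    (hz' : ∀ t ∈ l, z ≠ Sum.inr (b t)) :
    (l.map fun t => swap (Sum.inl (a t) : α ⊕ β) (Sum.inr (b t))).prod z = z := by
  induction l with
  | nil => rfl
  | cons s l ih =>
    rw [List.map_cons, List.prod_cons, Perm.mul_apply,
      ih (fun t ht => hz t (List.mem_cons_of_mem _ ht))
        (fun t ht => hz' t (List.mem_cons_of_mem _ ht))]
    exact swap_apply_of_ne_of_ne (hz s List.mem_cons_self) (hz' s List.mem_cons_self)

theorem prod_swap_apply_pair (ha : Injective a) (hb : Injective b) {l : List ι} (hl : l.Nodup)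
    {t : ι} (ht : t ∈ l) :
    (l.map fun t => swap (Sum.inl (a t) : α ⊕ β) (Sum.inr (b t))).prod (Sum.inl (a t)) =
        Sum.inr (b t) ∧
      (l.map fun t => swap (Sum.inl (a t) : α ⊕ β) (Sum.inr (b t))).prod (Sum.inr (b t)) =
        Sum.inl (a t) := by
  induction l with
  | nil => cases ht
  | cons s l ih =>
    rw [List.nodup_cons] at hl
    simp only [List.map_cons, List.prod_cons, Perm.mul_apply]
    by_cases hs : t = s
    · subst hs
      have hne : ∀ u ∈ l, t ≠ u := fun u hu h => hl.1 (h ▸ hu)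
      rw [prod_swap_apply_of_forall_ne l (Sum.inl (a t))
          (fun u hu h => hne u hu (ha (Sum.inl_injective h))) (fun u _ h => by cases h),
        prod_swap_apply_of_forall_ne l (Sum.inr (b t)) (fun u _ h => by cases h)
          (fun u hu h => hne u hu (hb (Sum.inr_injective h)))]
      exact ⟨swap_apply_left _ _, swap_apply_right _ _⟩
    · have htl : t ∈ l := (List.mem_cons.1 ht).resolve_left hs
      rw [(ih hl.2 htl).1, (ih hl.2 htl).2]
      refine ⟨swap_apply_of_ne_of_ne (fun h => by cases h) fun h => hs (hb (Sum.inr_injective h)),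
        swap_apply_of_ne_of_ne (fun h => hs (ha (Sum.inl_injective h))) fun h => by cases h⟩

end Cross

section Fill

variable {k : ℕ} (X : Exterior k) (T : Patch k)

theorem Exterior.port_injective : Injective X.port := fun a b h =>
  X.port_distinct a b (h ▸ Perm.SameCycle.refl _ _)

theorem crossPorts_inl_of_ne {x : X.Dart} (hx : ∀ t, x ≠ X.port t) :
    crossPorts X T (Sum.inl x) = Sum.inl x :=
  letI := Classical.decEq (X.Dart ⊕ T.Dart)
  prod_swap_apply_of_forall_ne _ _ (fun t _ h => hx t (Sum.inl_injective h))
    fun _ _ h => by cases h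

theorem crossPorts_inr_of_ne {x : T.Dart} (hx : ∀ t, x ≠ T.port t) :
    crossPorts X T (Sum.inr x) = Sum.inr x :=
  letI := Classical.decEq (X.Dart ⊕ T.Dart)
  prod_swap_apply_of_forall_ne _ _ (fun _ _ h => by cases h)
    fun t _ h => hx t (Sum.inr_injective h)

variable {T}

theorem crossPorts_inl_port (hT : Injective T.port) (t : Fin k) :
    crossPorts X T (Sum.inl (X.port t)) = Sum.inr (T.port t) :=
  letI := Classical.decEq (X.Dart ⊕ T.Dart)
  (prod_swap_apply_pair X.port_injective hT (List.nodup_finRange k) (List.mem_finRange t)).1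

theorem crossPorts_inr_port (hT : Injective T.port) (t : Fin k) :
    crossPorts X T (Sum.inr (T.port t)) = Sum.inl (X.port t) :=
  letI := Classical.decEq (X.Dart ⊕ T.Dart)
  (prod_swap_apply_pair X.port_injective hT (List.nodup_finRange k) (List.mem_finRange t)).2

theorem fill_rot_inl_of_ne {x : X.Dart} (hx : ∀ t, x ≠ X.port t) :
    (fill X T).rot (Sum.inl x) = Sum.inl (X.rot x) := by
  change (Equiv.sumCongr X.rot T.rot) (crossPorts X T (Sum.inl x)) = _
  rw [crossPorts_inl_of_ne X T hx]; rfl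

theorem fill_rot_inr_of_ne {x : T.Dart} (hx : ∀ t, x ≠ T.port t) :
    (fill X T).rot (Sum.inr x) = Sum.inr (T.rot x) := by
  change (Equiv.sumCongr X.rot T.rot) (crossPorts X T (Sum.inr x)) = _
  rw [crossPorts_inr_of_ne X T hx]; rfl

theorem fill_rot_inl_port (hT : Injective T.port) (t : Fin k) :
    (fill X T).rot (Sum.inl (X.port t)) = Sum.inr (T.rot (T.port t)) := by
  change (Equiv.sumCongr X.rot T.rot) (crossPorts X T (Sum.inl _)) = _
  rw [crossPorts_inl_port X hT]; rfl

theorem fill_rot_inr_port (hT : Injective T.port) (t : Fin k) :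
    (fill X T).rot (Sum.inr (T.port t)) = Sum.inl (X.rot (X.port t)) := by
  change (Equiv.sumCongr X.rot T.rot) (crossPorts X T (Sum.inr _)) = _
  rw [crossPorts_inr_port X hT]; rfl

theorem fill_face_inl_of_ne {x : X.Dart} (hx : ∀ t, x ≠ X.port t) :
    (fill X T).face (Sum.inl x) = Quot.mk _ (Sum.inl (X.face x)) := by
  change Quot.mk _ (Sum.map X.face T.face (crossPorts X T (Sum.inl x))) = _
  rw [crossPorts_inl_of_ne X T hx]; rfl

theorem fill_face_inr_of_ne {x : T.Dart} (hx : ∀ t, x ≠ T.port t) :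
    (fill X T).face (Sum.inr x) = Quot.mk _ (Sum.inr (T.face x)) := by
  change Quot.mk _ (Sum.map X.face T.face (crossPorts X T (Sum.inr x))) = _
  rw [crossPorts_inr_of_ne X T hx]; rfl

theorem fill_face_inl_port (hT : Injective T.port) (t : Fin k) :
    (fill X T).face (Sum.inl (X.port t)) = Quot.mk _ (Sum.inr (T.face (T.port t))) := by
  change Quot.mk _ (Sum.map X.face T.face (crossPorts X T (Sum.inl _))) = _
  rw [crossPorts_inl_port X hT]; rfl

theorem fill_face_inr_port (hT : Injective T.port) (t : Fin k) :
    (fill X T).face (Sum.inr (T.port t)) = Quot.mk _ (Sum.inl (X.face (X.port t))) := by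
  change Quot.mk _ (Sum.map X.face T.face (crossPorts X T (Sum.inr _))) = _
  rw [crossPorts_inr_port X hT]; rfl

theorem fill_face_rot_inv (z : X.Dart ⊕ T.Dart) : (fill X T).face ((fill X T).rot⁻¹ z) =
    Quot.mk _ (Sum.map X.face T.face ((Equiv.sumCongr X.rot T.rot)⁻¹ z)) := by
  have h : (fill X T).rot⁻¹ z =
      (crossPorts X T)⁻¹ ((Equiv.sumCongr X.rot T.rot)⁻¹ z) := by
    change (Equiv.sumCongr X.rot T.rot * crossPorts X T)⁻¹ z = _
    rw [mul_inv_rev]; rfl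
  rw [h]
  change Quot.mk _ (Sum.map X.face T.face (crossPorts X T ((crossPorts X T)⁻¹ _))) = _
  exact congrArg (fun w => Quot.mk _ (Sum.map X.face T.face w)) ((crossPorts X T).apply_symm_apply _)

theorem fill_face_rot_inv_inl (x : X.Dart) : (fill X T).face ((fill X T).rot⁻¹ (Sum.inl x)) =
    Quot.mk _ (Sum.inl (X.face (X.rot⁻¹ x))) :=
  fill_face_rot_inv X _

theorem fill_face_rot_inv_inr (x : T.Dart) : (fill X T).face ((fill X T).rot⁻¹ (Sum.inr x)) =
    Quot.mk _ (Sum.inr (T.face (T.rot⁻¹ x))) :=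
  fill_face_rot_inv X _

theorem fill_face_walk_inl (hT : Injective T.port) (x : X.Dart) :
    (fill X T).face ((fill X T).rot⁻¹ ((fill X T).opp (Sum.inl x))) =
      (fill X T).face (Sum.inl x) := by
  change (fill X T).face ((fill X T).rot⁻¹ (Sum.inl (X.opp x))) = _
  rw [fill_face_rot_inv_inl]
  by_cases hx : ∃ t, x = X.port t
  · obtain ⟨t, rfl⟩ := hx
    rw [fill_face_inl_port X hT, X.opp_port]
    exact Quot.sound (Seam.left t)
  · push Not at hx
    rw [fill_face_inl_of_ne X hx, X.face_walk x hx]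

end Fill

/-- The local conditions on a part of a plane graph that fills a disk. -/
structure Patch.IsLocal {k : ℕ} (T : Patch k) : Prop where
  finite_dart : Finite T.Dart
  finite_face : Finite T.Face
  opp_opp : ∀ d, T.opp (T.opp d) = d
  black_opp : ∀ d, T.black (T.opp d) = T.black d
  opp_port : ∀ t, T.opp (T.port t) = T.port t
  port_injective : Injective T.port
  face_walk : ∀ d, (∀ t, d ≠ T.port t) → T.face (T.rot⁻¹ (T.opp d)) = T.face d

section Fill

variable {k : ℕ} (X : Exterior k) {T : Patch k}

theorem Patch.IsLocal.fill_face_walk (hT : T.IsLocal) (d : (fill X T).Dart) :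
    (fill X T).face ((fill X T).rot⁻¹ ((fill X T).opp d)) = (fill X T).face d := by
  rcases d with x | x
  · exact fill_face_walk_inl X hT.port_injective x
  · change (fill X T).face ((fill X T).rot⁻¹ (Sum.inr (T.opp x))) = _
    rw [fill_face_rot_inv_inr]
    by_cases hx : ∃ t, x = T.port t
    · obtain ⟨t, rfl⟩ := hx
      rw [fill_face_inr_port X hT.port_injective, hT.opp_port]
      exact (Quot.sound (Seam.right t)).symm
    · push Not at hx
      rw [fill_face_inr_of_ne X hx, hT.face_walk x hx]

end Fill

/-! ## Isotopies -/

namespace PreBlink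

theorem Isotopic.symm {B C : PreBlink} (h : B.Isotopic C) : C.Isotopic B := by
  obtain ⟨eV, eD, eF, h1, h2, h3, h4, h5, h6, h7⟩ := h
  refine ⟨eV.symm, eD.symm, eF.symm, fun d => ?_, fun d d' => ?_, fun d => ?_, fun d d' => ?_,
    fun d => ?_, fun v f => ?_, ?_⟩
  · rw [Equiv.eq_symm_apply, ← h1, Equiv.apply_symm_apply]
  · rw [h2, Equiv.apply_symm_apply, Equiv.apply_symm_apply]
  · rw [← h3, Equiv.apply_symm_apply]
  · rw [h4, Equiv.apply_symm_apply, Equiv.apply_symm_apply]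
  · rw [Equiv.eq_symm_apply, ← h5, Equiv.apply_symm_apply]
  · rw [h6, Equiv.apply_symm_apply, Equiv.apply_symm_apply]
  · rw [h7, Equiv.symm_apply_apply]

/-- `e` comes after `d` around the vertex of `d`, and there are only blanks in between. -/
def Next (B : PreBlink) (d e : B.Dart) : Prop :=
  ∃ n : ℕ, (B.rot ^ (n + 1)) d = e ∧
    ∀ m < n, B.opp ((B.rot ^ (m + 1)) d) = (B.rot ^ (m + 1)) d

theorem Next.trans {B : PreBlink} {d e f : B.Dart} (h : B.Next d e) (he : B.opp e = e)
    (h' : B.Next e f) : B.Next d f := by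
  obtain ⟨n, hn, hn'⟩ := h
  obtain ⟨m, hm, hm'⟩ := h'
  have key : ∀ l, (B.rot ^ (l + 1 + (n + 1))) d = (B.rot ^ (l + 1)) e := fun l => by
    rw [pow_add, Perm.mul_apply, hn]
  refine ⟨m + 1 + n, ?_, fun l hl => ?_⟩
  · rw [show m + 1 + n + 1 = m + 1 + (n + 1) by ring, key, hm]
  · rcases lt_trichotomy l n with h | h | h
    · exact hn' l h
    · subst h; rw [hn, he]
    · obtain ⟨q, rfl⟩ : ∃ q, l = q + n + 1 := ⟨l - n - 1, by omega⟩
      rw [show q + n + 1 + 1 = q + 1 + (n + 1) by ring, key]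
      exact hm' q (by omega)

theorem Next.unique {B : PreBlink} {d e e' : B.Dart} (h : B.Next d e) (h' : B.Next d e')
    (he : B.opp e ≠ e) (he' : B.opp e' ≠ e') : e = e' := by
  obtain ⟨n, hn, hn'⟩ := h
  obtain ⟨m, hm, hm'⟩ := h'
  rcases lt_trichotomy n m with h | h | h
  · exact absurd (hn ▸ hm' n h) he
  · rw [← hn, ← hm, h]
  · exact absurd (hm ▸ hn' m h) he'

theorem exists_next {B : PreBlink} [Finite B.Dart] {d : B.Dart} (hd : B.opp d ≠ d) :
    ∃ e, B.opp e ≠ e ∧ B.Next d e := by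
  classical
  have hex : ∃ n : ℕ, B.opp ((B.rot ^ (n + 1)) d) ≠ (B.rot ^ (n + 1)) d := by
    have := isOfFinOrder_of_finite B.rot
    refine ⟨orderOf B.rot - 1, ?_⟩
    rw [Nat.sub_add_cancel this.orderOf_pos, pow_orderOf_eq_one]
    exact hd
  exact ⟨_, Nat.find_spec hex, Nat.find hex, rfl, fun m hm => not_not.1 (Nat.find_min hex hm)⟩

/-- Each corner belongs to the same face as the corner after an earlier dart that is kept. -/
theorem exists_face_eq {α : Type} {P : PreBlink} [Finite P.Dart] (j : α → P.Dart)
    (hblankface : ∀ x, (∀ d, x ≠ j d) → P.face (P.rot⁻¹ x) = P.face x) {d : α} {x : P.Dart}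
    (hd : P.rot.SameCycle (j d) x) :
    ∃ e, P.rot.SameCycle (j e) x ∧ P.face (j e) = P.face x := by
  have key : ∀ (N : ℕ) x, (P.rot ^ N) (j d) = x →
      ∃ e, P.rot.SameCycle (j e) x ∧ P.face (j e) = P.face x := by
    intro N
    induction N with
    | zero => rintro x rfl; exact ⟨d, Perm.SameCycle.refl _ _, rfl⟩
    | succ N ih =>
      intro x hx
      by_cases h : ∃ e, x = j e
      · obtain ⟨e, rfl⟩ := h
        exact ⟨e, Perm.SameCycle.refl _ _, rfl⟩
      · push Not at h
        obtain ⟨e, he, hef⟩ := ih (P.rot⁻¹ x) (by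
          rw [← hx, pow_succ', Perm.mul_apply]; exact (P.rot.symm_apply_apply _).symm)
        exact ⟨e, Perm.sameCycle_symm_apply_right.1 he, hef.trans (hblankface x h)⟩
  obtain ⟨N, -, -, hN⟩ := Perm.SameCycle.exists_pow_eq'' hd
  exact key N x hN

/-- Removing blanks gives an isotopic graph, if each vertex keeps a dart: `j` embeds the
remaining darts. -/
theorem isotopic_of_thin {Q P : PreBlink} [Finite Q.Dart] [Finite P.Dart] (j : Q.Dart → P.Dart)
    (eF : Q.Face ≃ P.Face) (hj : Injective j) (hopp : ∀ d, P.opp (j d) = j (Q.opp d))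
    (hblank : ∀ x, (∀ d, x ≠ j d) → P.opp x = x)
    (hblack : ∀ d, Q.opp d ≠ d → P.black (j d) = Q.black d)
    (hrot : ∀ d, ∃ n : ℕ, (P.rot ^ (n + 1)) (j d) = j (Q.rot d) ∧
      ∀ m < n, ∀ e, (P.rot ^ (m + 1)) (j d) ≠ j e)
    (hcover : ∀ x, ∃ d, P.rot.SameCycle (j d) x)
    (hface : ∀ d, P.face (j d) = eF (Q.face d))
    (hblankface : ∀ x, (∀ d, x ≠ j d) → P.face (P.rot⁻¹ x) = P.face x)
    (houter : P.outer = eF Q.outer) : Q.Isotopic P := by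
  have hstep : ∀ d, P.rot.SameCycle (j d) (j (Q.rot d)) := fun d => by
    obtain ⟨n, hn, -⟩ := hrot d
    exact ⟨(n + 1 : ℕ), by rw [zpow_natCast, hn]⟩
  have hpow : ∀ (n : ℕ) d, P.rot.SameCycle (j d) (j ((Q.rot ^ n) d)) := fun n => by
    induction n with
    | zero => exact fun d => Perm.SameCycle.refl _ _
    | succ n ih => exact fun d => by rw [pow_succ', Perm.mul_apply]; exact (ih d).trans (hstep _)
  have hinj : ∀ (N : ℕ) d d', (P.rot ^ N) (j d) = j d' → Q.rot.SameCycle d d' := by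
    intro N
    induction N using Nat.strong_induction_on with
    | _ N ih =>
      intro d d' h
      rcases Nat.eq_zero_or_pos N with rfl | hN
      · rw [hj h]
      · obtain ⟨n, hn, hn'⟩ := hrot d
        have hle : n + 1 ≤ N := by
          by_contra hlt
          exact hn' (N - 1) (by omega) d' (by rw [Nat.sub_add_cancel hN, h])
        have h2 : (P.rot ^ (N - (n + 1))) (j (Q.rot d)) = j d' := by
          rw [← hn, ← Perm.mul_apply, ← pow_add, Nat.sub_add_cancel hle, h]
        exact (Perm.sameCycle_apply_left).1 (ih _ (by omega) _ _ h2)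
  let fV : Q.Vertex → P.Vertex := Quotient.lift (fun d => P.vertex (j d)) fun d d' h => by
    obtain ⟨n, -, -, h⟩ := Perm.SameCycle.exists_pow_eq'' h
    exact Quotient.sound (h ▸ hpow n d)
  have hfV : Bijective fV := by
    constructor
    · rintro ⟨d⟩ ⟨d'⟩ h
      obtain ⟨n, -, -, h⟩ := Perm.SameCycle.exists_pow_eq'' (Quotient.exact h)
      exact Quotient.sound (hinj n d d' h)
    · rintro ⟨x⟩
      obtain ⟨d, hd⟩ := hcover x
      exact ⟨Q.vertex d, Quotient.sound hd⟩
  let fD : Q.EdgeDart → P.EdgeDart := fun d => ⟨j d.1, fun h => d.2 (hj ((hopp _).symm.trans h))⟩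
  have hfD : Bijective fD := by
    refine ⟨fun d d' h => Subtype.ext (hj (congrArg Subtype.val h)), fun ⟨x, hx⟩ => ?_⟩
    by_cases h : ∃ d, x = j d
    · obtain ⟨d, rfl⟩ := h
      exact ⟨⟨d, fun h => hx (by rw [hopp, h])⟩, rfl⟩
    · push Not at h
      exact absurd (hblank x h) hx
  have hnext1 : ∀ d, P.Next (j d) (j (Q.rot d)) := fun d => by
    obtain ⟨n, hn, hn'⟩ := hrot d
    exact ⟨n, hn, fun m hm => hblank _ (hn' m hm)⟩
  have hnext : ∀ (n : ℕ) d, (∀ m < n, Q.opp ((Q.rot ^ (m + 1)) d) = (Q.rot ^ (m + 1)) d) →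
      P.Next (j d) (j ((Q.rot ^ (n + 1)) d)) := fun n => by
    induction n with
    | zero => exact fun d _ => hnext1 d
    | succ n ih =>
      intro d h
      rw [pow_succ', Perm.mul_apply]
      exact (ih d fun m hm => h m (by omega)).trans (by rw [hopp, h n (by omega)]) (hnext1 _)
  have hnext2 : ∀ d e, Q.Next d e → P.Next (j d) (j e) := by
    rintro d e ⟨n, rfl, hn⟩
    exact hnext n d hn
  refine ⟨Equiv.ofBijective fV hfV, Equiv.ofBijective fD hfD, eF, fun d => rfl,
    fun d d' => ?_, fun d => hblack d.1 d.2, fun d d' => ⟨hnext2 d.1 d'.1, fun h => ?_⟩,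
    fun d => hface d.1, ?_, houter⟩
  · change _ ↔ P.opp (j d.1) = j d'.1
    rw [hopp]
    exact hj.eq_iff.symm
  · obtain ⟨e, he, hde⟩ := exists_next d.2
    have := Next.unique (hnext2 _ _ hde) h (fun h => he (hj ((hopp _).symm.trans h)))
      (fun h => d'.2 (hj ((hopp _).symm.trans h)))
    rw [hj this] at hde
    exact hde
  · rintro ⟨d⟩ f
    constructor
    · rintro ⟨e, he, rfl⟩
      exact ⟨j e, congrArg fV he, hface e⟩
    · rintro ⟨x, hx, hxf⟩
      obtain ⟨e, he, hef⟩ := exists_face_eq j hblankface (Quotient.exact hx).symm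
      refine ⟨e, hfV.1 ?_, eF.injective ?_⟩
      · exact (Quotient.sound he).trans hx
      · rw [← hface, hef, hxf]

end PreBlink

end BlinkCalculus

namespace BlinkCalculus

open Equiv Function

/-! ## Planarity of filled exteriors -/

section Fill

variable {k : ℕ} (X : Exterior k) {T : Patch k}

/-- The vertices of a part of a plane graph. -/
def Patch.Vertex (T : Patch k) : Type := Quotient (Perm.SameCycle.setoid T.rot)

/-- The vertex of a dart. -/
def Patch.vertex (T : Patch k) (d : T.Dart) : T.Vertex :=
  Quotient.mk (Perm.SameCycle.setoid T.rot) d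

/-- The faces of a part of a plane graph that meet the boundary of the disk. -/
def Patch.Boundary (T : Patch k) (f : T.Face) : Prop :=
  (∃ t, f = T.face (T.port t)) ∨ (k = 0 ∧ f = T.hole)

/-- A connected part of a plane graph that fills a disk: the regions at different arcs of the
boundary of the disk are different, and Euler's formula holds. -/
structure Patch.IsDisk (T : Patch k) : Prop extends T.IsLocal where
  nonempty : Nonempty T.Dart
  connected : ∀ d d', Relation.EqvGen (fun d d' => d' = T.rot d ∨ d' = T.opp d) d d'
  face_surjective : Surjective T.face
  port_walk : ∀ t, T.face (T.rot⁻¹ (T.port (finRotate k t))) = T.face (T.port t)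
  face_port_injective : Injective fun t => T.face (T.port t)
  euler : 2 * Nat.card T.Vertex + 2 * Nat.card {f // ¬ T.Boundary f} =
    Nat.card {d // T.opp d ≠ d} + 2

theorem fill_sameCycle_port (hT : Injective T.port) (t : Fin k) :
    (fill X T).rot.SameCycle (Sum.inr (T.port t)) (Sum.inl (X.port t)) := by
  classical
  have := X.finite_dart
  have hex : ∃ n : ℕ, (X.rot ^ (n + 1)) (X.port t) = X.port t := by
    have := isOfFinOrder_of_finite X.rot
    refine ⟨orderOf X.rot - 1, ?_⟩
    rw [Nat.sub_add_cancel this.orderOf_pos, pow_orderOf_eq_one]; rfl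
  have key : ∀ n ≤ Nat.find hex, (fill X T).rot.SameCycle (Sum.inr (T.port t))
      (Sum.inl ((X.rot ^ (n + 1)) (X.port t))) := by
    intro n
    induction n with
    | zero => exact fun _ => ⟨1, by rw [zpow_one, fill_rot_inr_port X hT]; rfl⟩
    | succ n ih =>
      intro hn
      refine (ih (by omega)).trans ⟨1, ?_⟩
      rw [zpow_one, fill_rot_inl_of_ne, ← Perm.mul_apply, ← pow_succ']
      intro s hs
      have h2 : X.rot.SameCycle (X.port t) (X.port s) :=
        ⟨(n + 1 : ℕ), by rw [zpow_natCast, hs]⟩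
      exact Nat.find_min hex (show n < Nat.find hex by omega)
        (by rw [hs, X.port_distinct _ _ h2])
  have := key _ le_rfl
  rwa [Nat.find_spec hex] at this

theorem fill_sameCycle_inl (hT : Injective T.port) (x : X.Dart) :
    (fill X T).rot.SameCycle (Sum.inl x) (Sum.inl (X.rot x)) := by
  by_cases hx : ∃ t, x = X.port t
  · obtain ⟨t, rfl⟩ := hx
    exact (fill_sameCycle_port X hT t).symm.trans
      ⟨1, by rw [zpow_one, fill_rot_inr_port X hT]⟩
  · push Not at hx
    exact ⟨1, by rw [zpow_one, fill_rot_inl_of_ne X hx]⟩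

theorem fill_sameCycle_inr (hT : Injective T.port) (x : T.Dart) :
    (fill X T).rot.SameCycle (Sum.inr x) (Sum.inr (T.rot x)) := by
  by_cases hx : ∃ t, x = T.port t
  · obtain ⟨t, rfl⟩ := hx
    exact (fill_sameCycle_port X hT t).trans
      ⟨1, by rw [zpow_one, fill_rot_inl_port X hT]⟩
  · push Not at hx
    exact ⟨1, by rw [zpow_one, fill_rot_inr_of_ne X hx]⟩

/-- A function that is constant along a permutation is constant on its cycles. -/
theorem eq_of_sameCycle {α β : Type} {f : Perm α} {g : α → β} (h : ∀ x, g (f x) = g x) {x y : α}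
    (hxy : f.SameCycle x y) : g x = g y := by
  have h1 : ∀ (n : ℕ) x, g ((f ^ n) x) = g x := fun n => by
    induction n with
    | zero => exact fun _ => rfl
    | succ n ih => exact fun x => by rw [pow_succ', Perm.mul_apply, h, ih]
  obtain ⟨n, rfl⟩ := hxy
  obtain ⟨m, rfl | rfl⟩ := n.eq_nat_or_neg
  · rw [zpow_natCast, h1]
  · have hx : (f ^ m) ((f ^ (-(m : ℤ))) x) = x := by
      rw [zpow_neg, zpow_natCast]; exact (f ^ m).apply_symm_apply x
    rw [← h1 m ((f ^ (-(m : ℤ))) x), hx]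

theorem sameCycle_of_step {α β : Type} {f : Perm α} {g : Perm β} {e : α → β}
    (h : ∀ x, g.SameCycle (e x) (e (f x))) {x y : α} (hxy : f.SameCycle x y) :
    g.SameCycle (e x) (e y) :=
  Quotient.exact (s := Perm.SameCycle.setoid g)
    (eq_of_sameCycle (g := fun x => Quotient.mk (Perm.SameCycle.setoid g) (e x))
      (fun x => (Quotient.sound (h x)).symm) hxy)

/-- The vertices of a filled exterior. -/
theorem exists_fill_vertex_equiv (hp : Injective T.port) :
    ∃ e : (fill X T).Vertex ≃
      T.Vertex ⊕ {v : X.toPatch.Vertex // ∀ t, v ≠ X.toPatch.vertex (X.port t)},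
    ∀ x, e ((fill X T).vertex (Sum.inr x)) = Sum.inl (T.vertex x) := by
  classical
  let ψ : X.toPatch.Vertex →
      T.Vertex ⊕ {v : X.toPatch.Vertex // ∀ t, v ≠ X.toPatch.vertex (X.port t)} := fun v =>
    if h : ∃ t, v = X.toPatch.vertex (X.port t) then Sum.inl (T.vertex (T.port h.choose))
    else Sum.inr ⟨v, fun t ht => h ⟨t, ht⟩⟩
  have hψ : ∀ t, ψ (X.toPatch.vertex (X.port t)) = Sum.inl (T.vertex (T.port t)) := fun t => by
    have h : ∃ s, X.toPatch.vertex (X.port t) = X.toPatch.vertex (X.port s) :=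
      ⟨t, rfl⟩
    have h2 : h.choose = t := (X.port_distinct _ _ (Quotient.exact h.choose_spec)).symm
    exact (dif_pos h).trans (by rw [h2])
  let Φ : (fill X T).Dart →
      T.Vertex ⊕ {v : X.toPatch.Vertex // ∀ t, v ≠ X.toPatch.vertex (X.port t)} :=
    Sum.elim (fun x => ψ (X.toPatch.vertex x)) fun x => Sum.inl (T.vertex x)
  have hX : ∀ x, X.toPatch.vertex (X.rot x) = X.toPatch.vertex x := fun x =>
    Quotient.sound (Perm.sameCycle_apply_left.2 (Perm.SameCycle.refl _ _))
  have hTr : ∀ x, T.vertex (T.rot x) = T.vertex x := fun x =>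
    Quotient.sound (Perm.sameCycle_apply_left.2 (Perm.SameCycle.refl _ _))
  have hΦ : ∀ z, Φ ((fill X T).rot z) = Φ z := by
    rintro (x | x)
    · by_cases hx : ∃ t, x = X.port t
      · obtain ⟨t, rfl⟩ := hx
        rw [fill_rot_inl_port X hp]
        exact (congrArg Sum.inl (hTr _)).trans (hψ t).symm
      · push Not at hx
        rw [fill_rot_inl_of_ne X hx]
        exact congrArg ψ (hX x)
    · by_cases hx : ∃ t, x = T.port t
      · obtain ⟨t, rfl⟩ := hx
        rw [fill_rot_inr_port X hp]
        exact (congrArg ψ (hX _)).trans (hψ t)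
      · push Not at hx
        rw [fill_rot_inr_of_ne X hx]
        exact congrArg Sum.inl (hTr x)
  let g1 : T.Vertex → (fill X T).Vertex := Quotient.map' Sum.inr fun _ _ h =>
    sameCycle_of_step (fill_sameCycle_inr X hp) h
  let g2 : X.toPatch.Vertex → (fill X T).Vertex := Quotient.map' Sum.inl fun _ _ h =>
    sameCycle_of_step (fill_sameCycle_inl X hp) h
  refine ⟨
    { toFun := Quotient.lift Φ fun _ _ h => eq_of_sameCycle hΦ h
      invFun := Sum.elim g1 fun v => g2 v.1
      left_inv := by
        rintro ⟨x | x⟩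
        · change Sum.elim g1 (fun v => g2 v.1) (ψ (X.toPatch.vertex x)) = g2 (X.toPatch.vertex x)
          by_cases h : ∃ t, X.toPatch.vertex x = X.toPatch.vertex (X.port t)
          · obtain ⟨t, ht⟩ := h
            rw [ht, hψ]
            exact Quotient.sound (fill_sameCycle_port X hp t)
          · have h2 : ψ (X.toPatch.vertex x) = Sum.inr ⟨X.toPatch.vertex x, fun t ht => h ⟨t, ht⟩⟩ :=
              dif_neg h
            rw [h2]; rfl
        · rfl
      right_inv := by
        rintro (x | ⟨⟨x⟩, hx⟩)
        · induction x using Quotient.inductionOn; rfl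
        · change ψ (X.toPatch.vertex x) = _
          have h : ¬ ∃ t, X.toPatch.vertex x = X.toPatch.vertex (X.port t) :=
            fun ⟨t, ht⟩ => hx t ht
          exact dif_neg h }, fun _ => rfl⟩

theorem card_fill_vertex (hT : T.IsLocal) : Nat.card (fill X T).Vertex = Nat.card T.Vertex +
    Nat.card {v : X.toPatch.Vertex // ∀ t, v ≠ X.toPatch.vertex (X.port t)} := by
  have := X.finite_dart
  have := hT.finite_dart
  have : Finite T.Vertex := Quotient.finite _
  have : Finite X.toPatch.Vertex := Quotient.finite _
  obtain ⟨e, -⟩ := exists_fill_vertex_equiv X hT.port_injective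
  rw [Nat.card_congr e, Nat.card_sum]

theorem sameCycle_of_fill_inr (hp : Injective T.port) {x y : T.Dart}
    (h : (fill X T).rot.SameCycle (Sum.inr x) (Sum.inr y)) : T.rot.SameCycle x y := by
  obtain ⟨e, he⟩ := exists_fill_vertex_equiv X hp
  have h1 : (fill X T).vertex (Sum.inr x) = (fill X T).vertex (Sum.inr y) := Quotient.sound h
  exact Quotient.exact (Sum.inl_injective ((he x).symm.trans ((congrArg e h1).trans (he y))))

/-- The faces of a filled exterior. -/
theorem card_fill_face (hT : T.IsDisk) : Nat.card (fill X T).Face = Nat.card X.Face +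
    Nat.card {f // ¬ T.Boundary f} := by
  classical
  have := X.finite_face
  have := hT.finite_face
  let ψ : T.Face → X.Face ⊕ {f // ¬ T.Boundary f} := fun f =>
    if h : ∃ t, f = T.face (T.port t) then Sum.inl (X.face (X.rot⁻¹ (X.port h.choose)))
    else if h' : k = 0 ∧ f = T.hole then Sum.inl X.hole
    else Sum.inr ⟨f, fun hf => hf.elim h h'⟩
  have hψ : ∀ t, ψ (T.face (T.port t)) = Sum.inl (X.face (X.rot⁻¹ (X.port t))) := fun t => by
    have h : ∃ s, T.face (T.port t) = T.face (T.port s) := ⟨t, rfl⟩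
    have h2 : h.choose = t := (hT.face_port_injective h.choose_spec).symm
    simp only [ψ, dif_pos h, h2]
  have hψ0 : k = 0 → ψ T.hole = Sum.inl X.hole := fun hk => by
    have h : ¬ ∃ t, T.hole = T.face (T.port t) := fun ⟨t, _⟩ => by subst hk; exact t.elim0
    have h' : k = 0 ∧ T.hole = T.hole := ⟨hk, rfl⟩
    exact (dif_neg h).trans (dif_pos h')
  let Φ : (fill X T).Face → X.Face ⊕ {f // ¬ T.Boundary f} :=
    Quot.lift (Sum.elim Sum.inl ψ) fun a b h => by
      cases h with
      | left t => exact (hψ t).symm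
      | right t =>
        obtain ⟨s, rfl⟩ := (finRotate k).surjective t
        change Sum.inl (X.face _) = ψ (T.face _)
        rw [hT.port_walk, hψ, X.port_walk]
      | hole hk => exact (hψ0 hk).symm
  have e : (fill X T).Face ≃ X.Face ⊕ {f // ¬ T.Boundary f} :=
    { toFun := Φ
      invFun := Sum.elim (fun f => Quot.mk _ (Sum.inl f)) fun f => Quot.mk _ (Sum.inr f.1)
      left_inv := by
        rintro ⟨f | f⟩
        · rfl
        · change Sum.elim (fun f => Quot.mk _ (Sum.inl f)) (fun f => Quot.mk _ (Sum.inr f.1))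
            (ψ f) = Quot.mk _ (Sum.inr f)
          by_cases h : ∃ t, f = T.face (T.port t)
          · obtain ⟨t, rfl⟩ := h
            rw [hψ]
            exact Quot.sound (Seam.left t)
          · by_cases h' : k = 0 ∧ f = T.hole
            · obtain ⟨hk, rfl⟩ := h'
              rw [hψ0 hk]
              exact Quot.sound (Seam.hole hk)
            · simp only [ψ, dif_neg h, dif_neg h']; rfl
      right_inv := by
        rintro (f | ⟨f, hf⟩)
        · rfl
        · change ψ f = _
          have h : ¬ ∃ t, f = T.face (T.port t) := fun h => hf (Or.inl h)
          have h' : ¬ (k = 0 ∧ f = T.hole) := fun h => hf (Or.inr h)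
          simp only [ψ, dif_neg h, dif_neg h'] }
  rw [Nat.card_congr e, Nat.card_sum]

theorem card_fill_edgeDart (hT : Finite T.Dart) : Nat.card (fill X T).EdgeDart =
    Nat.card {d // X.opp d ≠ d} + Nat.card {d // T.opp d ≠ d} := by
  have := X.finite_dart
  have e : (fill X T).EdgeDart ≃ {d // X.opp d ≠ d} ⊕ {d // T.opp d ≠ d} :=
    { toFun := fun d => match d with
        | ⟨Sum.inl x, h⟩ => Sum.inl ⟨x, fun hx => h (congrArg Sum.inl hx)⟩
        | ⟨Sum.inr x, h⟩ => Sum.inr ⟨x, fun hx => h (congrArg Sum.inr hx)⟩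
      invFun := Sum.elim (fun x => ⟨Sum.inl x.1, fun h => x.2 (Sum.inl_injective h)⟩)
        fun x => ⟨Sum.inr x.1, fun h => x.2 (Sum.inr_injective h)⟩
      left_inv := by rintro ⟨x | x, h⟩ <;> rfl
      right_inv := by rintro (x | x) <;> rfl }
  rw [Nat.card_congr e, Nat.card_sum]

/-- Two darts of the exterior, or of the coin (represented by `none`), that are joined by a step
along the graph. -/
inductive Exterior.Joined : Option X.Dart → Option X.Dart → Prop
  | rot (x) : Joined (some x) (some (X.rot x))
  | opp (x) : Joined (some x) (some (X.opp x))
  | port (t) : Joined (some (X.port t)) none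

/-- The component of a dart. -/
def PreBlink.component (B : PreBlink) (d : B.Dart) : B.Component := Quot.mk _ d

theorem PreBlink.component_rot (B : PreBlink) (d : B.Dart) :
    B.component (B.rot d) = B.component d :=
  (Quot.sound (r := fun d d' => d' = B.rot d ∨ d' = B.opp d) (Or.inl rfl)).symm

theorem PreBlink.component_opp (B : PreBlink) (d : B.Dart) :
    B.component (B.opp d) = B.component d :=
  (Quot.sound (r := fun d d' => d' = B.rot d ∨ d' = B.opp d) (Or.inr rfl)).symm

theorem PreBlink.component_eq_of_sameCycle (B : PreBlink) {d e : B.Dart}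
    (h : B.rot.SameCycle d e) : B.component d = B.component e :=
  eq_of_sameCycle B.component_rot h

theorem fill_component_inr (hT : T.IsDisk) (x y : T.Dart) :
    (fill X T).component (Sum.inr x) = (fill X T).component (Sum.inr y) := by
  have hv := fun z w => (fill X T).component_eq_of_sameCycle (d := z) (e := w)
  induction hT.connected x y with
  | rel x y h =>
    rcases h with rfl | rfl
    · exact hv _ _ (fill_sameCycle_inr X hT.port_injective x)
    · exact Quot.sound (Or.inr rfl)
  | refl x => rfl
  | symm x y _ ih => exact ih.symm
  | trans x y z _ _ h1 h2 => exact h1.trans h2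

theorem card_fill_component (hT : T.IsDisk) :
    Nat.card (fill X T).Component = Nat.card (Quot X.Joined) := by
  obtain ⟨t0⟩ := hT.nonempty
  have hp := hT.port_injective
  have hv := fun z w => (fill X T).component_eq_of_sameCycle (d := z) (e := w)
  let Φ : (fill X T).Dart → Quot X.Joined :=
    Sum.elim (fun x => Quot.mk _ (some x)) fun _ => Quot.mk _ none
  have hΦ : ∀ z, Φ z = Φ ((fill X T).rot z) := by
    rintro (x | x)
    · by_cases hx : ∃ t, x = X.port t
      · obtain ⟨t, rfl⟩ := hx
        rw [fill_rot_inl_port X hp]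
        exact Quot.sound (Exterior.Joined.port t)
      · push Not at hx
        rw [fill_rot_inl_of_ne X hx]
        exact Quot.sound (Exterior.Joined.rot x)
    · by_cases hx : ∃ t, x = T.port t
      · obtain ⟨t, rfl⟩ := hx
        rw [fill_rot_inr_port X hp]
        exact (Quot.sound (Exterior.Joined.port t)).symm.trans
          (Quot.sound (Exterior.Joined.rot _))
      · push Not at hx
        rw [fill_rot_inr_of_ne X hx]
        rfl
  refine Nat.card_congr
    { toFun := Quot.lift Φ ?_
      invFun := Quot.lift (fun x => x.elim (Quot.mk _ (Sum.inr t0)) fun x =>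
        Quot.mk _ (Sum.inl x)) ?_
      left_inv := ?_
      right_inv := ?_ }
  · rintro z w (rfl | rfl)
    · exact hΦ z
    · rcases z with x | x
      · exact Quot.sound (Exterior.Joined.opp x)
      · rfl
  · rintro _ _ (x | x | t)
    · exact hv _ _ (fill_sameCycle_inl X hp x)
    · exact Quot.sound (Or.inr rfl)
    · exact (hv _ _ (fill_sameCycle_port X hp t)).symm.trans (fill_component_inr X hT _ _)
  · rintro ⟨x | x⟩
    · rfl
    · exact fill_component_inr X hT _ _
  · rintro ⟨_ | x⟩ <;> rfl

/-- Whether a filled exterior is plane does not depend on the connected coin that fills it. -/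
theorem IsDisk.isPlane_fill {T' : Patch k} (hT : T.IsDisk) (hT' : T'.IsDisk)
    (h : (fill X T).IsPlane) : (fill X T').IsPlane := by
  have := X.finite_dart
  have := X.finite_face
  have := hT'.finite_dart
  have := hT'.finite_face
  refine ⟨inferInstanceAs (Finite (_ ⊕ _)), Finite.of_surjective _ Quot.mk_surjective, ?_, ?_,
    hT'.toIsLocal.fill_face_walk X, ?_, ?_⟩
  · rintro (x | x)
    · exact congrArg Sum.inl (X.opp_opp x)
    · exact congrArg Sum.inr (hT'.opp_opp x)
  · rintro (x | x)
    · exact X.black_opp x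
    · exact hT'.black_opp x
  · obtain ⟨t0⟩ := hT.nonempty
    obtain ⟨t0'⟩ := hT'.nonempty
    have hp := hT.port_injective
    have hp' := hT'.port_injective
    let R := fun f g : (fill X T').Face =>
      ∃ d, (fill X T').face d = f ∧
        ((fill X T').face ((fill X T').rot d) = g ∨ (fill X T').face ((fill X T').opp d) = g)
    -- faces at darts of the same component are joined
    have hcomp : ∀ z w : (fill X T').Dart,
        (fill X T').component z = (fill X T').component w →
        Quot.mk R ((fill X T').face z) = Quot.mk R ((fill X T').face w) := by
      intro z w hzw
      let F : (fill X T').Component → Quot R :=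
        Quot.lift (fun z => Quot.mk R ((fill X T').face z)) (by
          rintro z w (rfl | rfl)
          · exact Quot.sound ⟨z, rfl, Or.inl rfl⟩
          · exact Quot.sound ⟨z, rfl, Or.inr rfl⟩)
      exact congrArg F hzw
    have hv := fun z w => (fill X T').component_eq_of_sameCycle (d := z) (e := w)
    have hfX : ∀ x : X.Dart, ∃ z : (fill X T').Dart, (fill X T').component z =
        (fill X T').component (Sum.inl x) ∧ (fill X T').face z = Quot.mk _ (Sum.inl (X.face x)) := fun x => by
      by_cases hx : ∃ t, x = X.port t
      · obtain ⟨t, rfl⟩ := hx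
        exact ⟨Sum.inr (T'.port t), hv _ _ (fill_sameCycle_port X hp' t),
          fill_face_inr_port X hp' t⟩
      · push Not at hx
        exact ⟨Sum.inl x, rfl, fill_face_inl_of_ne X hx⟩
    have hfT : ∀ x : T'.Dart, ∃ z : (fill X T').Dart, (fill X T').component z =
        (fill X T').component (Sum.inr x) ∧ (fill X T').face z = Quot.mk _ (Sum.inr (T'.face x)) := fun x => by
      by_cases hx : ∃ t, x = T'.port t
      · obtain ⟨t, rfl⟩ := hx
        exact ⟨Sum.inl (X.port t), (hv _ _ (fill_sameCycle_port X hp' t)).symm,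
          fill_face_inl_port X hp' t⟩
      · push Not at hx
        exact ⟨Sum.inr x, rfl, fill_face_inr_of_ne X hx⟩
    let ξ : X.Face → Quot R := fun f => Quot.mk R (Quot.mk _ (Sum.inl f))
    let τ : Quot R := Quot.mk R (Quot.mk _ (Sum.inr (T'.face t0')))
    have hτ : ∀ f : T'.Face, Quot.mk R (Quot.mk _ (Sum.inr f)) = τ := fun f => by
      obtain ⟨x, rfl⟩ := hT'.face_surjective f
      obtain ⟨z, hz, hz'⟩ := hfT x
      obtain ⟨w, hw, hw'⟩ := hfT t0'
      change _ = Quot.mk R (Quot.mk _ (Sum.inr (T'.face t0')))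
      rw [← hz', ← hw']
      exact hcomp _ _ (hz.trans ((fill_component_inr X hT' _ _).trans hw.symm))
    have hξ : ∀ x y : X.Dart, (fill X T').component (Sum.inl x) =
        (fill X T').component (Sum.inl y) → ξ (X.face x) = ξ (X.face y) := fun x y hxy => by
      obtain ⟨z, hz, hz'⟩ := hfX x
      obtain ⟨w, hw, hw'⟩ := hfX y
      change Quot.mk R (Quot.mk _ _) = Quot.mk R (Quot.mk _ _)
      rw [← hz', ← hw']
      exact hcomp _ _ (hz.trans (hxy.trans hw.symm))
    have hleft : ∀ t, ξ (X.face (X.rot⁻¹ (X.port t))) = τ := fun t =>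
      (congrArg (Quot.mk R) (Quot.sound (Seam.left t))).trans (hτ _)
    have hright : ∀ t, ξ (X.face (X.port t)) = τ := fun t =>
      (congrArg (Quot.mk R) (Quot.sound (Seam.right t))).trans (hτ _)
    let Φ : (fill X T).Face → Quot R := Quot.lift (Sum.elim ξ fun _ => τ) fun a b h => by
      cases h with
      | left t => exact hleft t
      | right t => exact hright t
      | hole hk => exact (congrArg (Quot.mk R) (Quot.sound (Seam.hole hk))).trans (hτ _)
    let ψ : (fill X T).Dart → Quot R := Sum.elim (fun x => ξ (X.face x)) fun _ => τ
    have hψ : ∀ z, Φ ((fill X T).face z) = ψ z := by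
      rintro (x | x)
      · by_cases hx : ∃ t, x = X.port t
        · obtain ⟨t, rfl⟩ := hx
          rw [fill_face_inl_port X hp]
          exact (hright t).symm
        · push Not at hx
          rw [fill_face_inl_of_ne X hx]; rfl
      · by_cases hx : ∃ t, x = T.port t
        · obtain ⟨t, rfl⟩ := hx
          rw [fill_face_inr_port X hp]
          exact hright t
        · push Not at hx
          rw [fill_face_inr_of_ne X hx]; rfl
    have hrot : ∀ z, ψ ((fill X T).rot z) = ψ z := by
      have hX : ∀ x, ξ (X.face (X.rot x)) = ξ (X.face x) := fun x =>
        (hξ _ _ (hv _ _ (fill_sameCycle_inl X hp' x))).symm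
      rintro (x | x)
      · by_cases hx : ∃ t, x = X.port t
        · obtain ⟨t, rfl⟩ := hx
          rw [fill_rot_inl_port X hp]
          exact (hright t).symm
        · push Not at hx
          rw [fill_rot_inl_of_ne X hx]
          exact hX x
      · by_cases hx : ∃ t, x = T.port t
        · obtain ⟨t, rfl⟩ := hx
          rw [fill_rot_inr_port X hp]
          exact (hX _).trans (hright t)
        · push Not at hx
          rw [fill_rot_inr_of_ne X hx]; rfl
    have hopp : ∀ z, ψ ((fill X T).opp z) = ψ z := by
      rintro (x | x)
      · exact hξ _ _ ((fill X T').component_opp (Sum.inl x))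
      · rfl
    have hΦ : ∀ f g, Φ f = Φ g := fun f g => by
      induction h.connected f g with
      | rel f g h =>
        obtain ⟨d, rfl, rfl | rfl⟩ := h
        · rw [hψ, hψ, hrot]
        · rw [hψ, hψ, hopp]
      | refl => rfl
      | symm _ _ _ ih => exact ih.symm
      | trans _ _ _ _ _ h1 h2 => exact h1.trans h2
    have hall : ∀ f : (fill X T').Face, ∃ g : (fill X T).Face, Quot.mk R f = Φ g := by
      rintro ⟨f | f⟩
      · exact ⟨Quot.mk _ (Sum.inl f), rfl⟩
      · exact ⟨Quot.mk _ (Sum.inr (T.face t0)), hτ f⟩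
    intro f g
    obtain ⟨f', hf⟩ := hall f
    obtain ⟨g', hg⟩ := hall g
    exact Quot.eqvGen_exact (hf.trans ((hΦ f' g').trans hg.symm))
  · have e := h.euler
    have e1 := hT.euler
    have e2 := hT'.euler
    rw [card_fill_vertex X hT.toIsLocal, card_fill_face X hT, card_fill_edgeDart X hT.finite_dart,
      card_fill_component X hT] at e
    rw [card_fill_vertex X hT'.toIsLocal, card_fill_face X hT',
      card_fill_edgeDart X hT'.finite_dart, card_fill_component X hT']
    omega

end Fill

end BlinkCalculus

namespace BlinkCalculus

open Equiv Function

/-! ## Coins inside of coins -/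

/-- Exchanges the two darts of each edge, and moves each port to the next port. -/
def shift (e k : ℕ) : Perm (CoinDart e k) :=
  Equiv.sumCongr (Equiv.prodCongr (Equiv.refl _) Equiv.boolNot) (finRotate k)

/-- Exchanges the two darts of each edge. -/
def flip {e k : ℕ} : CoinDart e k → CoinDart e k := Sum.map (Prod.map id not) id

/-- A plane graph in an annulus with `k` attachment vertices on the outer circle and `j` attachment
vertices on the inner circle. -/
structure Context (k j : ℕ) where
  edges : ℕ
  rot : Perm (CoinDart edges k ⊕ Fin j)
  black : Fin edges → Bool
  outside : CoinDart edges k ⊕ Fin j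

namespace Context

variable {k j : ℕ} (Y : Context k j)

abbrev Dart : Type := CoinDart Y.edges k ⊕ Fin j

/-- The regions, obtained by walking around their boundaries. -/
inductive Walk : Y.Dart → Y.Dart → Prop
  | outer (d) : Walk (Sum.inl d) (Y.rot⁻¹ (Sum.inl (shift _ _ d)))
  | inner (t) : Walk (Sum.inr (finRotate j t)) (Y.rot⁻¹ (Sum.inr t))

/-- The context as a part of a plane graph, with the ports on the outer circle. -/
def toPatch : Patch k where
  Dart := Y.Dart
  Face := Quot Y.Walk
  rot := Y.rot
  opp := Sum.map flip id
  black := Sum.elim (Sum.elim (fun d => Y.black d.1) fun _ => false) fun _ => false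
  face := Quot.mk _
  port t := Sum.inl (Sum.inr t)
  hole := Quot.mk _ Y.outside

theorem port_injective : Injective Y.toPatch.port := fun _ _ h =>
  Sum.inr_injective (Sum.inl_injective h)

theorem ne_port_inner (s : Fin j) (t : Fin k) : (Sum.inr s : Y.Dart) ≠ Y.toPatch.port t :=
  fun h => by cases h

theorem ne_port_edge (d : Fin Y.edges × Bool) (t : Fin k) :
    (Sum.inl (Sum.inl d) : Y.Dart) ≠ Y.toPatch.port t := fun h => by cases h

/-- Different attachment vertices on the inner circle are different vertices. -/
def Separated : Prop := ∀ s t, Y.rot.SameCycle (Sum.inr s) (Sum.inr t) → s = t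

end Context

theorem flip_flip {e k : ℕ} (d : CoinDart e k) : flip (flip d) = d := by
  rcases d with ⟨d, b⟩ | d
  · exact congrArg (fun b => Sum.inl (d, b)) (Bool.not_not b)
  · rfl

/-- The exterior of the inner circle of a context. -/
noncomputable def Exterior.extend {k j : ℕ} (X : Exterior k) (Y : Context k j)
    (hY : Y.Separated) : Exterior j where
  Dart := X.Dart ⊕ Y.Dart
  Face := (fill X Y.toPatch).Face
  rot := (fill X Y.toPatch).rot
  opp := (fill X Y.toPatch).opp
  black := (fill X Y.toPatch).black
  face := (fill X Y.toPatch).face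
  port t := Sum.inr (Sum.inr t)
  hole := (fill X Y.toPatch).outer
  outer := (fill X Y.toPatch).outer
  finite_dart := by
    have := X.finite_dart
    infer_instance
  finite_face := by
    have := X.finite_face
    have : Finite Y.toPatch.Face := Finite.of_surjective (Quot.mk _) Quot.mk_surjective
    exact Finite.of_surjective (Quot.mk _) Quot.mk_surjective
  opp_opp := by
    rintro (x | x | x)
    · exact congrArg Sum.inl (X.opp_opp x)
    · exact congrArg (fun d => Sum.inr (Sum.inl d)) (flip_flip x)
    · rfl
  black_opp := by
    rintro (x | (x | x) | x)
    · exact X.black_opp x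
    · rfl
    · rfl
    · rfl
  opp_port _ := rfl
  port_distinct s t h := hY s t (sameCycle_of_fill_inr X Y.port_injective h)
  face_walk := by
    rintro (x | (x | x) | x) hx
    · exact fill_face_walk_inl X Y.port_injective x
    · exact (fill_face_rot_inv_inr X (T := Y.toPatch) _).trans
        ((congrArg (fun f => Quot.mk _ (Sum.inr f))
          (Quot.sound (Context.Walk.outer (Sum.inl x))).symm).trans
          (fill_face_inr_of_ne X (T := Y.toPatch) (Y.ne_port_edge x)).symm)
    · exact (fill_face_rot_inv_inr X (T := Y.toPatch) _).trans
        ((Quot.sound (Seam.right x)).symm.trans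
          (fill_face_inr_port X (T := Y.toPatch) Y.port_injective x).symm)
    · exact absurd rfl (hx x)
  port_walk t := (fill_face_inr_of_ne X (T := Y.toPatch) (Y.ne_port_inner _)).trans
    ((congrArg (fun f => Quot.mk _ (Sum.inr f)) (Quot.sound (Context.Walk.inner t))).trans
      (fill_face_rot_inv_inr X (T := Y.toPatch) _).symm)

namespace Coin

variable {k : ℕ} (c : Coin k)

theorem toPatch_isLocal : c.toPatch.IsLocal where
  finite_dart := inferInstanceAs (Finite (CoinDart c.edges k))
  finite_face := Finite.of_surjective (Quot.mk _ : Option (CoinDart c.edges k) → _)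
    Quot.mk_surjective
  opp_opp := flip_flip
  black_opp := by rintro (d | d) <;> rfl
  opp_port _ := rfl
  port_injective := Sum.inr_injective
  face_walk := by
    rintro (d | d) h
    · exact (Quot.sound (Coin.Walk.step (c := c) (Sum.inl d))).symm
    · exact absurd rfl (h d)

theorem face_rot_inv (d : CoinDart c.edges k) :
    c.toPatch.face (c.rot⁻¹ (shift _ _ d)) = c.toPatch.face d :=
  (Quot.sound (Coin.Walk.step (c := c) d)).symm

end Coin

section Fits

variable {k j : ℕ}

/-- The darts of a context filled with a coin, without the ports in the inner circle. -/
abbrev Context.Ess (Y : Context k j) (L : Coin j) : Type :=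
  CoinDart Y.edges k ⊕ (Fin L.edges × Bool)

/-- The inclusion into all darts. -/
def Context.incl (Y : Context k j) (L : Coin j) :
    Y.Ess L → Y.Dart ⊕ CoinDart L.edges j :=
  Sum.map Sum.inl Sum.inl

/-- The rotation of a context filled with a coin, where each port of the context is followed by the
darts of the coin, and vice versa. -/
def Context.merge (Y : Context k j) (L : Coin j) :
    Y.Dart ⊕ CoinDart L.edges j → Y.Dart ⊕ CoinDart L.edges j
  | Sum.inl (Sum.inl d) => Sum.inl (Y.rot (Sum.inl d))
  | Sum.inl (Sum.inr t) => Sum.inr (L.rot (Sum.inr t))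
  | Sum.inr (Sum.inl d) => Sum.inr (L.rot (Sum.inl d))
  | Sum.inr (Sum.inr t) => Sum.inl (Y.rot (Sum.inr t))

/-- The coin `T` consists of the context `Y` and of the coin `L` in its inner circle. The map `emb`
gives the darts of `T`; the other darts in `ctx t` and `coin t` have on their left the same region
as the ports. -/
structure Fits (T : Coin k) (Y : Context k j) (L : Coin j) where
  emb : Y.Ess L ≃ CoinDart T.edges k
  ctx : Fin j → CoinDart T.edges k
  coin : Fin j → CoinDart T.edges k
  pos : j ≠ 0
  port : ∀ t, emb (Sum.inl (Sum.inr t)) = Sum.inr t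
  opp_ctx : ∀ d, emb (Sum.inl (Sum.inl (d.1, !d.2))) = flip (emb (Sum.inl (Sum.inl d)))
  opp_coin : ∀ d, emb (Sum.inr (d.1, !d.2)) = flip (emb (Sum.inr d))
  black_ctx : ∀ d, T.toPatch.black (emb (Sum.inl (Sum.inl d))) = Y.black d.1
  black_coin : ∀ d, T.toPatch.black (emb (Sum.inr d)) = L.black d.1
  rot : ∀ z, ∃ n : ℕ, (Y.merge L)^[n + 1] (Y.incl L z) = Y.incl L (emb.symm (T.rot (emb z))) ∧
    ∀ m < n, ∀ e, (Y.merge L)^[m + 1] (Y.incl L z) ≠ Y.incl L e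
  cover : ∀ z, ∃ n e, (Y.merge L)^[n] z = Y.incl L e
  face_ctx : ∀ y, T.toPatch.face (Sum.elim (emb ∘ Sum.inl) ctx (Y.rot⁻¹ y)) =
    T.toPatch.face (Sum.elim (emb ∘ Sum.inl) ctx
      (Sum.map (shift _ _).symm (finRotate j) y))
  face_coin : ∀ d, T.toPatch.face (Sum.elim (emb ∘ Sum.inr) coin (L.rot⁻¹ d)) =
    T.toPatch.face (Sum.elim (emb ∘ Sum.inr) coin ((shift _ _).symm d))
  face_left : ∀ t, T.toPatch.face (Sum.elim (emb ∘ Sum.inl) ctx (Y.rot⁻¹ (Sum.inr t))) =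
    T.toPatch.face (coin t)
  face_right : ∀ t, T.toPatch.face (Sum.elim (emb ∘ Sum.inr) coin (L.rot⁻¹ (Sum.inr t))) =
    T.toPatch.face (ctx t)
  out : CoinDart T.edges k
  outside : T.outside = some out
  outside_coin : ∃ o, L.outside = some o
  hole : k = 0 → T.toPatch.face (Sum.elim (emb ∘ Sum.inl) ctx Y.outside) = T.toPatch.face out
  hole' : k = 0 → ∃ t d, Y.outside = Y.rot⁻¹ (Sum.inr t) ∧ emb (Sum.inr d) = out ∧
    L.toPatch.face (Sum.inr t) = L.toPatch.face (Sum.inl d)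

namespace Fits

variable {T : Coin k} {Y : Context k j} {L : Coin j} (F : Fits T Y L) (X : Exterior k)
  (hY : Y.Separated)

/-- The filled context inside of the filled exterior. -/
def assoc (X : Exterior k) (hY : Y.Separated) :
    Y.Dart ⊕ CoinDart L.edges j → (fill (X.extend Y hY) L.toPatch).Dart :=
  Sum.elim (fun y => Sum.inl (Sum.inr y)) Sum.inr

theorem assoc_injective : Injective (assoc (L := L) X hY) := by
  rintro (x | x) (y | y) h
  · exact congrArg Sum.inl (Sum.inr_injective (Sum.inl_injective h))
  · cases h
  · cases h
  · exact congrArg Sum.inr (Sum.inr_injective h)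

theorem rot_assoc {z : Y.Dart ⊕ CoinDart L.edges j}
    (hz : ∀ t, z ≠ Sum.inl (Sum.inl (Sum.inr t))) :
    (fill (X.extend Y hY) L.toPatch).rot (assoc X hY z) = assoc X hY (Y.merge L z) := by
  rcases z with ((z | z) | z) | (z | z)
  · refine (fill_rot_inl_of_ne (X.extend Y hY) (T := L.toPatch)
      (x := Sum.inr (Sum.inl (Sum.inl z))) fun t h => by cases h).trans ?_
    exact congrArg Sum.inl (fill_rot_inr_of_ne X (T := Y.toPatch) (Y.ne_port_edge z))
  · exact absurd rfl (hz z)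
  · exact fill_rot_inl_port (X.extend Y hY) (T := L.toPatch) Sum.inr_injective z
  · exact fill_rot_inr_of_ne (X.extend Y hY) (T := L.toPatch) fun t h => by cases h
  · refine (fill_rot_inr_port (X.extend Y hY) (T := L.toPatch) Sum.inr_injective z).trans ?_
    exact congrArg Sum.inl (fill_rot_inr_of_ne X (T := Y.toPatch) (Y.ne_port_inner z))

theorem rot_inl_inl {x : X.Dart} (hx : ∀ t, x ≠ X.port t) :
    (fill (X.extend Y hY) L.toPatch).rot (Sum.inl (Sum.inl x)) =
      Sum.inl (Sum.inl (X.rot x)) := by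
  refine (fill_rot_inl_of_ne (X.extend Y hY) (T := L.toPatch)
    (x := Sum.inl x) fun t h => by cases h).trans ?_
  exact congrArg Sum.inl (fill_rot_inl_of_ne X (T := Y.toPatch) hx)

theorem rot_inl_inl_port (t : Fin k) :
    (fill (X.extend Y hY) L.toPatch).rot (Sum.inl (Sum.inl (X.port t))) =
      assoc X hY (Y.merge L (Sum.inl (Sum.inl (Sum.inr t)))) := by
  refine (fill_rot_inl_of_ne (X.extend Y hY) (T := L.toPatch)
    (x := Sum.inl (X.port t)) fun t h => by cases h).trans ?_
  exact congrArg Sum.inl (fill_rot_inl_port X (T := Y.toPatch) Y.port_injective t)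

theorem rot_assoc_port (t : Fin k) :
    (fill (X.extend Y hY) L.toPatch).rot (assoc X hY (Sum.inl (Sum.inl (Sum.inr t)))) =
      Sum.inl (Sum.inl (X.rot (X.port t))) := by
  refine (fill_rot_inl_of_ne (X.extend Y hY) (T := L.toPatch)
    (x := Sum.inr (Sum.inl (Sum.inr t))) fun t h => by cases h).trans ?_
  exact congrArg Sum.inl (fill_rot_inr_port X (T := Y.toPatch) Y.port_injective t)

/-- The dart in whose place the darts after `z` come in the filled exterior. -/
def start (z : Y.Ess L) : (fill (X.extend Y hY) L.toPatch).Dart :=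
  match z with
  | Sum.inl (Sum.inr t) => Sum.inl (Sum.inl (X.port t))
  | z => assoc X hY (Y.incl L z)

theorem rot_start (z : Y.Ess L) : (fill (X.extend Y hY) L.toPatch).rot (start X hY z) =
    assoc X hY (Y.merge L (Y.incl L z)) := by
  rcases z with (z | z) | z
  · exact rot_assoc X hY fun t h => by cases h
  · exact rot_inl_inl_port X hY z
  · exact rot_assoc X hY fun t h => by cases h

theorem rot_pow_start (z : Y.Ess L) (n : ℕ)
    (h : ∀ m < n, ∀ e, (Y.merge L)^[m + 1] (Y.incl L z) ≠ Y.incl L e) :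
    ((fill (X.extend Y hY) L.toPatch).rot ^ (n + 1)) (start X hY z) =
      assoc X hY ((Y.merge L)^[n + 1] (Y.incl L z)) := by
  induction n with
  | zero => exact rot_start X hY z
  | succ n ih =>
    rw [pow_succ', Perm.mul_apply, ih fun m hm => h m (by omega), rot_assoc,
      ← iterate_succ_apply' (Y.merge L)]
    exact fun t ht => h n (by omega) (Sum.inl (Sum.inr t)) ht

/-- The region on the left of a dart of a filled context. -/
def region (z : Y.Ess L) : (fill (X.extend Y hY) L.toPatch).Face :=
  match z with
  | Sum.inl y => Quot.mk _ (Sum.inl (Quot.mk _ (Sum.inr (Y.toPatch.face (Sum.inl y)))))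
  | Sum.inr l => Quot.mk _ (Sum.inr (L.toPatch.face (Sum.inl l)))

theorem face_start (z : Y.Ess L) :
    (fill (X.extend Y hY) L.toPatch).face (start X hY z) = region X hY z := by
  rcases z with (z | z) | z
  · refine (fill_face_inl_of_ne (X.extend Y hY) (T := L.toPatch)
      (x := Sum.inr (Sum.inl (Sum.inl z))) fun t h => by cases h).trans ?_
    exact congrArg (fun f => Quot.mk _ (Sum.inl f))
      (fill_face_inr_of_ne X (T := Y.toPatch) (Y.ne_port_edge z))
  · refine (fill_face_inl_of_ne (X.extend Y hY) (T := L.toPatch)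
      (x := Sum.inl (X.port z)) fun t h => by cases h).trans ?_
    exact congrArg (fun f => Quot.mk _ (Sum.inl f))
      (fill_face_inl_port X (T := Y.toPatch) Y.port_injective z)
  · exact fill_face_inr_of_ne (X.extend Y hY) (T := L.toPatch) fun t h => by cases h

theorem face_inl_inl {x : X.Dart} (hx : ∀ t, x ≠ X.port t) :
    (fill (X.extend Y hY) L.toPatch).face (Sum.inl (Sum.inl x)) =
      Quot.mk _ (Sum.inl (Quot.mk _ (Sum.inl (X.face x)))) := by
  refine (fill_face_inl_of_ne (X.extend Y hY) (T := L.toPatch)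
    (x := Sum.inl x) fun t h => by cases h).trans ?_
  exact congrArg (fun f => Quot.mk _ (Sum.inl f)) (fill_face_inl_of_ne X (T := Y.toPatch) hx)

theorem face_assoc_port (t : Fin k) :
    (fill (X.extend Y hY) L.toPatch).face (assoc X hY (Sum.inl (Sum.inl (Sum.inr t)))) =
      Quot.mk _ (Sum.inl (Quot.mk _ (Sum.inl (X.face (X.port t))))) := by
  refine (fill_face_inl_of_ne (X.extend Y hY) (T := L.toPatch)
    (x := Sum.inr (Sum.inl (Sum.inr t))) fun t h => by cases h).trans ?_
  exact congrArg (fun f => Quot.mk _ (Sum.inl f))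
    (fill_face_inr_port X (T := Y.toPatch) Y.port_injective t)

theorem face_blank {z : Y.Dart ⊕ CoinDart L.edges j} (hz : ∀ e, z ≠ Y.incl L e) :
    (fill (X.extend Y hY) L.toPatch).face
        ((fill (X.extend Y hY) L.toPatch).rot⁻¹ (assoc X hY z)) =
      (fill (X.extend Y hY) L.toPatch).face (assoc X hY z) := by
  have h := L.toPatch_isLocal.fill_face_walk (X.extend Y hY) (assoc X hY z)
  rcases z with (z | z) | (z | z)
  · exact absurd rfl (hz (Sum.inl z))
  · exact h
  · exact absurd rfl (hz (Sum.inr z))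
  · exact h

end Fits

end Fits

end BlinkCalculus

namespace BlinkCalculus

open Equiv Function

namespace Fits

variable {k j : ℕ} {T : Coin k} {Y : Context k j} {L : Coin j} (F : Fits T Y L) (X : Exterior k)
  (hY : Y.Separated)

include F

theorem region_step (z : Y.Ess L) :
    (fill (X.extend Y hY) L.toPatch).face ((fill (X.extend Y hY) L.toPatch).rot⁻¹
      (assoc X hY (Y.incl L (F.emb.symm (T.rot (F.emb z)))))) = region X hY z := by
  obtain ⟨n, hn, hn'⟩ := F.rot z
  have key : ∀ m ≤ n, (fill (X.extend Y hY) L.toPatch).face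
      ((fill (X.extend Y hY) L.toPatch).rot⁻¹
        (assoc X hY ((Y.merge L)^[m + 1] (Y.incl L z)))) = region X hY z := by
    intro m
    induction m with
    | zero =>
      intro _
      rw [← face_start, iterate_one, ← rot_start]
      exact congrArg _ (Equiv.symm_apply_apply _ _)
    | succ m ih =>
      intro hm
      rw [← ih (by omega), face_blank X hY (hn' m (by omega)), iterate_succ_apply',
        ← rot_assoc X hY fun t ht => hn' m (by omega) (Sum.inl (Sum.inr t)) ht]
      exact congrArg _ (Equiv.symm_apply_apply _ _)
  rw [← hn]
  exact key n le_rfl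

omit F in
theorem face_rot_inv_port (t : Fin k) :
    (fill (X.extend Y hY) L.toPatch).face ((fill (X.extend Y hY) L.toPatch).rot⁻¹
      (assoc X hY (Sum.inl (Sum.inl (Sum.inr t))))) =
    Quot.mk _ (Sum.inl (Quot.mk _ (Sum.inr (Y.toPatch.face (Y.rot⁻¹ (Sum.inl (Sum.inr t))))))) :=
  (fill_face_rot_inv_inl (X.extend Y hY) (T := L.toPatch) _).trans
    (congrArg (fun f => Quot.mk _ (Sum.inl f)) (fill_face_rot_inv_inr X (T := Y.toPatch) _))

theorem emb_symm_port (t : Fin k) : F.emb.symm (Sum.inr t) = Sum.inl (Sum.inr t) := by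
  rw [Equiv.symm_apply_eq, F.port]

theorem emb_ctx_ne (d : Fin Y.edges × Bool) (t : Fin k) :
    F.emb (Sum.inl (Sum.inl d)) ≠ Sum.inr t := fun h => by
  rw [← F.port] at h
  cases F.emb.injective h

theorem emb_coin_ne (d : Fin L.edges × Bool) (t : Fin k) : F.emb (Sum.inr d) ≠ Sum.inr t :=
  fun h => by
    rw [← F.port] at h
    cases F.emb.injective h

omit F in
theorem shift_eq_flip {e k : ℕ} {d : CoinDart e k} (h : ∀ t, d ≠ Sum.inr t) :
    shift e k d = flip d := by
  rcases d with d | d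
  · rfl
  · exact absurd rfl (h d)

theorem region_walk (d : CoinDart T.edges k) :
    region X hY (F.emb.symm d) = region X hY (F.emb.symm (T.rot⁻¹ (shift _ _ d))) := by
  have h1 := F.region_step X hY (F.emb.symm (T.rot⁻¹ (shift _ _ d)))
  rw [Equiv.apply_symm_apply, show T.rot (T.rot⁻¹ (shift _ _ d)) = shift _ _ d from
    T.rot.apply_symm_apply _] at h1
  rw [← h1]
  obtain ⟨z, rfl⟩ := F.emb.surjective d
  rw [Equiv.symm_apply_apply]
  rcases z with (z | z) | z
  · rw [shift_eq_flip (F.emb_ctx_ne z), ← F.opp_ctx, Equiv.symm_apply_apply]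
    exact (face_start X hY (L := L) (Sum.inl (Sum.inl z))).symm.trans
      (L.toPatch_isLocal.fill_face_walk (X.extend Y hY) (Sum.inl (Sum.inr (Sum.inl (Sum.inl z))))).symm
  · rw [F.port]
    change _ = (fill (X.extend Y hY) L.toPatch).face ((fill (X.extend Y hY) L.toPatch).rot⁻¹
      (assoc X hY (Y.incl L (F.emb.symm (Sum.inr (finRotate k z))))))
    rw [emb_symm_port]
    refine Eq.trans ?_ (face_rot_inv_port X hY _).symm
    exact congrArg (fun f => Quot.mk _ (Sum.inl (Quot.mk _ (Sum.inr f))))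
      (Quot.sound (Context.Walk.outer (Sum.inr z)))
  · rw [shift_eq_flip (F.emb_coin_ne z), ← F.opp_coin, Equiv.symm_apply_apply]
    exact (face_start X hY (L := L) (Sum.inr z)).symm.trans
      (L.toPatch_isLocal.fill_face_walk (X.extend Y hY) (Sum.inr (Sum.inl z))).symm

theorem region_port (t : Fin k) : region X hY (F.emb.symm (Sum.inr t)) =
    Quot.mk _ (Sum.inl (Quot.mk _ (Sum.inl (X.face (X.rot⁻¹ (X.port t)))))) :=
  (congrArg (region X hY) (F.emb_symm_port t)).trans
    (congrArg (fun f => Quot.mk _ (Sum.inl f)) (Quot.sound (Seam.left t)).symm)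

theorem region_rot_inv_port (t : Fin k) :
    region X hY (F.emb.symm (T.rot⁻¹ (Sum.inr t))) =
      Quot.mk _ (Sum.inl (Quot.mk _ (Sum.inl (X.face (X.port t))))) := by
  have h := F.region_step X hY (F.emb.symm (T.rot⁻¹ (Sum.inr t)))
  rw [Equiv.apply_symm_apply, show T.rot (T.rot⁻¹ (Sum.inr t)) = Sum.inr t from
    T.rot.apply_symm_apply _, emb_symm_port] at h
  exact h.symm.trans ((face_rot_inv_port X hY t).trans
    (congrArg (fun f => Quot.mk _ (Sum.inl f)) (Quot.sound (Seam.right t)).symm))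

theorem region_out (hk : k = 0) : region X hY (F.emb.symm F.out) =
    Quot.mk _ (Sum.inl (Quot.mk _ (Sum.inl X.hole))) := by
  obtain ⟨t, d, ho, hd, hf⟩ := F.hole' hk
  rw [← hd, Equiv.symm_apply_apply]
  refine Eq.symm ?_
  refine (congrArg (fun f => Quot.mk _ (Sum.inl f)) (Quot.sound (Seam.hole hk))).trans ?_
  refine Eq.trans ?_ (congrArg (fun f => Quot.mk _ (Sum.inr f)) hf)
  refine Eq.trans ?_ (Quot.sound (Seam.left t))
  refine congrArg (fun f => Quot.mk _ (Sum.inl f)) ?_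
  refine Eq.trans ?_ (fill_face_rot_inv_inr X (T := Y.toPatch) _).symm
  exact congrArg (fun f => Quot.mk _ (Sum.inr (Quot.mk _ f))) ho

/-- The regions of the filled coin as regions of the filled context. -/
def face : (fill X T.toPatch).Face → (fill (X.extend Y hY) L.toPatch).Face :=
  Quot.lift (Sum.elim (fun f => Quot.mk _ (Sum.inl (Quot.mk _ (Sum.inl f))))
    (Quot.lift (fun d => region X hY (F.emb.symm (d.getD F.out))) (by
      rintro _ _ (d | _)
      · exact F.region_walk X hY d
      · rw [F.outside]; rfl))) (by
    rintro _ _ (t | t | hk)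
    · exact (F.region_port X hY t).symm
    · exact (F.region_rot_inv_port X hY t).symm
    · exact (F.region_out X hY hk).symm)

/-- The regions of the context as regions of the filled coin. -/
def faceCtx : (fill X Y.toPatch).Face → (fill X T.toPatch).Face :=
  Quot.lift (Sum.elim (fun f => Quot.mk _ (Sum.inl f))
    (Quot.lift (fun y => Quot.mk _ (Sum.inr (T.toPatch.face
      (Sum.elim (F.emb ∘ Sum.inl) F.ctx y)))) (by
      rintro _ _ (d | t)
      · refine congrArg (fun f => Quot.mk _ (Sum.inr f)) ?_
        rw [F.face_ctx, Sum.map_inl, Equiv.symm_apply_apply]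
      · refine congrArg (fun f => Quot.mk _ (Sum.inr f)) ?_
        rw [F.face_ctx]; rfl))) (by
    rintro _ _ (t | t | hk)
    · refine (Quot.sound (Seam.left t)).trans ?_
      refine congrArg (fun f => Quot.mk _ (Sum.inr (T.toPatch.face f))) (F.port t).symm
    · refine (Quot.sound (Seam.right t)).trans ?_
      refine congrArg (fun f => Quot.mk _ (Sum.inr f)) ?_
      refine Eq.trans ?_ (F.face_ctx (Sum.inl (Sum.inr t))).symm
      have h := T.face_rot_inv ((shift _ _).symm (Sum.inr t))
      rw [Equiv.apply_symm_apply] at h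
      exact h.trans (congrArg T.toPatch.face (F.port ((finRotate k).symm t)).symm)
    · refine (Quot.sound (Seam.hole hk)).trans ?_
      refine congrArg (fun f => Quot.mk _ (Sum.inr f)) ?_
      refine Eq.trans ?_ (F.hole hk).symm
      exact (Quot.sound Coin.Walk.outside).trans (congrArg _ F.outside))

/-- The regions of the filled context as regions of the filled coin. -/
noncomputable def faceInv : (fill (X.extend Y hY) L.toPatch).Face → (fill X T.toPatch).Face :=
  Quot.lift (Sum.elim (F.faceCtx X)
    (Quot.lift (fun d => Quot.mk _ (Sum.inr (T.toPatch.face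
      (Sum.elim (F.emb ∘ Sum.inr) F.coin (d.getD F.outside_coin.choose))))) (by
      rintro _ _ (d | _)
      · refine congrArg (fun f => Quot.mk _ (Sum.inr f)) ?_
        refine Eq.trans ?_ (F.face_coin _).symm
        exact congrArg (fun d => T.toPatch.face (Sum.elim (F.emb ∘ Sum.inr) F.coin d))
          ((shift _ _).symm_apply_apply d).symm
      · exact congrArg (fun o => Quot.mk _ (Sum.inr (T.toPatch.face
          (Sum.elim (F.emb ∘ Sum.inr) F.coin (o.getD F.outside_coin.choose)))))
          F.outside_coin.choose_spec.symm))) (by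
    rintro _ _ (t | t | hj)
    · refine (congrArg (F.faceCtx X) (fill_face_rot_inv_inr X (T := Y.toPatch) _)).trans ?_
      exact congrArg (fun f => Quot.mk _ (Sum.inr f)) (F.face_left t)
    · refine (congrArg (F.faceCtx X)
        (fill_face_inr_of_ne X (T := Y.toPatch) (Y.ne_port_inner t))).trans ?_
      exact congrArg (fun f => Quot.mk _ (Sum.inr f)) (F.face_right t).symm
    · exact absurd hj F.pos)

theorem faceInv_face (f : (fill X T.toPatch).Face) : F.faceInv X hY (F.face X hY f) = f := by
  have h : ∀ d, F.faceInv X hY (region X hY (F.emb.symm d)) =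
      Quot.mk _ (Sum.inr (T.toPatch.face d)) := fun d => by
    obtain ⟨z, rfl⟩ := F.emb.surjective d
    rw [Equiv.symm_apply_apply]
    rcases z with z | z <;> rfl
  rcases f with ⟨f | f⟩
  · rfl
  rcases f with ⟨_ | d⟩
  · exact (h F.out).trans (congrArg (fun f => Quot.mk _ (Sum.inr f))
      ((Quot.sound Coin.Walk.outside).trans (congrArg _ F.outside)).symm)
  · exact h d

/-- The darts of the filled coin as darts of the filled context. -/
def dart : (fill X T.toPatch).Dart → (fill (X.extend Y hY) L.toPatch).Dart :=
  Sum.elim (fun x => Sum.inl (Sum.inl x)) fun d => assoc X hY (Y.incl L (F.emb.symm d))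

theorem dart_emb (z : Y.Ess L) : F.dart X hY (Sum.inr (F.emb z)) = assoc X hY (Y.incl L z) :=
  congrArg (fun z => assoc X hY (Y.incl L z)) (F.emb.symm_apply_apply z)

/-- The counterpart of `start` in the filled coin. -/
def origin (z : Y.Ess L) : (fill X T.toPatch).Dart :=
  match z with
  | Sum.inl (Sum.inr t) => Sum.inl (X.port t)
  | z => Sum.inr (F.emb z)

theorem dart_origin (z : Y.Ess L) : F.dart X hY (F.origin X z) = start X hY z := by
  rcases z with (z | z) | z
  · exact F.dart_emb X hY _
  · rfl
  · exact F.dart_emb X hY _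

theorem rot_origin (z : Y.Ess L) :
    (fill X T.toPatch).rot (F.origin X z) = Sum.inr (T.rot (F.emb z)) := by
  rcases z with (z | z) | z
  · exact fill_rot_inr_of_ne X (T := T.toPatch) (F.emb_ctx_ne z)
  · rw [F.port]
    exact fill_rot_inl_port X (T := T.toPatch) Sum.inr_injective z
  · exact fill_rot_inr_of_ne X (T := T.toPatch) (F.emb_coin_ne z)

theorem face_origin (z : Y.Ess L) :
    (fill X T.toPatch).face (F.origin X z) = Quot.mk _ (Sum.inr (T.toPatch.face (F.emb z))) := by
  rcases z with (z | z) | z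
  · exact fill_face_inr_of_ne X (T := T.toPatch) (F.emb_ctx_ne z)
  · rw [F.port]
    exact fill_face_inl_port X (T := T.toPatch) Sum.inr_injective z
  · exact fill_face_inr_of_ne X (T := T.toPatch) (F.emb_coin_ne z)

theorem dart_cases (q : (fill X T.toPatch).Dart) : (∃ z, q = F.origin X z) ∨
    (∃ x, (∀ t, x ≠ X.port t) ∧ q = Sum.inl x) ∨ ∃ t, q = Sum.inr (Sum.inr t) := by
  rcases q with x | d
  · by_cases hx : ∃ t, x = X.port t
    · obtain ⟨t, rfl⟩ := hx
      exact Or.inl ⟨Sum.inl (Sum.inr t), rfl⟩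
    · push Not at hx
      exact Or.inr (Or.inl ⟨x, hx, rfl⟩)
  · obtain ⟨z, rfl⟩ := F.emb.surjective d
    rcases z with (z | z) | z
    · exact Or.inl ⟨Sum.inl (Sum.inl z), rfl⟩
    · exact Or.inr (Or.inr ⟨z, congrArg Sum.inr (F.port z)⟩)
    · exact Or.inl ⟨Sum.inr z, rfl⟩

theorem dart_port (t : Fin k) : F.dart X hY (Sum.inr (Sum.inr t)) =
    assoc X hY (Sum.inl (Sum.inl (Sum.inr t))) :=
  congrArg (fun z => assoc X hY (Y.incl L z)) (F.emb_symm_port t)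

theorem face_dart (q : (fill X T.toPatch).Dart) :
    (fill (X.extend Y hY) L.toPatch).face (F.dart X hY q) =
      F.face X hY ((fill X T.toPatch).face q) := by
  rcases F.dart_cases X q with ⟨z, rfl⟩ | ⟨x, hx, rfl⟩ | ⟨t, rfl⟩
  · rw [dart_origin, face_origin, face_start]
    exact congrArg _ (F.emb.symm_apply_apply z).symm
  · refine (face_inl_inl X hY hx).trans ?_
    rw [fill_face_inl_of_ne X hx]; rfl
  · refine (congrArg _ (F.dart_port X hY t)).trans ((face_assoc_port X hY t).trans ?_)
    exact (congrArg (F.face X hY)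
      (fill_face_inr_port X (T := T.toPatch) Sum.inr_injective t)).symm

theorem dart_ne {x : (fill (X.extend Y hY) L.toPatch).Dart} (hx : ∀ q, x ≠ F.dart X hY q) :
    ∃ z, (∀ e, z ≠ Y.incl L e) ∧ x = assoc X hY z := by
  rcases x with (x | y) | l
  · exact absurd rfl (hx (Sum.inl x))
  · exact ⟨Sum.inl y, fun e he => hx (Sum.inr (F.emb e))
      ((congrArg (assoc X hY) he).trans (F.dart_emb X hY e).symm), rfl⟩
  · exact ⟨Sum.inr l, fun e he => hx (Sum.inr (F.emb e))
      ((congrArg (assoc X hY) he).trans (F.dart_emb X hY e).symm), rfl⟩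

theorem dart_injective : Injective (F.dart X hY) := by
  have hincl : Injective (Y.incl L) := Sum.map_injective.2 ⟨Sum.inl_injective, Sum.inl_injective⟩
  rintro (x | d) (y | e) h
  · exact congrArg Sum.inl (Sum.inl_injective (Sum.inl_injective h))
  · exfalso
    generalize hz : F.emb.symm e = z
    have h : Sum.inl (Sum.inl x) = assoc X hY (Y.incl L (F.emb.symm e)) := h
    rw [hz] at h
    rcases z with z | z <;> cases h
  · exfalso
    generalize hz : F.emb.symm d = z
    have h : assoc X hY (Y.incl L (F.emb.symm d)) = Sum.inl (Sum.inl y) := h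
    rw [hz] at h
    rcases z with z | z <;> cases h
  · exact congrArg Sum.inr (F.emb.symm.injective (hincl (assoc_injective X hY h)))

theorem exists_dart_sameCycle (x : (fill (X.extend Y hY) L.toPatch).Dart) :
    ∃ q, (fill (X.extend Y hY) L.toPatch).rot.SameCycle (F.dart X hY q) x := by
  have key : ∀ (n : ℕ) z e, (Y.merge L)^[n] z = Y.incl L e →
      ∃ q, (fill (X.extend Y hY) L.toPatch).rot.SameCycle (F.dart X hY q) (assoc X hY z) := by
    intro n
    induction n with
    | zero =>
      rintro z e rfl
      exact ⟨Sum.inr (F.emb e), by rw [dart_emb]⟩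
    | succ n ih =>
      intro z e h
      by_cases hz : ∃ t, z = Sum.inl (Sum.inl (Sum.inr t))
      · obtain ⟨t, rfl⟩ := hz
        exact ⟨Sum.inr (Sum.inr t), by rw [dart_port]⟩
      · push Not at hz
        obtain ⟨q, hq⟩ := ih (Y.merge L z) e h
        rw [← rot_assoc X hY hz] at hq
        exact ⟨q, Perm.sameCycle_apply_right.1 hq⟩
  rcases x with (x | y) | l
  · exact ⟨Sum.inl x, Perm.SameCycle.refl _ _⟩
  · obtain ⟨n, e, h⟩ := F.cover (Sum.inl y)
    exact key n _ e h
  · obtain ⟨n, e, h⟩ := F.cover (Sum.inr l)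
    exact key n _ e h

theorem face_rot_inv_of_ne {x : (fill (X.extend Y hY) L.toPatch).Dart}
    (hx : ∀ q, x ≠ F.dart X hY q) :
    (fill (X.extend Y hY) L.toPatch).face ((fill (X.extend Y hY) L.toPatch).rot⁻¹ x) =
      (fill (X.extend Y hY) L.toPatch).face x := by
  obtain ⟨z, hz, rfl⟩ := F.dart_ne X hY hx
  exact face_blank X hY hz

theorem face_surjective : Surjective (F.face X hY) := by
  have := (X.extend Y hY).finite_dart
  have : Finite (fill (X.extend Y hY) L.toPatch).Dart :=
    inferInstanceAs (Finite ((X.extend Y hY).Dart ⊕ CoinDart L.edges j))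
  have key : ∀ x, ∃ f, F.face X hY f = (fill (X.extend Y hY) L.toPatch).face x := fun x => by
    obtain ⟨q, hq⟩ := F.exists_dart_sameCycle X hY x
    obtain ⟨q', -, hq'⟩ := PreBlink.exists_face_eq (F.dart X hY)
      (fun x hx => F.face_rot_inv_of_ne X hY hx) hq
    exact ⟨_, (F.face_dart X hY q').symm.trans hq'⟩
  have hL : ∀ l, ∃ f, F.face X hY f = Quot.mk _ (Sum.inr (L.toPatch.face l)) := by
    rintro (l | t)
    · obtain ⟨f, hf⟩ := key (Sum.inr (Sum.inl l))
      exact ⟨f, hf.trans (fill_face_inr_of_ne (X.extend Y hY) (T := L.toPatch)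
        fun t h => by cases h)⟩
    · obtain ⟨f, hf⟩ := key (Sum.inl (Sum.inr (Sum.inr t)))
      exact ⟨f, hf.trans (fill_face_inl_port (X.extend Y hY) (T := L.toPatch)
        Sum.inr_injective t)⟩
  rintro ⟨f | f⟩
  · rcases f with ⟨f | f⟩
    · exact ⟨Quot.mk _ (Sum.inl f), rfl⟩
    rcases f with ⟨y | t⟩
    · refine ⟨Quot.mk _ (Sum.inr (T.toPatch.face (F.emb (Sum.inl y)))), ?_⟩
      exact congrArg (region X hY) (F.emb.symm_apply_apply (Sum.inl y))
    · obtain ⟨f, hf⟩ := key (Sum.inr (Sum.inr t))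
      refine ⟨f, hf.trans ((fill_face_inr_port (X.extend Y hY) (T := L.toPatch)
        Sum.inr_injective t).trans ?_)⟩
      exact congrArg (fun f => Quot.mk _ (Sum.inl f))
        (fill_face_inr_of_ne X (T := Y.toPatch) (Y.ne_port_inner t))
  rcases f with ⟨_ | l⟩
  · obtain ⟨o, ho⟩ := F.outside_coin
    obtain ⟨f, hf⟩ := hL o
    refine ⟨f, hf.trans (congrArg (fun f => Quot.mk _ (Sum.inr f)) ?_)⟩
    exact ((Quot.sound Coin.Walk.outside).trans (congrArg _ ho)).symm
  · exact hL l

/-- A coin that consists of a context and of a smaller coin. -/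
theorem isotopic :
    (fill X T.toPatch).Isotopic (fill (X.extend Y hY) L.toPatch) := by
  have := X.finite_dart
  have := (X.extend Y hY).finite_dart
  have : Finite (fill (X.extend Y hY) L.toPatch).Dart :=
    inferInstanceAs (Finite ((X.extend Y hY).Dart ⊕ CoinDart L.edges j))
  have : Finite (fill X T.toPatch).Dart :=
    inferInstanceAs (Finite (X.Dart ⊕ CoinDart T.edges k))
  refine PreBlink.isotopic_of_thin (F.dart X hY)
    (Equiv.ofBijective (F.face X hY) ⟨LeftInverse.injective (F.faceInv_face X hY),
      F.face_surjective X hY⟩) (F.dart_injective X hY) ?_ ?_ ?_ ?_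
    (F.exists_dart_sameCycle X hY) (F.face_dart X hY)
    (fun x hx => F.face_rot_inv_of_ne X hY hx) rfl
  · rintro (x | d)
    · rfl
    · obtain ⟨z, rfl⟩ := F.emb.surjective d
      rw [dart_emb]
      rcases z with (z | z) | z
      · refine Eq.trans ?_ ((congrArg (fun d => F.dart X hY (Sum.inr d))
          (F.opp_ctx z)).symm.trans (F.dart_emb X hY _)).symm
        rfl
      · rw [F.port]
        exact (F.dart_port X hY z).symm
      · refine Eq.trans ?_ ((congrArg (fun d => F.dart X hY (Sum.inr d))
          (F.opp_coin z)).symm.trans (F.dart_emb X hY _)).symm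
        rfl
  · intro x hx
    obtain ⟨((z | z) | z) | (z | z), hz, rfl⟩ := F.dart_ne X hY hx
    · exact absurd rfl (hz (Sum.inl (Sum.inl z)))
    · exact absurd rfl (hz (Sum.inl (Sum.inr z)))
    · rfl
    · exact absurd rfl (hz (Sum.inr z))
    · rfl
  · rintro (x | d) hd
    · rfl
    · obtain ⟨z, rfl⟩ := F.emb.surjective d
      rw [dart_emb]
      rcases z with (z | z) | z
      · exact (F.black_ctx z).symm
      · exact absurd (congrArg (fill X T.toPatch).opp (congrArg Sum.inr (F.port z)))
          (fun h => hd (h.trans (congrArg Sum.inr (F.port z)).symm))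
      · exact (F.black_coin z).symm
  · intro q
    rcases F.dart_cases X q with ⟨z, rfl⟩ | ⟨x, hx, rfl⟩ | ⟨t, rfl⟩
    · obtain ⟨n, hn, hn'⟩ := F.rot z
      refine ⟨n, ?_, fun m hm q hq => ?_⟩
      · rw [dart_origin, rot_pow_start X hY z n hn', rot_origin, hn]
        rfl
      · rw [dart_origin, rot_pow_start X hY z m fun l hl => hn' l (by omega)] at hq
        rcases q with x | d
        · generalize (Y.merge L)^[m + 1] (Y.incl L z) = w at hq
          rcases w with w | w <;> cases hq
        · exact hn' m hm _ (assoc_injective X hY hq)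
    · refine ⟨0, ?_, fun m hm => absurd hm (Nat.not_lt_zero m)⟩
      rw [fill_rot_inl_of_ne X hx]
      exact rot_inl_inl X hY hx
    · refine ⟨0, ?_, fun m hm => absurd hm (Nat.not_lt_zero m)⟩
      rw [zero_add, pow_one]
      refine (congrArg _ (F.dart_port X hY t)).trans ((rot_assoc_port X hY t).trans ?_)
      exact congrArg (F.dart X hY)
        (fill_rot_inr_port X (T := T.toPatch) Sum.inr_injective t).symm

end Fits

end BlinkCalculus

namespace BlinkCalculus

open Equiv Function

/-! ## Computation with permutations -/

/-- A type whose elements are numbered. -/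
class Coded (α : Type) where
  size : ℕ
  key : α → ℕ
  elt : ℕ → Option α
  key_lt : ∀ a, key a < size
  elt_key : ∀ a, elt (key a) = some a

namespace Coded

instance (n : ℕ) : Coded (Fin n) where
  size := n
  key a := a
  elt m := if h : m < n then some ⟨m, h⟩ else none
  key_lt a := a.2
  elt_key a := by simp

instance (α : Type) [Coded α] : Coded (α × Bool) where
  size := 2 * size α
  key a := 2 * key a.1 + a.2.toNat
  elt m := (elt (m / 2)).map fun a => (a, m % 2 == 1)
  key_lt := by
    rintro ⟨a, _ | _⟩ <;> have := key_lt a <;> simp <;> omega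
  elt_key := by
    rintro ⟨a, _ | _⟩
    · simp [elt_key]
    · have h : (2 * key a + 1) / 2 = key a := by omega
      simp [h, elt_key, Nat.add_mod]

instance (α β : Type) [Coded α] [Coded β] : Coded (α ⊕ β) where
  size := size α + size β
  key := Sum.elim key fun b => size α + key b
  elt m := if m < size α then (elt m).map Sum.inl else (elt (m - size α)).map Sum.inr
  key_lt := by
    rintro (a | b)
    · exact (key_lt a).trans_le (Nat.le_add_right _ _)
    · exact Nat.add_lt_add_left (key_lt b) _
  elt_key := by
    rintro (a | b)
    · simp [key_lt a, elt_key]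
    · simp [elt_key]

variable {α : Type} [Coded α]

theorem key_injective : Injective (key : α → ℕ) := fun a b h =>
  Option.some_injective _ ((elt_key a).symm.trans ((congrArg elt h).trans (elt_key b)))

theorem card_le_size [Fintype α] : Fintype.card α ≤ size α := by
  have := Fintype.card_le_of_injective (fun a : α => (⟨key a, key_lt a⟩ : Fin (size α)))
    fun a b h => key_injective (Fin.mk.inj h)
  simpa using this

/-- The number with the given digits in base `b`. -/
def pack (b : ℕ) : List ℕ → ℕ :=
  List.foldr (fun a n => Nat.add a (Nat.mul b n)) 0

/-- The digit with a given index in base `b`. -/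
def digit (b n i : ℕ) : ℕ := Nat.mod (Nat.div n (Nat.pow b i)) b

theorem digit_pack {b : ℕ} {l : List ℕ} (hl : ∀ a ∈ l, a < b) {i : ℕ} (hi : i < l.length) :
    digit b (pack b l) i = l[i] := by
  induction l generalizing i with
  | nil => exact absurd hi i.not_lt_zero
  | cons a l ih =>
    have ha : a < b := hl a List.mem_cons_self
    change (a + b * pack b l) / b ^ i % b = _
    cases i with
    | zero => rw [pow_zero, Nat.div_one, Nat.add_mul_mod_self_left, Nat.mod_eq_of_lt ha]; rfl
    | succ i =>
      rw [pow_succ', ← Nat.div_div_eq_div_mul, Nat.add_mul_div_left _ _ (by omega),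
        Nat.div_eq_of_lt ha, Nat.zero_add]
      exact ih (fun a ha => hl a (List.mem_cons_of_mem _ ha)) (Nat.lt_of_succ_lt_succ hi)

/-- The values of a function, as a number. -/
def memo (f : α → ℕ) : ℕ :=
  pack (size α) ((List.range (size α)).map fun n => (elt n).elim 0 f)

theorem digit_memo {f : α → ℕ} (hf : ∀ a, f a < size α) (a : α) :
    digit (size α) (memo f) (key a) = f a := by
  refine (digit_pack (fun b hb => ?_) (by simpa using key_lt a)).trans (by simp [elt_key])
  obtain ⟨n, -, rfl⟩ := List.mem_map.1 hb
  rcases elt (α := α) n with _ | b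
  · exact (Nat.zero_le _).trans_lt (key_lt a)
  · exact hf b

/-- The numbers of the elements, as a number whose digits are indexed by the values of a function. -/
def memoInv (α : Type) [Coded α] (f : α → ℕ) : ℕ :=
  (List.range (size α)).foldr (fun n m => Nat.add m ((elt n).elim 0 fun a : α =>
    Nat.mul n (Nat.pow (size α) (f a)))) 0

theorem injective_of_memoInv {f : α → ℕ}
    (h : ∀ a, digit (size α) (memoInv α f) (f a) = key a) : Injective f := fun a b hab =>
  key_injective ((h a).symm.trans ((congrArg (digit (size α) (memoInv α f)) hab).trans (h b)))

/-- The same permutation, in a form in which it is quickly computed. -/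
def memoPerm (f : Perm α) : Perm α where
  toFun a := (elt (digit (size α) (memo fun a => key (f a)) (key a))).getD a
  invFun a := (elt (digit (size α) (memo fun a => key (f⁻¹ a)) (key a))).getD a
  left_inv a := by simp [digit_memo fun a => key_lt _, elt_key]
  right_inv a := by simp [digit_memo fun a => key_lt _, elt_key]

theorem memoPerm_eq (f : Perm α) : memoPerm f = f :=
  Equiv.ext fun a => by simp [memoPerm, digit_memo fun a => key_lt _, elt_key]

/-- The permutation given by the list of the numbers of the images. -/
def tablePerm [Fintype α] (l : List ℕ) : Perm α :=
  let f (a : α) : α := (elt (digit (size α) (pack (size α) l) (key a))).getD a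
  let g (a : α) : α := (elt (digit (size α) (memoInv α fun a => key (f a)) (key a))).getD a
  if h : (∀ a, key (g (f a)) = key a) ∧ ∀ a, key (f (g a)) = key a then
    ⟨f, g, fun a => key_injective (h.1 a), fun a => key_injective (h.2 a)⟩
  else 1

/-- The least number that is met in some steps of a walk that stops before it comes to `s`. -/
def walkMin (g : ℕ → ℕ) (s : ℕ) : ℕ → ℕ → ℕ
  | 0, a => a
  | n + 1, a =>
    bif Nat.beq (g a) s then a
    else bif Nat.ble a (walkMin g s n (g a)) then a else walkMin g s n (g a)

theorem exists_walkMin (g : ℕ → ℕ) (s n a : ℕ) : ∃ m, walkMin g s n a = g^[m] a := by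
  induction n generalizing a with
  | zero => exact ⟨0, rfl⟩
  | succ n ih =>
    obtain ⟨m, hm⟩ := ih (g a)
    unfold walkMin
    cases Nat.beq (g a) s
    · cases Nat.ble a (walkMin g s n (g a))
      · exact ⟨m + 1, hm⟩
      · exact ⟨0, rfl⟩
    · exact ⟨0, rfl⟩

theorem walkMin_le (g : ℕ → ℕ) (s : ℕ) {n m : ℕ} (h : m ≤ n) (a : ℕ)
    (hm : ∀ l < m, g^[l + 1] a ≠ s) : walkMin g s n a ≤ g^[m] a := by
  induction n generalizing a m with
  | zero => rw [Nat.le_zero.1 h]; exact le_rfl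
  | succ n ih =>
    unfold walkMin
    cases m with
    | zero =>
      cases Nat.beq (g a) s
      · cases hb : Nat.ble a (walkMin g s n (g a))
        · exact le_of_not_ge fun h : a ≤ walkMin g s n (g a) => by
            rw [Nat.ble_eq_true_of_le h] at hb; cases hb
        · exact le_rfl
      · exact le_rfl
    | succ m =>
      have h1 : Nat.beq (g a) s = false := by
        have h0 : g a ≠ s := hm 0 (Nat.succ_pos m)
        cases h : Nat.beq (g a) s
        · rfl
        · exact absurd (Nat.eq_of_beq_eq_true h) h0
      have h2 := ih (Nat.le_of_succ_le_succ h) (g a)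
        fun l hl => hm (l + 1) (Nat.succ_lt_succ hl)
      rw [h1]
      cases hb : Nat.ble a (walkMin g s n (g a))
      · exact h2
      · exact (Nat.le_of_ble_eq_true hb).trans h2

/-- The least number of an element of the cycle of an element, as a function of its number. -/
def cycleMin (f : Perm α) (n : ℕ) : ℕ :=
  walkMin (digit (size α) (memo fun a => key (f a))) n (size α) n

theorem iterate_digit (f : Perm α) (m : ℕ) (a : α) :
    (digit (size α) (memo fun a => key (f a)))^[m] (key a) = key (f^[m] a) := by
  induction m with
  | zero => rfl
  | succ m ih =>
    rw [iterate_succ_apply', ih, digit_memo fun a => key_lt _, iterate_succ_apply']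

theorem exists_cycleMin (f : Perm α) (a : α) :
    ∃ b, f.SameCycle a b ∧ cycleMin f (key a) = key b := by
  obtain ⟨m, hm⟩ := exists_walkMin (digit (size α) (memo fun a => key (f a))) (key a) (size α)
    (key a)
  exact ⟨f^[m] a, ⟨m, by rw [zpow_natCast, Perm.coe_pow]⟩, hm.trans (iterate_digit f m a)⟩

theorem cycleMin_le [Fintype α] (f : Perm α) {a b : α} (h : f.SameCycle a b) :
    cycleMin f (key a) ≤ key b := by
  classical
  have hex : ∃ i : ℕ, i ≤ size α ∧ f^[i] a = b := by
    by_cases ha : a ∈ f.support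
    · obtain ⟨i, hi, rfl⟩ := h.exists_pow_eq_of_mem_support ha
      exact ⟨i, (Nat.le_of_lt hi).trans
        ((Finset.card_le_univ (f.cycleOf a).support).trans card_le_size), by rw [Perm.coe_pow]⟩
    · exact ⟨0, Nat.zero_le _, h.eq_of_left (Perm.notMem_support.1 ha)⟩
  obtain ⟨h1, h2⟩ := Nat.find_spec hex
  rw [← h2, ← iterate_digit]
  refine walkMin_le _ _ h1 _ fun l hl hr => Nat.find_min hex (Nat.sub_lt (by omega) l.succ_pos)
    ⟨(Nat.sub_le _ _).trans h1, ?_⟩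
  rw [iterate_digit] at hr
  have h3 := congrArg (fun i => f^[i] a) (Nat.sub_add_cancel (Nat.succ_le_of_lt hl))
  rw [h2, iterate_add_apply, Nat.succ_eq_add_one, key_injective hr] at h3
  exact h3

/-- The least number of an element of the cycle of `a`. -/
def label (f : Perm α) (a : α) : ℕ := digit (size α) (memo fun a : α => cycleMin f (key a)) (key a)

theorem exists_label (f : Perm α) (a : α) : ∃ b, f.SameCycle a b ∧ label f a = key b := by
  obtain ⟨b, hb, hb'⟩ := exists_cycleMin f a
  refine ⟨b, hb, (digit_memo (f := fun a => cycleMin f (key a)) (fun a => ?_) a).trans hb'⟩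
  obtain ⟨c, -, hc⟩ := exists_cycleMin f a
  rw [hc]
  exact key_lt c

theorem label_le [Fintype α] (f : Perm α) {a b : α} (h : f.SameCycle a b) : label f a ≤ key b := by
  refine (digit_memo (f := fun a => cycleMin f (key a)) (fun a => ?_) a).trans_le (cycleMin_le f h)
  obtain ⟨c, -, hc⟩ := exists_cycleMin f a
  rw [hc]
  exact key_lt c

theorem label_eq_iff [Fintype α] {f : Perm α} {a b : α} : label f a = label f b ↔ f.SameCycle a b := by
  constructor
  · intro h
    obtain ⟨c, hc, hc'⟩ := exists_label f a
    obtain ⟨d, hd, hd'⟩ := exists_label f b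
    rw [h, hd'] at hc'
    rw [key_injective hc'] at hd
    exact hc.trans hd.symm
  · intro h
    obtain ⟨c, hc, hc'⟩ := exists_label f a
    obtain ⟨d, hd, hd'⟩ := exists_label f b
    exact le_antisymm ((label_le f (h.trans hd)).trans_eq hd'.symm)
      ((label_le f (h.symm.trans hc)).trans_eq hc'.symm)

theorem card_filter_label [Fintype α] [DecidableEq α] (f : Perm α)
    {β : Type} (g : α → β) (hg : ∀ a b, g a = g b ↔ f.SameCycle a b) (P : β → Prop) (Q : α → Prop)
    [DecidablePred Q] (hQ : ∀ a, Q a ↔ P (g a)) (hs : Surjective g) :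
    Nat.card {b // P b} = (Finset.univ.filter fun a => label f a = key a ∧ Q a).card := by
  rw [← Fintype.card_subtype, ← Nat.card_eq_fintype_card]
  refine (Nat.card_congr (Equiv.ofBijective
    (fun a : {a // label f a = key a ∧ Q a} => (⟨g a.1, (hQ _).1 a.2.2⟩ : {b // P b})) ⟨?_, ?_⟩)).symm
  · rintro ⟨a, ha, ha'⟩ ⟨b, hb, hb'⟩ h
    have h := label_eq_iff.2 ((hg a b).1 (congrArg Subtype.val h))
    exact Subtype.ext (key_injective (ha.symm.trans (h.trans hb)))
  · rintro ⟨b, hb⟩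
    obtain ⟨a, rfl⟩ := hs b
    obtain ⟨c, hc, hc'⟩ := exists_label f a
    have hgc := (hg a c).2 hc
    exact ⟨⟨c, (label_eq_iff.2 hc).symm.trans hc', (hQ c).2 (hgc ▸ hb)⟩, Subtype.ext hgc.symm⟩

end Coded

end BlinkCalculus

namespace BlinkCalculus

open Equiv Function Coded

namespace Coin

variable {k : ℕ} (c : Coin k)

theorem face_eq_of_sameCycle {d d' : CoinDart c.edges k} (h : c.dual.rot.SameCycle d d') :
    c.toPatch.face d = c.toPatch.face d' := by
  have step : ∀ d, c.toPatch.face (c.dual.rot d) = c.toPatch.face d := fun d => c.face_rot_inv d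
  obtain ⟨n, rfl⟩ := h.exists_nat_pow_eq
  induction n with
  | zero => rfl
  | succ n ih =>
    rw [pow_succ']
    exact (ih ⟨n, by rw [zpow_natCast]⟩).trans (step _).symm

theorem face_eq_of_label {d d' : CoinDart c.edges k}
    (h : label c.dual.rot d = label c.dual.rot d') : c.toPatch.face d = c.toPatch.face d' :=
  c.face_eq_of_sameCycle (label_eq_iff.1 h)

variable {c} in
theorem face_eq_iff {x : CoinDart c.edges k} (hx : c.outside = some x) {d d' : CoinDart c.edges k} :
    c.toPatch.face d = c.toPatch.face d' ↔ c.dual.rot.SameCycle d d' := by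
  refine ⟨fun h => ?_, c.face_eq_of_sameCycle⟩
  let F : c.toPatch.Face → ℕ := Quot.lift (fun o => label c.dual.rot (o.getD x)) (by
    rintro _ _ (d | _)
    · exact label_eq_iff.2 ⟨1, by rw [zpow_one]; rfl⟩
    · rw [hx]; rfl)
  exact label_eq_iff.1 (congrArg F h)

variable {c} in
theorem hole_eq {x : CoinDart c.edges k} (hx : c.outside = some x) :
    c.toPatch.hole = c.toPatch.face x :=
  (Quot.sound Coin.Walk.outside).trans (congrArg _ hx)

variable {c} in
theorem face_surjective {x : CoinDart c.edges k} (hx : c.outside = some x) :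
    Surjective c.toPatch.face := by
  rintro ⟨_ | d⟩
  · exact ⟨x, (hole_eq hx).symm⟩
  · exact ⟨d, rfl⟩

/-- A number for each dart, the same for darts that are connected by the given edges. -/
def piece : List (Fin c.edges) → CoinDart c.edges k → ℕ
  | [], d => label c.rot d
  | a :: l, d => if piece l d = piece l (i a) then piece l (o a) else piece l d

theorem eqvGen_of_piece {l : List (Fin c.edges)} {d d' : CoinDart c.edges k}
    (h : c.piece l d = c.piece l d') :
    Relation.EqvGen (fun d d' => d' = c.toPatch.rot d ∨ d' = c.toPatch.opp d) d d' := by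
  induction l generalizing d d' with
  | nil =>
    obtain ⟨n, rfl⟩ := (label_eq_iff.1 h).exists_nat_pow_eq
    clear h
    induction n with
    | zero => exact .refl _
    | succ n ih =>
      exact ih.trans _ _ _ (.rel _ _ (Or.inl (by rw [pow_succ']; rfl)))
  | cons a l ih =>
    have ha : Relation.EqvGen (fun d d' => d' = c.toPatch.rot d ∨ d' = c.toPatch.opp d)
      (o a) (i a) := .rel _ _ (Or.inr rfl)
    simp only [piece] at h
    split_ifs at h with h1 h2 h2
    · exact (ih h1).trans _ _ _ (ih h2).symm
    · exact ((ih h1).trans _ _ _ ha.symm).trans _ _ _ (ih h)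
    · exact (ih h).trans _ _ _ (ha.trans _ _ _ (ih h2).symm)
    · exact ih h

/-- A criterion for a coin to be a connected plane graph in a disk. -/
def DiskCheck : Prop :=
  match c.outside with
  | none => False
  | some x =>
    (∀ d, c.piece (List.finRange c.edges) d = c.piece (List.finRange c.edges) x) ∧
    (∀ s t : Fin k, label c.dual.rot (Sum.inr s) = label c.dual.rot (Sum.inr t) → s = t) ∧
    (Finset.univ.filter fun d => label c.rot d = key d ∧ True).card +
      (Finset.univ.filter fun d => label c.dual.rot d = key d ∧
        (∀ t : Fin k, label c.dual.rot d ≠ label c.dual.rot (Sum.inr t)) ∧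
          (k = 0 → label c.dual.rot d ≠ label c.dual.rot x)).card = c.edges + 1

instance : Decidable c.DiskCheck := by
  unfold DiskCheck
  cases c.outside <;> infer_instance

theorem card_edgeDart : Nat.card {d // c.toPatch.opp d ≠ d} = 2 * c.edges := by
  have e : {d // c.toPatch.opp d ≠ d} ≃ Fin c.edges × Bool :=
    (Equiv.ofBijective (fun d : Fin c.edges × Bool =>
      (⟨Sum.inl d, by rcases d with ⟨d, _ | _⟩ <;> intro h <;> cases h⟩ :
        {d // c.toPatch.opp d ≠ d})) ⟨fun d d' h => Sum.inl_injective (congrArg Subtype.val h), by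
        rintro ⟨d | d, hd⟩
        · exact ⟨d, rfl⟩
        · exact absurd rfl hd⟩).symm
  rw [Nat.card_congr e, Nat.card_eq_fintype_card, Fintype.card_prod, Fintype.card_fin,
    Fintype.card_bool, mul_comm]

variable {c} in
theorem DiskCheck.isDisk (h : c.DiskCheck) : c.toPatch.IsDisk := by
  unfold DiskCheck at h
  split at h
  · exact h.elim
  rename_i x hx
  obtain ⟨hc, hp, he⟩ := h
  refine { c.toPatch_isLocal with
    nonempty := ⟨x⟩
    connected := fun d d' => c.eqvGen_of_piece ((hc d).trans (hc d').symm)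
    face_surjective := face_surjective hx
    port_walk := fun t => c.face_rot_inv (Sum.inr t)
    face_port_injective := fun s t h => hp s t (label_eq_iff.2 ((face_eq_iff hx).1 h))
    euler := ?_ }
  have h1 := card_filter_label c.rot c.toPatch.vertex (fun a b => Quotient.eq) (fun _ => True)
    (fun _ => True) (fun _ => Iff.rfl) Quotient.mk_surjective
  have h2 := card_filter_label c.dual.rot c.toPatch.face (fun a b => face_eq_iff hx)
    (fun f => ¬ c.toPatch.Boundary f) (fun d =>
      (∀ t : Fin k, label c.dual.rot d ≠ label c.dual.rot (Sum.inr t)) ∧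
        (k = 0 → label c.dual.rot d ≠ label c.dual.rot x)) (fun d => ?_) (face_surjective hx)
  · rw [← h1, ← h2, Nat.card_congr (Equiv.subtypeUnivEquiv fun _ => trivial)] at he
    rw [card_edgeDart, ← mul_add, he, mul_add]
  · rw [Patch.Boundary, not_or, not_exists, not_and, hole_eq hx]
    refine and_congr (forall_congr' fun t => not_congr ?_)
      (forall_congr' fun _ => not_congr ?_) <;>
    exact label_eq_iff.trans (face_eq_iff hx).symm


end Coin


end BlinkCalculus

namespace BlinkCalculus

open Equiv Function Coded

/-- The coin given by the number of edges, the list of the black edges, the list of the successors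
of the darts, and a dart on the outside. -/
def Coin.ofTable {k : ℕ} (e : ℕ) (black rot : List ℕ) (outside : ℕ) : Coin k where
  edges := e
  rot := tablePerm rot
  black a := black.contains a.1
  outside := elt outside

/-- The same coin, in a form in which its rotation is quickly computed. -/
def Coin.memo {k : ℕ} (c : Coin k) : Coin k := { c with rot := memoPerm c.rot }

theorem Coin.memo_eq {k : ℕ} (c : Coin k) : c.memo = c :=
  congrArg (fun r => { c with rot := r }) (memoPerm_eq c.rot)

/-- The context given by the number of edges, the list of the black edges, the list of the
successors of the darts, and a dart on the outside. -/
def Context.ofTable {k j : ℕ} (e : ℕ) (black rot : List ℕ) (outside : CoinDart e k ⊕ Fin j) :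
    Context k j where
  edges := e
  rot := tablePerm rot
  black a := black.contains a.1
  outside := outside

namespace Context

variable {k j : ℕ} (Y : Context k j) (L : Coin j)

/-- A criterion for the vertices on the inner circle to be different. -/
def SeparatedCheck : Prop :=
  ∀ s t : Fin j, label Y.rot (Sum.inr s) = label Y.rot (Sum.inr t) → s = t

instance : Decidable Y.SeparatedCheck :=
  inferInstanceAs (Decidable (∀ _ _ : Fin j, _ → _))

variable {Y} in
theorem SeparatedCheck.separated (h : Y.SeparatedCheck) : Y.Separated := fun s t hst =>
  h s t (label_eq_iff.2 hst)

/-- The first dart, from `z` on, that remains if the inner ports are removed. -/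
def firstEss : ℕ → Y.Dart ⊕ CoinDart L.edges j → Option (Y.Ess L)
  | _, Sum.inl (Sum.inl d) => some (Sum.inl d)
  | _, Sum.inr (Sum.inl d) => some (Sum.inr d)
  | 0, _ => none
  | n + 1, z => firstEss n (Y.merge L z)

variable {Y L} in
theorem exists_of_firstEss {n : ℕ} {z : Y.Dart ⊕ CoinDart L.edges j} {e : Y.Ess L}
    (h : Y.firstEss L n z = some e) :
    ∃ m, (Y.merge L)^[m] z = Y.incl L e ∧ ∀ l < m, ∀ e, (Y.merge L)^[l] z ≠ Y.incl L e := by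
  induction n generalizing z with
  | zero =>
    rcases z with (z | z) | (z | z) <;> cases h <;>
      exact ⟨0, rfl, fun m hm => absurd hm m.not_lt_zero⟩
  | succ n ih =>
    rcases z with (z | z) | (z | z)
    · cases h
      exact ⟨0, rfl, fun m hm => absurd hm m.not_lt_zero⟩
    · obtain ⟨m, hm, hm'⟩ := ih (z := Y.merge L (Sum.inl (Sum.inr z))) h
      refine ⟨m + 1, hm, fun l hl e => ?_⟩
      cases l with
      | zero => rcases e with e | e <;> intro h <;> cases h
      | succ l => exact hm' l (Nat.lt_of_succ_lt_succ hl) e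
    · cases h
      exact ⟨0, rfl, fun m hm => absurd hm m.not_lt_zero⟩
    · obtain ⟨m, hm, hm'⟩ := ih (z := Y.merge L (Sum.inr (Sum.inr z))) h
      refine ⟨m + 1, hm, fun l hl e => ?_⟩
      cases l with
      | zero => rcases e with e | e <;> intro h <;> cases h
      | succ l => exact hm' l (Nat.lt_of_succ_lt_succ hl) e

end Context

/-- The position of a context and of a coin in a larger coin: the numbers of the darts in the place
of the first darts of the edges of the context and of the coin, and those of darts in the same
regions as the ports on the inner circle of the context and as the ports of the coin. -/
structure Position where
  edge : List ℕ
  ctx : List ℕ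
  coin : List ℕ

namespace Position

variable {k j : ℕ} (P : Position) (T : Coin k) (Y : Context k j) (L : Coin j)
  (x : CoinDart T.edges k)

/-- The dart with a given number. -/
def dart {α : Type} [Coded α] (x : α) (n : ℕ) : α := (elt n).getD x

/-- The dart of the larger coin in the place of a dart. -/
def emb : Y.Ess L → CoinDart T.edges k
  | Sum.inl (Sum.inl (a, b)) =>
    cond b (flip (dart x (P.edge.getD a 0))) (dart x (P.edge.getD a 0))
  | Sum.inl (Sum.inr t) => Sum.inr t
  | Sum.inr (a, b) =>
    cond b (flip (dart x (P.edge.getD (Y.edges + a) 0))) (dart x (P.edge.getD (Y.edges + a) 0))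

/-- The extension of `emb` to the ports on the inner circle. -/
def embCtx : Y.Dart → CoinDart T.edges k :=
  Sum.elim (P.emb T Y L x ∘ Sum.inl) fun t => dart x (P.ctx.getD t 0)

/-- The extension of `emb` to the ports of the coin. -/
def embCoin : CoinDart L.edges j → CoinDart T.edges k :=
  Sum.elim (P.emb T Y L x ∘ Sum.inr) fun t => dart x (P.coin.getD t 0)

/-- The number of the region of a dart of the larger coin. -/
def region (d : CoinDart T.edges k) : ℕ := label T.dual.rot d

/-- The part of `Check` that concerns the darts. -/
def DartCheck : Prop :=
  j ≠ 0 ∧ Y.edges + L.edges = T.edges ∧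
  (∀ a : Y.Ess L, digit (size (Y.Ess L)) (memoInv (Y.Ess L) fun a => key (P.emb T Y L x a))
    (key (P.emb T Y L x a)) = key a) ∧
  (∀ d, T.toPatch.black (P.emb T Y L x (Sum.inl (Sum.inl d))) = Y.black d.1) ∧
  (∀ d, T.toPatch.black (P.emb T Y L x (Sum.inr d)) = L.black d.1) ∧
  (∀ z, ((Y.firstEss L (2 * j) (Y.merge L (Y.incl L z))).map fun e => key (P.emb T Y L x e)) =
    some (key (T.rot (P.emb T Y L x z)))) ∧
  (∀ t, (Y.firstEss L (2 * j) (Sum.inl (Sum.inr t))).isSome) ∧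
  ∀ t, (Y.firstEss L (2 * j) (Sum.inr (Sum.inr t))).isSome

/-- The part of `Check` that concerns the regions. -/
def FaceCheck : Prop :=
  (∀ y, region T (P.embCtx T Y L x (Y.rot⁻¹ y)) =
    region T (P.embCtx T Y L x (Sum.map (shift _ _).symm (finRotate j) y))) ∧
  (∀ d, region T (P.embCoin T Y L x (L.rot⁻¹ d)) =
    region T (P.embCoin T Y L x ((shift _ _).symm d))) ∧
  (∀ t, region T (P.embCtx T Y L x (Y.rot⁻¹ (Sum.inr t))) =
    region T (P.embCoin T Y L x (Sum.inr t))) ∧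
  (∀ t, region T (P.embCoin T Y L x (L.rot⁻¹ (Sum.inr t))) =
    region T (P.embCtx T Y L x (Sum.inr t))) ∧
  L.outside.isSome ∧
  (k = 0 → region T (P.embCtx T Y L x Y.outside) = region T x) ∧
  (k = 0 → ∃ t d, Y.outside = Y.rot⁻¹ (Sum.inr t) ∧ P.emb T Y L x (Sum.inr d) = x ∧
    label L.dual.rot (Sum.inr t) = label L.dual.rot (Sum.inl d))

instance : Decidable (P.DartCheck T Y L x) := by
  unfold DartCheck
  infer_instance

instance : Decidable (P.FaceCheck T Y L x) := by
  unfold FaceCheck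
  infer_instance

/-- A criterion for a coin to consist of a context and of a smaller coin. -/
def Check : Prop :=
  match T.outside with
  | none => False
  | some x => P.DartCheck T Y L x ∧ P.FaceCheck T Y L x

instance : Decidable (P.Check T Y L) := by
  unfold Check
  cases T.outside <;> infer_instance

variable {P T Y L x}

theorem face_eq_of_region {d d' : CoinDart T.edges k} (h : region T d = region T d') :
    T.toPatch.face d = T.toPatch.face d' :=
  T.face_eq_of_label h

theorem DartCheck.bijective (h : P.DartCheck T Y L x) : Bijective (P.emb T Y L x) := by
  refine (Fintype.bijective_iff_injective_and_card _).2
    ⟨fun a b hab => injective_of_memoInv h.2.2.1 (congrArg key hab), ?_⟩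
  have := h.2.1
  simp only [Fintype.card_sum, Fintype.card_prod, Fintype.card_fin, Fintype.card_bool]
  omega

theorem Check.fits (h : P.Check T Y L) : Nonempty (Fits T Y L) := by
  unfold Check at h
  split at h
  · exact h.elim
  rename_i x hx
  obtain ⟨hd, hctx, hcoin, hleft, hright, hout, hole, hole'⟩ := h
  have hbij := hd.bijective
  obtain ⟨hj, -, -, hbctx, hbcoin, hrot, hcovctx, hcovcoin⟩ := hd
  refine ⟨{
    emb := Equiv.ofBijective _ hbij
    ctx := fun t => dart x (P.ctx.getD t 0)
    coin := fun t => dart x (P.coin.getD t 0)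
    pos := hj
    port := fun t => rfl
    opp_ctx := ?_
    opp_coin := ?_
    black_ctx := hbctx
    black_coin := hbcoin
    rot := fun z => ?_
    cover := fun z => ?_
    face_ctx := fun y => face_eq_of_region (hctx y)
    face_coin := fun d => face_eq_of_region (hcoin d)
    face_left := fun t => face_eq_of_region (hleft t)
    face_right := fun t => face_eq_of_region (hright t)
    out := x
    outside := hx
    outside_coin := Option.isSome_iff_exists.1 hout
    hole := fun hk => face_eq_of_region (hole hk)
    hole' := fun hk => ?_ }⟩
  · rintro ⟨d, _ | _⟩
    · rfl
    · exact (flip_flip _).symm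
  · rintro ⟨d, _ | _⟩
    · rfl
    · exact (flip_flip _).symm
  · obtain ⟨e, he, he'⟩ := Option.map_eq_some_iff.1 (hrot z)
    obtain ⟨m, hm, hm'⟩ := Context.exists_of_firstEss he
    refine ⟨m, ?_, fun l hl => hm' l hl⟩
    refine hm.trans (congrArg (Y.incl L) ?_)
    rw [Equiv.eq_symm_apply]
    exact key_injective he'
  · have key : ∀ z, (Y.firstEss L (2 * j) z).isSome → ∃ n e, (Y.merge L)^[n] z = Y.incl L e :=
      fun z hz => by
        obtain ⟨e, he⟩ := Option.isSome_iff_exists.1 hz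
        obtain ⟨m, hm, -⟩ := Context.exists_of_firstEss he
        exact ⟨m, e, hm⟩
    rcases z with (z | z) | (z | z)
    · exact ⟨0, Sum.inl z, rfl⟩
    · exact key _ (hcovctx z)
    · exact ⟨0, Sum.inr z, rfl⟩
    · exact key _ (hcovcoin z)
  · obtain ⟨t, d, h1, h2, h3⟩ := hole' hk
    exact ⟨t, d, h1, h2, L.face_eq_of_label h3⟩

end Position

end BlinkCalculus

namespace BlinkCalculus

open Equiv Function

/-! ## Planarity of isotopic graphs -/

namespace PreBlink

variable {B C : PreBlink}

/-- The component of a vertex. -/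
def Vertex.component (v : B.Vertex) : B.Component :=
  Quotient.lift B.component (fun _ _ => B.component_eq_of_sameCycle) v

theorem exists_opp (hopp : ∀ d, B.opp (B.opp d) = d) (d : B.Dart) :
    B.opp d = d ∨ ∃ e e' : B.EdgeDart, e.1 = d ∧ e'.1 = B.opp d := by
  by_cases h : B.opp d = d
  · exact Or.inl h
  · exact Or.inr ⟨⟨d, h⟩, ⟨B.opp d, fun h' => h ((hopp d).symm.trans h').symm⟩, rfl, rfl⟩

theorem Isotopic.card_component_le (h : B.Isotopic C) (hfin : Finite B.Dart)
    (hopp : ∀ d, B.opp (B.opp d) = d) : Nat.card C.Component ≤ Nat.card B.Component := by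
  obtain ⟨eV, eD, eF, hV, hO, -, -, -, -, -⟩ := h
  have : Finite B.Component := Finite.of_surjective _ Quot.mk_surjective
  let F : B.Component → C.Component :=
    Quot.lift (fun d => (eV (B.vertex d)).component) (by
      rintro d _ (rfl | rfl)
      · exact congrArg (fun v => (eV v).component) (Quotient.sound ⟨1, by rw [zpow_one]⟩)
      · rcases exists_opp hopp d with h | ⟨e, e', rfl, he'⟩
        · rw [h]
        · rw [← he', ← hV, ← hV, ← (hO e e').1 he'.symm]
          exact Quot.sound (Or.inr rfl))
  refine Nat.card_le_card_of_surjective F ?_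
  rintro ⟨d⟩
  obtain ⟨v, hv⟩ := eV.surjective (C.vertex d)
  obtain ⟨d', rfl⟩ := Quotient.exists_rep v
  exact ⟨Quot.mk _ d', (congrArg Vertex.component hv : _)⟩

theorem eqvGen_face (B : PreBlink) {d d' : B.Dart} (h : B.vertex d = B.vertex d') :
    Relation.EqvGen (fun f g => ∃ d, B.face d = f ∧ (B.face (B.rot d) = g ∨ B.face (B.opp d) = g))
      (B.face d) (B.face d') := by
  obtain ⟨n, rfl⟩ : B.rot.SameCycle d d' := Quotient.exact h
  clear h
  induction n with
  | zero => exact .refl _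
  | succ n ih =>
    rw [add_comm, zpow_add, zpow_one]
    exact ih.trans _ _ _ (.rel _ _ ⟨_, rfl, Or.inl rfl⟩)
  | pred n ih =>
    rw [sub_eq_neg_add, zpow_add, zpow_neg_one]
    exact ih.trans _ _ _ (.symm _ _ (.rel _ _ ⟨_, rfl, Or.inl (congrArg _
      (B.rot.apply_symm_apply _))⟩))

theorem Isotopic.isPlane (h : B.Isotopic C) (hB : B.IsPlane) (hdart : Finite C.Dart)
    (hopp : ∀ d, C.opp (C.opp d) = d) (hblack : ∀ d, C.black (C.opp d) = C.black d)
    (hwalk : ∀ d, C.face (C.rot⁻¹ (C.opp d)) = C.face d) : C.IsPlane := by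
  have h1 := h.card_component_le hB.finite_dart hB.opp_opp
  have h2 := h.symm.card_component_le hdart hopp
  obtain ⟨eV, eD, eF, -, hO, -, -, hF, hI, -⟩ := h
  have := hB.finite_face
  refine ⟨hdart, Finite.of_equiv _ eF, hopp, hblack, hwalk, ?_, ?_⟩
  · have key : ∀ f g, Relation.EqvGen
        (fun f g => ∃ d, B.face d = f ∧ (B.face (B.rot d) = g ∨ B.face (B.opp d) = g)) f g →
        Relation.EqvGen
        (fun f g => ∃ d, C.face d = f ∧ (C.face (C.rot d) = g ∨ C.face (C.opp d) = g))
        (eF f) (eF g) := by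
      intro f g h
      induction h with
      | refl f => exact .refl _
      | symm _ _ _ ih => exact .symm _ _ ih
      | trans _ _ _ _ _ ih1 ih2 => exact .trans _ _ _ ih1 ih2
      | rel f g h =>
        obtain ⟨d, rfl, rfl | rfl⟩ := h
        · obtain ⟨a, ha, ha'⟩ := (hI (B.vertex d) _).1 ⟨d, rfl, rfl⟩
          obtain ⟨b, hb, hb'⟩ := (hI (B.vertex d) _).1 ⟨B.rot d,
            Quotient.sound (Perm.SameCycle.symm ⟨1, by rw [zpow_one]⟩), rfl⟩
          rw [← ha', ← hb']
          exact C.eqvGen_face (ha.trans hb.symm)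
        · rcases exists_opp hB.opp_opp d with h | ⟨e, e', rfl, he'⟩
          · rw [h]; exact .refl _
          · rw [← he', ← hF, ← hF, ← (hO e e').1 he'.symm]
            exact .rel _ _ ⟨_, rfl, Or.inr rfl⟩
    intro f g
    have := key _ _ (hB.connected (eF.symm f) (eF.symm g))
    rwa [eF.apply_symm_apply, eF.apply_symm_apply] at this
  · rw [← Nat.card_congr eV, ← Nat.card_congr eD, ← Nat.card_congr eF, h1.antisymm h2]
    exact hB.euler

end PreBlink

theorem Patch.IsLocal.isPlane_of_isotopic {k : ℕ} {X : Exterior k} {T : Patch k} (hT : T.IsLocal)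
    {B : Blink} (h : B.Isotopic (fill X T)) : (fill X T).IsPlane := by
  have := X.finite_dart
  have := hT.finite_dart
  refine h.isPlane B.plane (inferInstanceAs (Finite (_ ⊕ _))) ?_ ?_ (hT.fill_face_walk X)
  · rintro (x | x)
    · exact congrArg Sum.inl (X.opp_opp x)
    · exact congrArg Sum.inr (hT.opp_opp x)
  · rintro (x | x)
    · exact X.black_opp x
    · exact hT.black_opp x

/-! ## Derivations -/

/-- The reduced moves, by the name of their source. -/
def CoinName.IsReduced (n : CoinName) : Prop := n.starred = false ∨ n.family = Family.m20

instance (n : CoinName) : Decidable n.IsReduced := by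
  unfold CoinName.IsReduced
  infer_instance

/-- The coin that the mate names. -/
def CoinName.mateCoin (n : CoinName) : Coin n.family.arity := n.mate.coin

/-- A place where a move can be made in a coin: the name of the coin that is replaced, its context,
and their positions before and after the move. -/
structure Place (k : ℕ) where
  name : CoinName
  ctx : Context k name.family.arity
  before : Position
  after : Position

variable {k : ℕ}

/-- A criterion for `c'` to result from `c` by a reduced move. -/
def Place.Check (s : Place k) (c c' : Coin k) : Prop :=
  s.name.IsReduced ∧ s.ctx.SeparatedCheck ∧ s.before.Check c s.ctx s.name.coin.memo ∧
    s.after.Check c' s.ctx s.name.mateCoin.memo ∧ c'.DiskCheck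

instance (s : Place k) (c c' : Coin k) : Decidable (s.Check c c') := by
  unfold Place.Check
  infer_instance

/-- A criterion for a list to be a sequence of reduced moves that starts at `c`. -/
def DerivationCheck : Coin k → List (Place k × Coin k) → Prop
  | _, [] => True
  | c, (s, c') :: l => s.Check c c' ∧ DerivationCheck c' l

instance : (c : Coin k) → (l : List (Place k × Coin k)) → Decidable (DerivationCheck c l)
  | _, [] => instDecidableTrue
  | _, (_, c') :: l => @instDecidableAnd _ _ _ (instDecidableDerivationCheck c' l)

variable {c c' : Coin k}

theorem Place.Check.obtainable {s : Place k} (h : s.Check c c') (X : Exterior k)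
    (hB : (fill X c.toPatch).IsPlane) (hB' : (fill X c'.toPatch).IsPlane) :
    Obtainable reducedMoves ⟨_, hB⟩ ⟨_, hB'⟩ := by
  obtain ⟨hs, hY, h1, h2, -⟩ := h
  rw [Coin.memo_eq] at h1 h2
  obtain ⟨F⟩ := h1.fits
  obtain ⟨F'⟩ := h2.fits
  exact .single (Or.inr ⟨⟨s.name⟩, Finset.mem_filter.2 ⟨Finset.mem_univ _, hs⟩,
    X.extend s.ctx hY.separated, F.isotopic X _, F'.isotopic X _⟩)

theorem DerivationCheck.obtainable {l : List (Place k × Coin k)} (h : DerivationCheck c l)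
    (hc : c.DiskCheck) (hl : (l.getLast?.map Prod.snd).getD c = c') (X : Exterior k)
    (hB : (fill X c.toPatch).IsPlane) : ∃ hB' : (fill X c'.toPatch).IsPlane,
    Obtainable reducedMoves ⟨_, hB⟩ ⟨_, hB'⟩ := by
  induction l generalizing c with
  | nil =>
    subst hl
    exact ⟨hB, .refl⟩
  | cons s l ih =>
    obtain ⟨s, c₁⟩ := s
    have h1 := IsDisk.isPlane_fill X hc.isDisk h.1.2.2.2.2.isDisk hB
    obtain ⟨h2, h3⟩ := ih h.2 h.1.2.2.2.2 (by
      rw [← hl]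
      cases l with
      | nil => rfl
      | cons s l => rw [List.getLast?_cons_cons]; cases h : (s :: l).getLast? <;> simp_all) h1
    exact ⟨h2, (h.1.obtainable X hB h1).trans h3⟩

/-- A criterion for a list to be a sequence of reduced moves that starts at the left starred coin
of a family. -/
def Family.DerivationCheck (f : Family) (l : List (Place f.arity × Coin f.arity)) : Prop :=
  (CoinName.coin ⟨f, false, false, true⟩).DiskCheck ∧
    BlinkCalculus.DerivationCheck (CoinName.coin ⟨f, false, false, true⟩) l

instance (f : Family) (l : List (Place f.arity × Coin f.arity)) :
    Decidable (f.DerivationCheck l) := by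
  unfold Family.DerivationCheck
  infer_instance

end BlinkCalculus

namespace BlinkCalculus

/-! ## The derivations -/

/-- A derivation of the starred move of the family `m33`. -/
def derivation33 :
    List (Place (Family.arity .m33) × Coin (Family.arity .m33)) := [
  (⟨⟨.m33, true, false, false⟩, .ofTable 0 [] [5, 3, 4, 1, 2, 0] (Sum.inl (p (k := 3) 0)),
    ⟨[0, 2, 4], [3, 5, 1], [5, 1, 3]⟩, ⟨[1, 3, 5], [1, 0, 2], [0, 2, 1]⟩⟩,
    CoinName.coin ⟨.m33, true, false, true⟩)]

theorem derivationCheck33 : Family.DerivationCheck .m33 derivation33 := by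
  decide +kernel

/-- A derivation of an isolated edge from a loop. -/
def derivation10 :
    List (Place (Family.arity .m10) × Coin (Family.arity .m10)) := [
  (⟨⟨.m11, true, false, false⟩, .ofTable 0 [] [0] (Sum.inr (0 : Fin 1)),
    ⟨[1], [0], [0]⟩, ⟨[0], [0], [0]⟩⟩,
    CoinName.coin ⟨.m10, false, false, false⟩)]

theorem derivationCheck10 : Family.DerivationCheck .m10 derivation10 := by
  decide +kernel

/-- A derivation of the starred move of the family `m11`. -/
def derivation11 :
    List (Place (Family.arity .m11) × Coin (Family.arity .m11)) := [
  (⟨⟨.m11, true, false, false⟩, .ofTable 0 [] [1, 0] (Sum.inl (p (k := 1) 0)),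
    ⟨[0], [1], [1]⟩, ⟨[1], [0], [0]⟩⟩,
    CoinName.coin ⟨.m11, true, false, true⟩)]

theorem derivationCheck11 : Family.DerivationCheck .m11 derivation11 := by
  decide +kernel

/-- A derivation of the starred move of the family `m31`. -/
def derivation31 :
    List (Place (Family.arity .m31) × Coin (Family.arity .m31)) := [
  (⟨⟨.m20, true, false, false⟩, .ofTable 3 [] [3, 7, 4, 0, 8, 1, 2, 5, 6] (Sum.inl (p (k := 1) 0)),
    ⟨[0, 2, 4], [4, 1], [1, 4]⟩, ⟨[6, 0, 2, 8, 5], [2, 1], [1, 2]⟩⟩,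
    .ofTable 5 [4] [2, 6, 4, 7, 10, 9, 1, 8, 3, 5, 0] 10),
  (⟨⟨.m33, false, true, false⟩, .ofTable 2 [] [5, 6, 4, 7, 0, 2, 1, 3] (Sum.inl (p (k := 1) 0)),
    ⟨[0, 4, 2, 6, 9], [2, 0, 1], [0, 1, 2]⟩, ⟨[0, 6, 8, 5, 2], [4, 0, 1], [0, 1, 4]⟩⟩,
    .ofTable 5 [2, 4] [2, 8, 4, 1, 6, 9, 10, 5, 3, 7, 0] 10),
  (⟨⟨.m20, false, false, true⟩, .ofTable 3 [2] [2, 4, 7, 1, 3, 8, 0, 6, 5] (Sum.inl (p (k := 1) 0)),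
    ⟨[0, 2, 8, 7, 5], [1, 2], [2, 1]⟩, ⟨[0, 2, 4], [1, 1], [1, 1]⟩⟩,
    .ofTable 3 [2] [2, 4, 6, 1, 3, 5, 0] 6),
  (⟨⟨.m20, true, false, false⟩, .ofTable 3 [2] [8, 4, 6, 1, 3, 5, 7, 2, 0] (Sum.inl (p (k := 1) 0)),
    ⟨[0, 2, 4], [0, 1], [1, 0]⟩, ⟨[7, 2, 8, 0, 4], [0, 1], [1, 0]⟩⟩,
    .ofTable 5 [0, 4] [2, 4, 10, 6, 1, 7, 8, 5, 3, 9, 0] 10),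
  (⟨⟨.m33, false, true, false⟩, .ofTable 2 [0] [5, 2, 1, 6, 0, 4, 3, 7] (Sum.inl (p (k := 1) 0)),
    ⟨[0, 4, 2, 7, 9], [1, 0, 1], [0, 1, 1]⟩, ⟨[0, 6, 8, 5, 2], [1, 0, 1], [0, 1, 1]⟩⟩,
    .ofTable 5 [0, 2, 4] [2, 6, 4, 7, 10, 9, 1, 8, 3, 5, 0] 10),
  (⟨⟨.m33, false, true, false⟩, .ofTable 2 [0, 1] [5, 6, 4, 7, 0, 2, 1, 3] (Sum.inl (p (k := 1) 0)),
    ⟨[0, 4, 2, 6, 9], [2, 0, 1], [0, 1, 2]⟩, ⟨[0, 6, 8, 5, 2], [4, 0, 1], [0, 1, 4]⟩⟩,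
    .ofTable 5 [0, 2, 3, 4] [2, 8, 4, 1, 6, 9, 10, 5, 3, 7, 0] 10),
  (⟨⟨.m20, false, false, true⟩, .ofTable 3 [0, 1, 2] [2, 5, 6, 1, 8, 3, 7, 0, 4]
      (Sum.inl (p (k := 1) 0)),
    ⟨[4, 6, 8, 3, 1], [2, 1], [1, 2]⟩, ⟨[0, 2, 5], [1, 1], [1, 1]⟩⟩,
    .ofTable 3 [0, 1, 2] [2, 4, 6, 1, 3, 5, 0] 6),
  (⟨⟨.m31, false, false, false⟩, .ofTable 0 [] [1, 0] (Sum.inl (p (k := 1) 0)),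
    ⟨[0, 2, 4], [1], [1]⟩, ⟨[0], [0], [0]⟩⟩,
    .ofTable 1 [] [2, 1, 0] 2),
  (⟨⟨.m11, false, true, false⟩, .ofTable 0 [] [1, 0] (Sum.inl (p (k := 1) 0)),
    ⟨[0], [0], [0]⟩, ⟨[0], [1], [1]⟩⟩,
    CoinName.coin ⟨.m31, true, false, true⟩)]

theorem derivationCheck31 : Family.DerivationCheck .m31 derivation31 := by
  decide +kernel

/-- A derivation of the starred move of the family `m54`. -/
def derivation54 :
    List (Place (Family.arity .m54) × Coin (Family.arity .m54)) := [
  (⟨⟨.m20, true, false, false⟩, .ofTable 5 [2, 3] [13, 10, 7, 8, 6, 12, 11, 5, 9, 1, 3, 4, 2, 0]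
      (Sum.inl (p (k := 2) 0)),
    ⟨[0, 2, 4, 6, 8], [0, 1], [1, 0]⟩, ⟨[5, 1, 9, 7, 2, 10, 13], [0, 4], [4, 0]⟩⟩,
    .ofTable 7 [3, 4, 5] [2, 6, 3, 4, 14, 12, 8, 15, 10, 7, 1, 13, 5, 11, 0, 9] 14),
  (⟨⟨.m20, true, false, false⟩, .ofTable 7 [3, 4, 5] [2, 6, 16, 4, 14, 12, 8, 15, 10, 7, 1, 13, 5,
      11, 17, 9, 0, 3] (Sum.inl (p (k := 2) 0)),
    ⟨[0, 2, 4, 6, 8, 10, 12], [1, 2], [2, 1]⟩, ⟨[8, 3, 4, 12, 14, 16, 10, 7, 1], [1, 0], [0, 1]⟩⟩,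
    .ofTable 9 [3, 6, 7, 8] [2, 6, 4, 7, 18, 10, 1, 8, 3, 12, 5, 17, 14, 19, 16, 13, 9, 11, 0, 15]
      18),
  (⟨⟨.m33, false, true, false⟩, .ofTable 6 [3, 4, 5] [15, 16, 12, 4, 3, 11, 8, 13, 10, 7, 14, 5,
      0, 9, 6, 2, 1] (Sum.inl (p (k := 2) 0)),
    ⟨[0, 4, 10, 12, 14, 16, 9, 2, 6], [1, 2, 0], [2, 0, 1]⟩, ⟨[0, 6, 16, 10, 12, 14, 2, 8, 5], [1,
      4, 0], [4, 0, 1]⟩⟩,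
    .ofTable 9 [1, 4, 5, 6, 7] [2, 8, 4, 1, 6, 9, 18, 16, 3, 10, 12, 19, 14, 11, 5, 17, 7, 15, 0,
      13] 18),
  (⟨⟨.m20, false, false, true⟩, .ofTable 7 [2, 3, 4, 5] [2, 5, 14, 12, 16, 6, 8, 15, 10, 7, 1, 13,
      3, 11, 17, 9, 4, 0] (Sum.inl (p (k := 2) 0)),
    ⟨[4, 6, 8, 10, 12, 14, 16, 0, 2], [1, 2], [2, 1]⟩, ⟨[0, 2, 5, 6, 8, 10, 12], [1, 1], [1, 1]⟩⟩,
    .ofTable 7 [2, 3, 4, 5] [2, 4, 14, 12, 6, 5, 8, 15, 10, 7, 1, 13, 3, 11, 0, 9] 14),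
  (⟨⟨.m20, true, false, false⟩, .ofTable 7 [2, 3, 4, 5] [2, 4, 14, 12, 6, 5, 8, 15, 10, 7, 1, 17,
      3, 11, 0, 9, 16, 13] (Sum.inl (p (k := 2) 0)),
    ⟨[0, 2, 4, 6, 8, 10, 12], [2, 2], [2, 2]⟩, ⟨[0, 2, 4, 6, 8, 10, 12, 17, 15], [2, 2], [2, 2]⟩⟩,
    .ofTable 9 [2, 3, 4, 5, 8] [2, 4, 18, 12, 6, 5, 8, 19, 10, 7, 1, 14, 3, 11, 13, 16, 15, 17, 0,
      9] 18),
  (⟨⟨.m33, false, true, false⟩, .ofTable 6 [2, 3, 4, 5] [2, 4, 12, 15, 6, 5, 8, 13, 16, 7, 14, 11,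
      0, 9, 10, 3, 1] (Sum.inl (p (k := 2) 0)),
    ⟨[0, 2, 4, 6, 8, 16, 15, 12, 10], [2, 2, 0], [2, 0, 2]⟩, ⟨[0, 2, 4, 6, 8, 16, 13, 10, 15], [2,
      2, 0], [2, 0, 2]⟩⟩,
    .ofTable 9 [2, 3, 4, 5, 6, 8] [2, 4, 18, 13, 6, 5, 8, 19, 10, 7, 12, 16, 1, 14, 3, 11, 15, 17,
      0, 9] 18),
  (⟨⟨.m33, false, true, false⟩, .ofTable 6 [1, 2, 3, 4, 5] [15, 2, 4, 3, 6, 13, 8, 5, 16, 10, 14,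
      11, 0, 7, 9, 12, 1] (Sum.inl (p (k := 2) 0)),
    ⟨[0, 4, 6, 8, 10, 16, 15, 2, 12], [10, 2, 0], [2, 0, 10]⟩, ⟨[0, 6, 8, 10, 12, 16, 2, 14, 5],
      [12, 4, 0], [4, 0, 12]⟩⟩,
    .ofTable 9 [1, 3, 4, 5, 6, 7, 8] [2, 6, 4, 1, 18, 15, 8, 7, 10, 19, 12, 9, 14, 16, 3, 13, 5,
      17, 0, 11] 18),
  (⟨⟨.m20, false, false, true⟩, .ofTable 7 [1, 2, 3, 4, 5, 6] [14, 11, 4, 3, 6, 15, 8, 5, 10, 12,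
      16, 9, 1, 13, 17, 7, 2, 0] (Sum.inl (p (k := 2) 0)),
    ⟨[4, 6, 8, 10, 12, 14, 16, 0, 2], [1, 2], [2, 1]⟩, ⟨[0, 8, 10, 12, 5, 3, 6], [1, 1], [1, 1]⟩⟩,
    .ofTable 7 [1, 2, 3, 4, 5, 6] [14, 2, 4, 8, 6, 3, 1, 7, 10, 9, 12, 15, 5, 11, 0, 13] 14),
  (⟨⟨.m20, true, false, false⟩, .ofTable 7 [1, 2, 3, 4, 5, 6] [14, 2, 4, 8, 6, 17, 1, 7, 10, 9,
      16, 15, 5, 11, 0, 13, 3, 12] (Sum.inl (p (k := 2) 0)),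
    ⟨[0, 2, 4, 6, 8, 10, 12], [2, 10], [10, 2]⟩, ⟨[0, 2, 4, 6, 8, 10, 16, 12, 15], [2, 10], [10,
      2]⟩⟩,
    .ofTable 9 [1, 2, 3, 4, 5, 6, 8] [18, 2, 4, 8, 6, 14, 1, 7, 10, 9, 12, 19, 3, 15, 16, 13, 5,
      11, 0, 17] 18),
  (⟨⟨.m33, false, false, false⟩, .ofTable 6 [1, 2, 3, 4, 5] [12, 2, 15, 6, 1, 5, 8, 7, 10, 13, 3,
      16, 0, 14, 9, 4, 11] (Sum.inl (p (k := 2) 0)),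
    ⟨[0, 2, 6, 8, 10, 12, 17, 4, 15], [10, 0, 2], [0, 2, 10]⟩, ⟨[0, 2, 8, 10, 12, 14, 4, 16, 7],
      [12, 0, 2], [0, 2, 12]⟩⟩,
    .ofTable 9 [1, 3, 4, 5, 6, 7] [18, 2, 4, 10, 6, 15, 8, 17, 1, 9, 12, 11, 14, 19, 3, 16, 5, 13,
      0, 7] 18),
  (⟨⟨.m33, true, true, false⟩, .ofTable 6 [1, 3, 4, 5] [12, 2, 4, 10, 6, 15, 8, 14, 1, 9, 16, 11,
      0, 7, 13, 5, 3] (Sum.inl (p (k := 2) 0)),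
    ⟨[0, 2, 4, 6, 8, 10, 15, 12, 17], [1, 4, 2], [4, 2, 1]⟩, ⟨[0, 2, 4, 6, 8, 10, 16, 14, 12], [1,
      4, 2], [4, 2, 1]⟩⟩,
    .ofTable 9 [1, 3, 4, 5, 6] [18, 2, 4, 10, 6, 14, 8, 16, 1, 9, 12, 11, 3, 17, 5, 13, 19, 15, 0,
      7] 18),
  (⟨⟨.m54, false, false, false⟩, .ofTable 4 [1, 2] [8, 10, 4, 6, 1, 5, 9, 11, 0, 3, 2, 7]
      (Sum.inl (p (k := 2) 0)),
    ⟨[0, 6, 8, 16, 2, 12, 4, 14, 10], [4, 1], [1, 4]⟩, ⟨[0, 8, 10, 14, 4, 12, 2, 6], [4, 1], [1,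
      4]⟩⟩,
    .ofTable 8 [2, 4, 5, 6] [16, 2, 4, 3, 6, 12, 8, 7, 10, 14, 1, 11, 5, 15, 17, 13, 0, 9] 16),
  (⟨⟨.m11, false, true, false⟩, .ofTable 7 [2, 3, 4, 5] [14, 2, 4, 3, 16, 10, 8, 12, 1, 9, 5, 13,
      15, 11, 0, 7, 6] (Sum.inl (p (k := 2) 0)),
    ⟨[0, 2, 4, 8, 10, 12, 14, 6], [4], [4]⟩, ⟨[0, 2, 4, 8, 10, 12, 14, 6], [4], [4]⟩⟩,
    .ofTable 8 [2, 3, 4, 5, 6] [16, 2, 4, 3, 6, 12, 7, 8, 10, 14, 1, 11, 5, 15, 17, 13, 0, 9] 16),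
  (⟨⟨.m20, false, false, false⟩, .ofTable 6 [2, 3, 4, 5] [12, 2, 4, 3, 6, 14, 7, 8, 10, 15, 1, 11,
      0, 9, 5, 13] (Sum.inl (p (k := 2) 0)),
    ⟨[0, 2, 4, 6, 8, 10, 12, 15], [4, 1], [1, 4]⟩, ⟨[0, 2, 4, 6, 8, 10], [4, 1], [1, 4]⟩⟩,
    .ofTable 6 [2, 3, 4, 5] [12, 2, 4, 3, 6, 13, 7, 8, 10, 5, 1, 11, 0, 9] 12),
  (⟨⟨.m20, true, false, false⟩, .ofTable 6 [2, 3, 4, 5] [12, 2, 4, 3, 6, 13, 14, 8, 10, 5, 15, 11,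
      0, 9, 1, 7] (Sum.inl (p (k := 2) 0)),
    ⟨[0, 2, 4, 6, 8, 10], [0, 6], [6, 0]⟩, ⟨[0, 2, 4, 6, 11, 12, 8, 15], [0, 6], [6, 0]⟩⟩,
    .ofTable 8 [2, 3, 4, 5, 6] [16, 2, 4, 3, 6, 17, 8, 11, 1, 15, 5, 12, 14, 13, 7, 9, 0, 10] 16),
  (⟨⟨.m33, true, true, false⟩, .ofTable 5 [2, 3, 4] [10, 2, 4, 3, 14, 11, 5, 8, 12, 9, 0, 6, 7,
      13, 1] (Sum.inl (p (k := 2) 0)),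
    ⟨[0, 2, 4, 10, 12, 9, 6, 14], [4, 0, 0], [0, 0, 4]⟩, ⟨[0, 2, 4, 8, 14, 11, 13, 6], [4, 0, 0],
      [0, 0, 4]⟩⟩,
    .ofTable 8 [2, 3, 4, 7] [16, 2, 4, 3, 6, 17, 1, 10, 5, 14, 12, 9, 7, 13, 11, 15, 0, 8] 16),
  (⟨⟨.m33, false, false, false⟩, .ofTable 5 [2, 3] [10, 2, 4, 3, 6, 11, 1, 14, 7, 9, 0, 12, 5, 13,
      8] (Sum.inl (p (k := 2) 0)),
    ⟨[0, 2, 4, 6, 12, 8, 15, 10], [4, 0, 0], [0, 0, 4]⟩, ⟨[0, 2, 4, 6, 14, 13, 11, 8], [4, 0, 0],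
      [0, 0, 4]⟩⟩,
    .ofTable 8 [2, 3, 4] [16, 2, 4, 3, 6, 17, 1, 11, 10, 13, 5, 12, 14, 9, 7, 15, 0, 8] 16),
  (⟨⟨.m33, true, true, false⟩, .ofTable 5 [2] [10, 2, 14, 3, 12, 7, 8, 5, 13, 9, 0, 4, 11, 6, 1]
      (Sum.inl (p (k := 2) 0)),
    ⟨[0, 2, 8, 12, 14, 7, 4, 10], [1, 8, 0], [8, 0, 1]⟩, ⟨[0, 2, 10, 12, 14, 7, 9, 4], [1, 6, 0],
      [6, 0, 1]⟩⟩,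
    .ofTable 8 [2, 5] [16, 2, 4, 3, 1, 6, 8, 17, 5, 12, 7, 13, 14, 11, 9, 15, 0, 10] 16),
  (⟨⟨.m33, false, true, false⟩, .ofTable 5 [2] [2, 11, 14, 6, 1, 7, 8, 5, 3, 9, 12, 4, 10, 13, 0]
      (Sum.inl (p (k := 2) 0)),
    ⟨[6, 8, 10, 12, 14, 0, 3, 5], [0, 1, 1], [1, 1, 0]⟩, ⟨[6, 8, 10, 12, 14, 4, 3, 0], [2, 1, 1],
      [1, 1, 2]⟩⟩,
    .ofTable 8 [1, 2, 5] [2, 4, 16, 5, 1, 6, 8, 17, 3, 12, 7, 13, 14, 11, 9, 15, 0, 10] 16),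
  (⟨⟨.m20, false, false, false⟩, .ofTable 6 [0, 3] [12, 14, 4, 13, 1, 8, 3, 9, 10, 7, 5, 11, 15,
      6, 2, 0] (Sum.inl (p (k := 2) 0)),
    ⟨[2, 6, 8, 10, 12, 14, 5, 1], [1, 0], [0, 1]⟩, ⟨[5, 0, 2, 6, 8, 10], [1, 4], [4, 1]⟩⟩,
    .ofTable 6 [2, 3] [2, 13, 4, 8, 5, 12, 1, 9, 10, 7, 3, 11, 0, 6] 12),
  (⟨⟨.m20, false, false, false⟩, .ofTable 4 [2] [2, 9, 4, 11, 5, 8, 3, 7, 0, 10, 1, 6]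
      (Sum.inl (p (k := 2) 0)),
    ⟨[0, 2, 4, 10, 6, 9], [0, 2], [2, 0]⟩, ⟨[0, 2, 4, 6], [0, 2], [2, 0]⟩⟩,
    .ofTable 4 [2] [2, 9, 4, 1, 5, 8, 3, 7, 0, 6] 8),
  (⟨⟨.m11, false, true, false⟩, .ofTable 3 [2] [2, 7, 4, 1, 5, 6, 0, 8, 3] (Sum.inl (p (k := 2) 0)),
    ⟨[0, 2, 4, 6], [2], [2]⟩, ⟨[3, 1, 4, 6], [1], [1]⟩⟩,
    CoinName.coin ⟨.m54, true, false, true⟩)]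

theorem derivationCheck54 : Family.DerivationCheck .m54 derivation54 := by
  decide +kernel

/-- A derivation of the starred move of the family `m66`. -/
def derivation66 :
    List (Place (Family.arity .m66) × Coin (Family.arity .m66)) := [
  (⟨⟨.m20, true, false, false⟩, .ofTable 6 [1, 4, 5] [3, 15, 8, 12, 6, 1, 11, 16, 10, 4, 14, 9, 0,
      7, 2, 5, 13] (Sum.inl (p (k := 3) 0)),
    ⟨[0, 2, 4, 6, 8, 10], [4, 1], [1, 4]⟩, ⟨[0, 3, 7, 14, 8, 10, 4, 12], [4, 1], [1, 4]⟩⟩,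
    .ofTable 8 [1, 2, 4, 5] [2, 4, 16, 8, 6, 12, 1, 14, 10, 7, 18, 9, 5, 17, 11, 13, 0, 15, 3] 16),
  (⟨⟨.m33, false, true, false⟩, .ofTable 5 [0, 1, 2] [10, 2, 4, 13, 12, 3, 15, 11, 5, 7, 14, 9, 1,
      8, 0, 6] (Sum.inl (p (k := 3) 0)),
    ⟨[2, 8, 10, 12, 14, 7, 0, 5], [4, 0, 1], [0, 1, 4]⟩, ⟨[4, 15, 13, 6, 10, 0, 8, 3], [6, 2, 1],
      [2, 1, 6]⟩⟩,
    .ofTable 8 [0, 2, 4, 6, 7] [2, 6, 4, 9, 16, 15, 8, 17, 1, 10, 12, 7, 14, 18, 3, 13, 0, 11, 5]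
      16),
  (⟨⟨.m33, true, false, false⟩, .ofTable 5 [0, 2, 3, 4] [2, 14, 4, 13, 10, 9, 8, 12, 3, 7, 0, 15,
      5, 6, 1, 11] (Sum.inl (p (k := 3) 0)),
    ⟨[0, 2, 4, 12, 14, 6, 11, 9], [10, 0, 1], [0, 1, 10]⟩, ⟨[0, 2, 4, 10, 12, 8, 6, 15], [8, 0,
      1], [0, 1, 8]⟩⟩,
    .ofTable 8 [0, 2, 3, 4, 5, 6] [2, 6, 4, 8, 16, 13, 1, 14, 10, 7, 12, 18, 3, 11, 9, 17, 0, 15,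
      5] 16),
  (⟨⟨.m33, true, true, false⟩, .ofTable 5 [0, 1, 2, 3] [13, 2, 1, 8, 6, 3, 14, 12, 5, 11, 0, 9,
      15, 10, 4, 7] (Sum.inl (p (k := 3) 0)),
    ⟨[0, 6, 8, 10, 14, 12, 5, 2], [4, 0, 10], [0, 10, 4]⟩, ⟨[0, 4, 13, 14, 10, 2, 7, 9], [2, 0,
      6], [0, 6, 2]⟩⟩,
    .ofTable 8 [0, 2, 4, 6, 7] [2, 4, 16, 6, 1, 10, 8, 13, 3, 15, 12, 17, 5, 14, 7, 18, 0, 11, 9]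
      16),
  (⟨⟨.m33, false, false, false⟩, .ofTable 5 [0, 2, 3] [2, 4, 10, 15, 1, 8, 3, 14, 13, 11, 0, 9, 7,
      5, 12, 6] (Sum.inl (p (k := 3) 0)),
    ⟨[0, 2, 4, 8, 10, 12, 15, 6], [0, 10, 6], [10, 6, 0]⟩, ⟨[0, 2, 4, 10, 12, 9, 6, 14], [0, 12,
      8], [12, 8, 0]⟩⟩,
    .ofTable 8 [0, 2, 5, 7] [2, 4, 16, 6, 1, 12, 8, 5, 10, 15, 3, 9, 14, 17, 7, 18, 0, 13, 11] 16),
  (⟨⟨.m20, false, false, true⟩, .ofTable 6 [0, 2, 5] [2, 4, 12, 6, 1, 8, 16, 5, 10, 13, 7, 14, 0,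
      9, 15, 11, 3] (Sum.inl (p (k := 3) 0)),
    ⟨[0, 2, 4, 6, 12, 14, 8, 10], [6, 2], [2, 6]⟩, ⟨[0, 2, 4, 6, 8, 10], [2, 2], [2, 2]⟩⟩,
    .ofTable 6 [0, 2, 5] [2, 4, 12, 6, 1, 8, 3, 5, 10, 13, 7, 14, 0, 9, 11] 12),
  (⟨⟨.m66, true, true, false⟩, .ofTable 0 [] [5, 3, 4, 1, 2, 0] (Sum.inl (p (k := 3) 0)),
    ⟨[11, 9, 7, 3, 5, 1], [1, 8, 2], [8, 2, 1]⟩, ⟨[11, 9, 7, 3, 5, 1], [1, 8, 2], [8, 2, 1]⟩⟩,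
    .ofTable 6 [0, 2, 4] [2, 4, 12, 6, 1, 8, 3, 5, 10, 13, 7, 14, 0, 9, 11] 12),
  (⟨⟨.m20, true, false, true⟩, .ofTable 6 [0, 2, 4] [2, 4, 12, 6, 1, 8, 15, 5, 10, 13, 7, 14, 0,
      9, 16, 3, 11] (Sum.inl (p (k := 3) 0)),
    ⟨[0, 2, 4, 6, 8, 10], [2, 2], [2, 2]⟩, ⟨[0, 2, 4, 6, 12, 14, 11, 9], [2, 6], [6, 2]⟩⟩,
    .ofTable 8 [0, 2, 4, 6] [2, 4, 16, 6, 1, 12, 8, 5, 10, 15, 3, 9, 14, 17, 7, 18, 0, 13, 11] 16),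
  (⟨⟨.m33, true, false, false⟩, .ofTable 5 [0, 2, 4] [2, 4, 10, 14, 1, 8, 3, 13, 15, 11, 0, 9, 7,
      12, 6, 5] (Sum.inl (p (k := 3) 0)),
    ⟨[0, 2, 4, 10, 12, 6, 14, 9], [12, 8, 0], [8, 0, 12]⟩, ⟨[0, 2, 4, 8, 10, 15, 6, 12], [10, 6,
      0], [6, 0, 10]⟩⟩,
    .ofTable 8 [0, 2, 3, 5, 7] [2, 4, 16, 6, 1, 10, 8, 13, 3, 15, 12, 17, 5, 14, 7, 18, 0, 11, 9]
      16),
  (⟨⟨.m33, false, true, false⟩, .ofTable 5 [0, 1, 2, 4] [14, 2, 1, 4, 6, 11, 3, 8, 15, 12, 0, 5,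
      13, 9, 10, 7] (Sum.inl (p (k := 3) 0)),
    ⟨[0, 4, 10, 12, 14, 9, 2, 7], [6, 2, 0], [2, 0, 6]⟩, ⟨[0, 6, 14, 9, 10, 2, 12, 5], [10, 4, 0],
      [4, 0, 10]⟩⟩,
    .ofTable 8 [0, 1, 3, 5, 6, 7] [2, 6, 4, 8, 16, 13, 1, 14, 10, 7, 12, 18, 3, 11, 9, 17, 0, 15,
      5] 16),
  (⟨⟨.m33, false, false, false⟩, .ofTable 5 [0, 1, 3, 4] [2, 13, 4, 15, 10, 9, 8, 12, 3, 7, 0, 14,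
      5, 1, 11, 6] (Sum.inl (p (k := 3) 0)),
    ⟨[0, 2, 4, 10, 12, 6, 15, 8], [0, 1, 8], [1, 8, 0]⟩, ⟨[0, 2, 4, 12, 14, 11, 9, 6], [0, 1, 10],
      [1, 10, 0]⟩⟩,
    .ofTable 8 [0, 1, 3, 6, 7] [2, 6, 4, 9, 16, 15, 8, 17, 1, 10, 12, 7, 14, 18, 3, 13, 0, 11, 5]
      16),
  (⟨⟨.m33, true, true, false⟩, .ofTable 5 [1, 3, 4] [10, 9, 13, 11, 6, 3, 8, 12, 14, 7, 15, 5, 1,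
      2, 4, 0] (Sum.inl (p (k := 3) 0)),
    ⟨[4, 6, 10, 12, 14, 3, 0, 8], [1, 6, 2], [6, 2, 1]⟩, ⟨[2, 12, 14, 11, 9, 5, 7, 0], [1, 4, 0],
      [4, 0, 1]⟩⟩,
    .ofTable 8 [0, 4, 5, 6] [2, 4, 16, 8, 6, 12, 1, 14, 10, 7, 18, 9, 5, 17, 11, 13, 0, 15, 3] 16),
  (⟨⟨.m20, false, false, false⟩, .ofTable 6 [0, 3, 4] [2, 16, 12, 6, 1, 10, 8, 5, 14, 7, 9, 15, 0,
      11, 3, 13, 4] (Sum.inl (p (k := 3) 0)),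
    ⟨[0, 2, 6, 8, 10, 14, 13, 5], [1, 4], [4, 1]⟩, ⟨[0, 3, 5, 8, 10, 6], [1, 4], [4, 1]⟩⟩,
    CoinName.coin ⟨.m66, true, false, true⟩)]

theorem derivationCheck66 : Family.DerivationCheck .m66 derivation66 := by
  decide +kernel

/-- A derivation of the starred move of the family `m99`. -/
def derivation99 :
    List (Place (Family.arity .m99) × Coin (Family.arity .m99)) := [
  (⟨⟨.m20, true, false, false⟩, .ofTable 9 [1, 4, 7] [3, 23, 8, 18, 21, 2, 12, 1, 10, 6, 5, 16,
      15, 7, 20, 9, 11, 14, 0, 22, 17, 4, 19, 13] (Sum.inl (p (k := 4) 0)),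
    ⟨[0, 2, 4, 6, 8, 10, 12, 14, 16], [1, 12], [12, 1]⟩, ⟨[0, 3, 15, 9, 10, 12, 7, 19, 20, 17, 5],
      [1, 4], [4, 1]⟩⟩,
    .ofTable 11 [1, 5, 8, 9] [2, 4, 22, 10, 6, 16, 8, 18, 1, 7, 12, 9, 14, 20, 3, 25, 5, 23, 11,
      24, 13, 19, 0, 17, 21, 15] 22),
  (⟨⟨.m20, true, false, false⟩, .ofTable 11 [1, 5, 8, 9] [2, 27, 22, 10, 6, 16, 26, 18, 1, 7, 12,
      9, 14, 20, 3, 25, 5, 23, 11, 24, 13, 19, 0, 17, 21, 15, 4, 8] (Sum.inl (p (k := 4) 0)),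
    ⟨[0, 2, 4, 6, 8, 10, 12, 14, 16, 18, 20], [1, 6], [6, 1]⟩, ⟨[0, 2, 22, 17, 6, 8, 10, 12, 24,
      18, 20, 15, 5], [1, 4], [4, 1]⟩⟩,
    .ofTable 13 [1, 4, 7, 9, 12] [2, 4, 26, 8, 6, 14, 1, 16, 10, 7, 12, 20, 3, 29, 5, 22, 18, 15,
      9, 28, 11, 19, 17, 24, 23, 27, 0, 25, 21, 13] 26),
  (⟨⟨.m33, false, true, false⟩, .ofTable 10 [1, 4, 7, 9] [2, 4, 20, 8, 6, 26, 1, 25, 10, 7, 12,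
      16, 3, 23, 9, 22, 11, 15, 24, 21, 0, 19, 17, 13, 18, 14, 5] (Sum.inl (p (k := 4) 0)),
    ⟨[0, 2, 4, 6, 8, 10, 12, 18, 20, 24, 23, 16, 14], [1, 16, 4], [16, 4, 1]⟩, ⟨[0, 2, 4, 6, 8,
      10, 12, 20, 22, 24, 17, 14, 19], [1, 18, 4], [18, 4, 1]⟩⟩,
    .ofTable 13 [1, 4, 7, 8, 10, 12] [2, 4, 26, 8, 6, 14, 1, 17, 10, 7, 12, 22, 3, 29, 16, 24, 5,
      18, 20, 15, 9, 28, 11, 21, 19, 27, 0, 25, 23, 13] 26),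
  (⟨⟨.m20, true, false, false⟩, .ofTable 13 [1, 4, 7, 8, 10, 12] [2, 4, 26, 8, 6, 14, 1, 17, 10,
      7, 12, 22, 3, 29, 16, 24, 5, 31, 20, 15, 30, 28, 11, 21, 19, 27, 0, 25, 23, 13, 18, 9]
      (Sum.inl (p (k := 4) 0)),
    ⟨[0, 2, 4, 6, 8, 10, 12, 14, 16, 18, 20, 22, 24], [14, 8], [8, 14]⟩, ⟨[0, 2, 4, 6, 8, 10, 12,
      14, 16, 25, 29, 20, 22, 27, 19], [14, 8], [8, 14]⟩⟩,
    .ofTable 15 [1, 4, 7, 8, 11, 13, 14] [2, 4, 30, 8, 6, 14, 1, 17, 10, 7, 12, 20, 3, 33, 16, 22,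
      5, 18, 9, 26, 11, 28, 24, 31, 15, 29, 19, 25, 32, 27, 0, 23, 21, 13] 30),
  (⟨⟨.m33, false, false, false⟩, .ofTable 12 [1, 4, 7, 8, 11] [2, 4, 24, 8, 6, 14, 1, 17, 10, 7,
      12, 20, 3, 27, 16, 22, 5, 18, 9, 29, 11, 28, 30, 25, 0, 23, 21, 13, 26, 19, 15]
      (Sum.inl (p (k := 4) 0)),
    ⟨[0, 2, 4, 6, 8, 10, 12, 14, 16, 18, 20, 22, 28, 26, 24], [22, 8, 14], [8, 14, 22]⟩, ⟨[0, 2,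
      4, 6, 8, 10, 12, 14, 16, 18, 20, 22, 27, 24, 29], [22, 8, 14], [8, 14, 22]⟩⟩,
    .ofTable 15 [1, 4, 7, 8, 11, 14] [2, 4, 30, 8, 6, 14, 1, 17, 10, 7, 12, 20, 3, 33, 16, 22, 5,
      18, 9, 27, 11, 29, 24, 31, 26, 32, 15, 28, 19, 25, 0, 23, 21, 13] 30),
  (⟨⟨.m20, true, false, false⟩, .ofTable 15 [1, 4, 7, 8, 11, 14] [2, 4, 30, 8, 6, 14, 1, 17, 10,
      7, 12, 20, 3, 33, 16, 22, 5, 18, 9, 27, 11, 29, 24, 31, 26, 32, 15, 28, 19, 35, 0, 23, 34,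
      13, 25, 21] (Sum.inl (p (k := 4) 0)),
    ⟨[0, 2, 4, 6, 8, 10, 12, 14, 16, 18, 20, 22, 24, 26, 28], [24, 10], [10, 24]⟩, ⟨[0, 2, 4, 6,
      8, 10, 12, 14, 16, 18, 20, 22, 24, 26, 28, 32, 31], [24, 10], [10, 24]⟩⟩,
    .ofTable 17 [1, 4, 7, 8, 11, 14, 16] [2, 4, 34, 8, 6, 14, 1, 17, 10, 7, 12, 20, 3, 37, 16, 22,
      5, 18, 9, 27, 11, 29, 24, 35, 26, 36, 15, 28, 19, 30, 21, 33, 25, 31, 0, 23, 32, 13] 34),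
  (⟨⟨.m33, false, true, false⟩, .ofTable 14 [1, 4, 7, 8, 10, 13] [2, 4, 28, 8, 6, 14, 1, 17, 10,
      7, 12, 33, 3, 31, 16, 20, 5, 18, 9, 25, 22, 29, 24, 30, 15, 34, 23, 32, 0, 21, 26, 13, 27,
      11, 19] (Sum.inl (p (k := 4) 0)),
    ⟨[0, 2, 4, 6, 8, 10, 12, 14, 16, 18, 22, 24, 26, 32, 31, 20, 28], [24, 10, 8], [10, 8, 24]⟩,
      ⟨[0, 2, 4, 6, 8, 10, 12, 14, 16, 18, 24, 26, 28, 33, 20, 30, 23], [26, 10, 8], [10, 8,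
      26]⟩⟩,
    .ofTable 17 [1, 4, 7, 8, 10, 12, 15, 16] [2, 4, 34, 8, 6, 14, 1, 17, 10, 7, 12, 20, 3, 37, 16,
      24, 5, 18, 9, 29, 22, 19, 11, 31, 26, 35, 28, 36, 15, 30, 21, 32, 23, 27, 0, 25, 33, 13]
      34),
  (⟨⟨.m33, false, true, false⟩, .ofTable 14 [1, 4, 6, 7, 9, 12, 13] [2, 4, 28, 8, 6, 12, 1, 15,
      33, 7, 3, 31, 14, 18, 5, 16, 9, 23, 20, 29, 22, 30, 13, 24, 34, 26, 32, 21, 0, 19, 27, 11,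
      25, 10, 17] (Sum.inl (p (k := 4) 0)),
    ⟨[0, 2, 4, 6, 8, 12, 14, 16, 18, 24, 26, 28, 30, 32, 23, 10, 21], [20, 10, 8], [10, 8, 20]⟩,
      ⟨[0, 2, 4, 6, 8, 14, 16, 18, 20, 30, 32, 23, 24, 28, 10, 26, 13], [24, 12, 8], [12, 8,
      24]⟩⟩,
    .ofTable 17 [1, 4, 5, 8, 9, 12, 13, 14, 15] [2, 4, 34, 8, 6, 16, 1, 19, 10, 7, 12, 21, 14, 27,
      3, 37, 18, 30, 5, 20, 9, 22, 24, 17, 26, 28, 11, 25, 13, 33, 32, 35, 23, 36, 0, 31, 29, 15]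
      34),
  (⟨⟨.m33, true, false, false⟩, .ofTable 14 [1, 2, 3, 6, 9, 10, 11, 12] [2, 34, 28, 4, 6, 33, 8,
      15, 10, 21, 3, 31, 32, 24, 5, 16, 18, 13, 20, 22, 7, 19, 9, 27, 26, 29, 17, 30, 0, 25, 23,
      11, 12, 14, 1] (Sum.inl (p (k := 4) 0)),
    ⟨[0, 2, 8, 10, 12, 14, 16, 20, 22, 24, 26, 28, 30, 32, 7, 4, 18], [1, 16, 0], [16, 0, 1]⟩,
      ⟨[0, 2, 6, 8, 10, 12, 28, 18, 20, 22, 24, 26, 30, 32, 15, 17, 4], [1, 14, 0], [14, 0, 1]⟩⟩,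
    .ofTable 17 [1, 3, 4, 7, 8, 11, 12, 13, 14, 15] [2, 4, 34, 6, 1, 14, 8, 17, 10, 19, 12, 25, 3,
      37, 16, 28, 5, 18, 7, 20, 22, 29, 24, 26, 9, 23, 11, 33, 15, 30, 32, 35, 21, 36, 0, 31, 27,
      13] 34),
  (⟨⟨.m33, false, false, false⟩, .ofTable 14 [1, 3, 6, 8, 9, 10, 11, 12] [2, 4, 28, 32, 1, 12, 8,
      34, 10, 19, 3, 31, 33, 22, 16, 23, 18, 20, 7, 17, 9, 27, 13, 24, 26, 29, 15, 30, 0, 25, 21,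
      11, 6, 5, 14] (Sum.inl (p (k := 4) 0)),
    ⟨[0, 2, 4, 8, 10, 12, 14, 20, 22, 24, 26, 28, 30, 32, 6, 16, 19], [6, 0, 14], [0, 14, 6]⟩,
      ⟨[0, 2, 4, 10, 12, 14, 16, 20, 22, 24, 26, 28, 30, 32, 18, 9, 6], [8, 0, 16], [0, 16, 8]⟩⟩,
    .ofTable 17 [1, 3, 5, 8, 11, 12, 13, 14, 15] [2, 4, 34, 6, 1, 16, 8, 5, 10, 19, 12, 9, 14, 25,
      3, 37, 18, 28, 7, 20, 22, 29, 24, 26, 11, 23, 13, 33, 17, 30, 32, 35, 21, 36, 0, 31, 27, 15]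
      34),
  (⟨⟨.m20, false, false, true⟩, .ofTable 15 [1, 3, 6, 9, 10, 11, 12, 13] [2, 4, 30, 6, 1, 12, 35,
      5, 10, 21, 3, 33, 14, 24, 7, 16, 18, 25, 20, 22, 34, 19, 9, 29, 13, 26, 28, 31, 17, 32, 0,
      27, 23, 11, 15, 8] (Sum.inl (p (k := 4) 0)),
    ⟨[0, 2, 4, 6, 12, 14, 16, 18, 20, 22, 24, 26, 28, 30, 32, 8, 10], [6, 10], [10, 6]⟩, ⟨[0, 2,
      4, 6, 8, 10, 12, 14, 24, 19, 17, 20, 22, 28, 27], [6, 6], [6, 6]⟩⟩,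
    .ofTable 15 [1, 3, 6, 8, 9, 10, 11, 14] [2, 4, 30, 6, 1, 12, 8, 5, 10, 16, 3, 33, 14, 22, 7,
      24, 18, 15, 20, 17, 9, 26, 13, 28, 19, 23, 32, 25, 27, 31, 0, 29, 21, 11] 30),
  (⟨⟨.m99, true, false, false⟩, .ofTable 6 [1, 3, 5] [2, 17, 12, 16, 3, 15, 19, 8, 14, 18, 9, 13,
      0, 11, 7, 5, 4, 1, 10, 6] (Sum.inl (p (k := 4) 0)),
    ⟨[0, 2, 10, 20, 26, 28, 4, 6, 8, 12, 14, 17, 22, 24, 19], [8, 0, 1, 18], [0, 1, 18, 8]⟩, ⟨[0,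
      2, 10, 20, 26, 28, 4, 6, 8, 12, 14, 17, 22, 24, 19], [8, 0, 1, 18], [0, 1, 18, 8]⟩⟩,
    .ofTable 15 [1, 2, 4, 6, 8, 9, 10, 11, 14] [2, 4, 30, 6, 1, 12, 8, 5, 10, 16, 3, 33, 14, 22,
      7, 24, 18, 15, 20, 17, 9, 26, 13, 28, 19, 23, 32, 25, 27, 31, 0, 29, 21, 11] 30),
  (⟨⟨.m20, false, false, false⟩, .ofTable 13 [0, 2, 4, 6, 7, 8, 9, 12] [26, 2, 4, 30, 6, 12, 1,
      29, 10, 18, 3, 20, 14, 11, 16, 13, 5, 22, 9, 24, 15, 19, 28, 21, 23, 27, 31, 25, 17, 7, 8,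
      0] (Sum.inl (p (k := 4) 0)),
    ⟨[2, 6, 8, 10, 12, 14, 16, 18, 20, 22, 24, 26, 28, 5, 1], [1, 0], [0, 1]⟩, ⟨[6, 5, 16, 18, 0,
      2, 15, 13, 24, 8, 10, 23, 20], [1, 4], [4, 1]⟩⟩,
    .ofTable 13 [0, 3, 4, 6, 7, 8, 10, 12] [2, 8, 4, 10, 6, 16, 26, 5, 1, 20, 12, 9, 14, 24, 3,
      13, 18, 15, 7, 29, 22, 27, 11, 28, 17, 23, 0, 21, 25, 19] 26),
  (⟨⟨.m20, true, false, false⟩, .ofTable 13 [0, 3, 4, 6, 7, 8, 10, 12] [2, 8, 4, 10, 6, 16, 26, 5,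
      1, 20, 12, 30, 14, 24, 3, 13, 18, 15, 7, 29, 31, 27, 11, 28, 17, 23, 0, 21, 25, 19, 22, 9]
      (Sum.inl (p (k := 4) 0)),
    ⟨[0, 2, 4, 6, 8, 10, 12, 14, 16, 18, 20, 22, 24], [20, 0], [0, 20]⟩, ⟨[0, 2, 4, 6, 8, 10, 12,
      14, 16, 18, 20, 26, 28, 24, 23], [20, 0], [0, 20]⟩⟩,
    .ofTable 15 [0, 3, 4, 6, 7, 8, 10, 12, 14] [2, 8, 4, 10, 6, 16, 30, 5, 1, 20, 12, 24, 14, 28,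
      3, 13, 18, 15, 7, 33, 22, 31, 9, 25, 26, 23, 11, 32, 17, 27, 0, 21, 29, 19] 30),
  (⟨⟨.m33, false, false, false⟩, .ofTable 12 [0, 3, 5, 6, 7, 9, 11] [2, 28, 4, 8, 6, 14, 24, 5,
      10, 18, 12, 22, 3, 11, 16, 13, 7, 27, 20, 30, 9, 26, 15, 21, 0, 29, 23, 17, 1, 25, 19]
      (Sum.inl (p (k := 4) 0)),
    ⟨[0, 2, 4, 6, 10, 12, 14, 16, 18, 24, 26, 28, 8, 21, 23], [0, 1, 20], [1, 20, 0]⟩, ⟨[0, 2, 4,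
      6, 12, 14, 16, 18, 20, 25, 26, 28, 22, 11, 8], [0, 1, 23], [1, 23, 0]⟩⟩,
    .ofTable 15 [0, 3, 4, 7, 8, 9, 12, 14] [2, 8, 4, 12, 6, 18, 30, 5, 10, 31, 1, 23, 14, 25, 16,
      28, 3, 15, 20, 17, 7, 33, 9, 24, 11, 26, 13, 32, 19, 27, 0, 22, 29, 21] 30),
  (⟨⟨.m33, false, false, false⟩, .ofTable 12 [2, 4, 5, 6, 9, 11] [2, 6, 4, 12, 24, 3, 8, 19, 10,
      22, 1, 9, 14, 11, 5, 27, 29, 18, 30, 20, 7, 26, 13, 21, 28, 16, 23, 15, 0, 25, 17]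
      (Sum.inl (p (k := 4) 0)),
    ⟨[2, 4, 6, 12, 14, 16, 18, 20, 22, 24, 26, 28, 0, 9, 11], [0, 1, 8], [1, 8, 0]⟩, ⟨[4, 6, 8,
      16, 18, 20, 22, 24, 10, 14, 26, 28, 12, 3, 0], [2, 1, 10], [1, 10, 2]⟩⟩,
    .ofTable 15 [0, 4, 7, 9, 10, 11, 14] [2, 31, 4, 13, 6, 16, 8, 22, 30, 7, 12, 14, 1, 11, 3, 26,
      18, 15, 20, 28, 5, 19, 24, 21, 9, 33, 17, 32, 23, 27, 0, 10, 29, 25] 30),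
  (⟨⟨.m33, false, true, false⟩, .ofTable 12 [0, 4, 7, 8, 9, 11] [2, 25, 4, 13, 6, 29, 8, 18, 24,
      7, 12, 30, 1, 11, 16, 22, 5, 15, 20, 17, 9, 27, 19, 28, 0, 10, 23, 21, 26, 14, 3]
      (Sum.inl (p (k := 4) 0)),
    ⟨[0, 2, 4, 6, 8, 10, 12, 18, 20, 22, 24, 28, 27, 16, 14], [11, 16, 2], [16, 2, 11]⟩, ⟨[0, 2,
      4, 6, 8, 10, 12, 20, 22, 24, 26, 29, 17, 14, 19], [11, 18, 2], [18, 2, 11]⟩⟩,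
    .ofTable 15 [0, 4, 7, 8, 10, 11, 12, 14] [2, 31, 4, 13, 6, 17, 8, 24, 30, 7, 12, 14, 1, 11,
      16, 32, 3, 18, 20, 15, 22, 29, 5, 21, 26, 23, 9, 33, 19, 25, 0, 10, 28, 27] 30),
  (⟨⟨.m33, true, false, false⟩, .ofTable 12 [0, 2, 5, 7, 8, 9, 11] [30, 25, 4, 18, 24, 3, 8, 10,
      1, 7, 28, 26, 14, 11, 16, 23, 29, 15, 20, 17, 5, 27, 13, 19, 0, 6, 22, 21, 9, 12, 2]
      (Sum.inl (p (k := 4) 0)),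
    ⟨[0, 6, 8, 10, 12, 14, 18, 20, 22, 24, 26, 28, 5, 2, 16], [0, 14, 4], [14, 4, 0]⟩, ⟨[0, 4, 6,
      8, 10, 20, 22, 24, 26, 16, 18, 29, 13, 15, 2], [0, 12, 2], [12, 2, 0]⟩⟩,
    .ofTable 15 [0, 3, 6, 7, 8, 10, 12, 13, 14] [2, 31, 4, 12, 6, 16, 30, 5, 10, 20, 1, 9, 14, 11,
      3, 22, 18, 27, 7, 33, 13, 32, 24, 21, 26, 28, 15, 25, 17, 23, 0, 8, 29, 19] 30),
  (⟨⟨.m33, true, true, false⟩, .ofTable 12 [0, 3, 6, 7, 8, 10, 11] [2, 25, 4, 12, 6, 16, 24, 5,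
      10, 20, 1, 9, 14, 11, 3, 28, 18, 23, 7, 27, 13, 26, 15, 30, 0, 8, 29, 19, 22, 21, 17]
      (Sum.inl (p (k := 4) 0)),
    ⟨[0, 2, 4, 6, 8, 10, 12, 14, 16, 18, 20, 26, 29, 25, 22], [24, 12, 16], [12, 16, 24]⟩, ⟨[0, 2,
      4, 6, 8, 10, 12, 14, 16, 18, 20, 24, 22, 28, 26], [22, 12, 16], [12, 16, 22]⟩⟩,
    .ofTable 15 [0, 3, 6, 7, 8, 10, 12, 13] [2, 31, 4, 12, 6, 16, 30, 5, 10, 20, 1, 9, 14, 11, 3,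
      22, 18, 25, 7, 33, 13, 32, 24, 29, 15, 26, 17, 23, 21, 27, 0, 8, 28, 19] 30),
  (⟨⟨.m20, false, false, true⟩, .ofTable 13 [0, 4, 5, 6, 8, 10, 11] [2, 27, 31, 8, 6, 16, 1, 5,
      10, 7, 3, 18, 14, 21, 30, 29, 9, 28, 20, 25, 11, 22, 13, 19, 17, 23, 0, 4, 24, 15, 12, 26]
      (Sum.inl (p (k := 4) 0)),
    ⟨[0, 2, 8, 10, 12, 14, 16, 18, 20, 22, 24, 26, 28, 4, 6], [2, 6], [6, 2]⟩, ⟨[0, 2, 4, 6, 8,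
      10, 23, 24, 12, 14, 16, 21, 18], [2, 2], [2, 2]⟩⟩,
    .ofTable 13 [0, 4, 5, 6, 8, 10, 11] [2, 27, 26, 8, 6, 12, 1, 5, 10, 7, 3, 14, 9, 28, 16, 19,
      11, 21, 13, 20, 15, 22, 17, 24, 23, 29, 0, 4, 18, 25] 26),
  (⟨⟨.m33, true, true, false⟩, .ofTable 10 [0, 4, 5, 6, 8] [2, 21, 20, 8, 6, 12, 1, 5, 10, 7, 3,
      24, 9, 22, 13, 25, 26, 18, 17, 23, 0, 4, 14, 19, 11, 15, 16] (Sum.inl (p (k := 4) 0)),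
    ⟨[0, 2, 4, 6, 8, 10, 12, 18, 22, 24, 20, 17, 14], [2, 8, 19], [8, 19, 2]⟩, ⟨[0, 2, 4, 6, 8,
      10, 12, 16, 22, 24, 14, 19, 21], [2, 8, 17], [8, 17, 2]⟩⟩,
    .ofTable 13 [0, 4, 5, 6, 10, 11] [2, 27, 26, 8, 6, 12, 1, 5, 10, 7, 3, 14, 9, 28, 11, 18, 13,
      19, 20, 17, 15, 22, 21, 24, 23, 29, 0, 4, 16, 25] 26),
  (⟨⟨.m20, false, false, false⟩, .ofTable 11 [0, 4, 5, 6, 10] [2, 23, 22, 8, 6, 12, 1, 5, 10, 7,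
      3, 14, 9, 24, 11, 18, 13, 19, 20, 17, 15, 26, 0, 4, 16, 27, 21, 25]
      (Sum.inl (p (k := 4) 0)),
    ⟨[0, 2, 4, 6, 8, 10, 12, 14, 16, 18, 20, 22, 24], [2, 17], [17, 2]⟩, ⟨[0, 2, 4, 6, 8, 10, 12,
      14, 16, 18, 20], [2, 17], [17, 2]⟩⟩,
    .ofTable 11 [0, 4, 5, 6, 10] [2, 23, 22, 8, 6, 12, 1, 5, 10, 7, 3, 14, 9, 24, 11, 18, 13, 19,
      20, 17, 15, 25, 0, 4, 16, 21] 22),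
  (⟨⟨.m20, false, false, false⟩, .ofTable 9 [0, 4, 5, 8] [2, 19, 18, 8, 6, 10, 1, 5, 22, 7, 9, 20,
      11, 15, 16, 13, 23, 21, 0, 4, 12, 17, 3, 14] (Sum.inl (p (k := 4) 0)),
    ⟨[0, 2, 4, 6, 8, 12, 16, 18, 20, 10, 14], [2, 8], [8, 2]⟩, ⟨[0, 3, 13, 7, 8, 15, 17, 10, 5],
      [3, 8], [8, 3]⟩⟩,
    CoinName.coin ⟨.m99, true, false, true⟩)]

theorem derivationCheck99 : Family.DerivationCheck .m99 derivation99 := by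
  decide +kernel

end BlinkCalculus

namespace BlinkCalculus

open Equiv Function Coded

/-! ## Negatives -/

section Neg

variable {k j : ℕ}

/-- The name of the negative coin. -/
def CoinName.neg (n : CoinName) : CoinName := { n with negative := !n.negative }

theorem Coin.neg_neg (c : Coin k) : c.neg.neg = c :=
  congrArg (fun b => { c with black := b }) (funext fun e => Bool.not_not (c.black e))

theorem CoinName.coin_neg (n : CoinName) : n.neg.coin = n.coin.neg := by
  obtain ⟨f, r, _ | _, _ | _⟩ := n
  · rfl
  · rfl
  · exact (Coin.neg_neg _).symm
  · exact (Coin.neg_neg _).symm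

/-- The context with the colours interchanged. -/
def Context.neg (Y : Context k j) : Context k j := { Y with black := fun e => !Y.black e }

theorem Coin.piece_neg (c : Coin k) (l : List (Fin c.edges)) (d : CoinDart c.edges k) :
    c.neg.piece l d = c.piece l d := by
  induction l generalizing d with
  | nil => rfl
  | cons a l ih =>
    have key : ∀ {m n q m' n' q' : ℕ}, m = m' → n = n' → q = q' →
        (if m = n then q else m) = if m' = n' then q' else m' := by
      rintro _ _ _ _ _ _ rfl rfl rfl
      rfl
    exact key (ih d) (ih (i a)) (ih (o a))

theorem Coin.DiskCheck.neg {c : Coin k} (h : c.DiskCheck) : c.neg.DiskCheck := by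
  obtain ⟨e, rot, black, _ | x⟩ := c
  · exact h
  · exact ⟨fun d => (Coin.piece_neg ⟨e, rot, black, some x⟩ _ d).trans
      ((h.1 d).trans (Coin.piece_neg ⟨e, rot, black, some x⟩ _ x).symm), h.2⟩

theorem Context.firstEss_neg (Y : Context k j) (L : Coin j) (n : ℕ)
    (z : Y.Dart ⊕ CoinDart L.edges j) : Y.neg.firstEss L.neg n z = Y.firstEss L n z := by
  induction n generalizing z with
  | zero => rcases z with (z | z) | (z | z) <;> rfl
  | succ n ih =>
    rcases z with (z | z) | (z | z)
    · rfl
    · exact ih (Y.merge L (Sum.inl (Sum.inr z)))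
    · rfl
    · exact ih (Y.merge L (Sum.inr (Sum.inr z)))

namespace Position

variable (P : Position) (T : Coin k) (Y : Context k j) (L : Coin j) (x : CoinDart T.edges k)

theorem emb_neg (a : Y.Ess L) : P.emb T.neg Y.neg L.neg x a = P.emb T Y L x a := by
  rcases a with (a | a) | a <;> rfl

theorem embCtx_neg (y : Y.Dart) : P.embCtx T.neg Y.neg L.neg x y = P.embCtx T Y L x y := by
  rcases y with y | y
  · exact emb_neg P T Y L x (Sum.inl y)
  · rfl

theorem embCoin_neg (d : CoinDart L.edges j) :
    P.embCoin T.neg Y.neg L.neg x d = P.embCoin T Y L x d := by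
  rcases d with d | d
  · exact emb_neg P T Y L x (Sum.inr d)
  · rfl

variable {P T Y L x}

theorem black_neg {b : Y.Ess L} {v : Bool} (hP : Injective (P.emb T Y L x))
    (hb : ∀ t, b ≠ Sum.inl (Sum.inr t)) (h : T.toPatch.black (P.emb T Y L x b) = v) :
    T.neg.toPatch.black (P.emb T.neg Y.neg L.neg x b) = !v := by
  have hd : ∃ a, P.emb T Y L x b = Sum.inl a := by
    rcases hd : P.emb T Y L x b with a | t
    · exact ⟨a, rfl⟩
    · exact absurd (hP (hd.trans
        (show Sum.inr t = P.emb T Y L x (Sum.inl (Sum.inr t)) from rfl))) (hb t)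
  obtain ⟨a, ha⟩ := hd
  rw [ha] at h
  exact (congrArg T.neg.toPatch.black ((emb_neg P T Y L x b).trans ha)).trans (congrArg not h)

theorem DartCheck.neg (h : P.DartCheck T Y L x) : P.DartCheck T.neg Y.neg L.neg x := by
  have hP := h.bijective.injective
  obtain ⟨h1, h2, h3, h4, h5, h6, h7, h8⟩ := h
  refine ⟨h1, h2, fun a => ?_, fun d => ?_, fun d => ?_, fun z => ?_, fun t => ?_,
    fun t => ?_⟩
  · have h : (fun a => key (P.emb T.neg Y.neg L.neg x a)) = fun a => key (P.emb T Y L x a) :=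
      funext fun a => congrArg key (emb_neg P T Y L x a)
    exact (congrArg (fun f => digit (size (Y.Ess L)) (memoInv (Y.Ess L) f) (f a)) h).trans (h3 a)
  · exact black_neg hP (fun t h => by cases h) (h4 d)
  · exact black_neg hP (fun t h => by cases h) (h5 d)
  · refine Eq.trans ?_ ((h6 z).trans
      (congrArg (fun d => some (key (T.rot d))) (emb_neg P T Y L x z).symm))
    refine (congrArg (Option.map _) ((Y.firstEss_neg L _ _).trans
      (congrArg (fun w => Y.firstEss L (2 * j) w) ?_))).trans
      (congrArg (fun f => Option.map f _) (funext fun e => congrArg key (emb_neg P T Y L x e)))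
    rcases z with (z | z) | z <;> rfl
  · exact (congrArg _ (Y.firstEss_neg L _ _)).trans (h7 t)
  · exact (congrArg _ (Y.firstEss_neg L _ _)).trans (h8 t)

theorem FaceCheck.neg (h : P.FaceCheck T Y L x) : P.FaceCheck T.neg Y.neg L.neg x := by
  have hctx (y : Y.Dart) : region T.neg (P.embCtx T.neg Y.neg L.neg x y) =
    region T (P.embCtx T Y L x y) := congrArg (region T) (embCtx_neg P T Y L x y)
  have hcoin (d : CoinDart L.edges j) : region T.neg (P.embCoin T.neg Y.neg L.neg x d) =
    region T (P.embCoin T Y L x d) := congrArg (region T) (embCoin_neg P T Y L x d)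
  obtain ⟨h1, h2, h3, h4, h5, h6, h7⟩ := h
  refine ⟨fun y => ?_, fun d => ?_, fun t => ?_, fun t => ?_, h5, fun hk => ?_, fun hk => ?_⟩
  · exact (hctx _).trans ((h1 y).trans (hctx _).symm)
  · exact (hcoin _).trans ((h2 d).trans (hcoin _).symm)
  · exact (hctx _).trans ((h3 t).trans (hcoin _).symm)
  · exact (hcoin _).trans ((h4 t).trans (hctx _).symm)
  · exact (hctx _).trans (h6 hk)
  · obtain ⟨t, d, h8, h9, h10⟩ := h7 hk
    exact ⟨t, d, h8, (emb_neg P T Y L x _).trans h9, h10⟩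

theorem Check.neg (h : P.Check T Y L) : P.Check T.neg Y.neg L.neg := by
  obtain ⟨e, rot, black, _ | x⟩ := T
  · exact h
  · exact ⟨h.1.neg, h.2.neg⟩

end Position

/-- The place in the negative coin. -/
def Place.neg (s : Place k) : Place k where
  name := s.name.neg
  ctx := s.ctx.neg
  before := s.before
  after := s.after

theorem Place.Check.neg {s : Place k} {c c' : Coin k} (h : s.Check c c') :
    s.neg.Check c.neg c'.neg := by
  obtain ⟨h1, h2, h3, h4, h5⟩ := h
  refine ⟨h1, h2, ?_, ?_, h5.neg⟩
  · exact (congrArg (fun L => s.before.Check c.neg s.ctx.neg (Coin.memo L)) s.name.coin_neg).mpr h3.neg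
  · exact (congrArg (fun L => s.after.Check c'.neg s.ctx.neg (Coin.memo L))
      s.name.mate.coin_neg).mpr h4.neg

theorem DerivationCheck.neg {c : Coin k} {l : List (Place k × Coin k)} (h : DerivationCheck c l) :
    DerivationCheck c.neg (l.map (Prod.map Place.neg Coin.neg)) := by
  induction l generalizing c with
  | nil => trivial
  | cons s l ih => exact ⟨h.1.neg, ih h.2⟩

end Neg

/-! ## The reduced calculus -/

theorem PreBlink.Isotopic.refl (B : PreBlink) : B.Isotopic B :=
  ⟨Equiv.refl _, Equiv.refl _, Equiv.refl _, fun _ => rfl, fun _ _ => Iff.rfl, fun _ => rfl,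
    fun _ _ => Iff.rfl, fun _ => rfl, fun _ _ => Iff.rfl, rfl⟩

theorem Replaces.symm {k : ℕ} {L R : Patch k} {B B' : Blink} (h : Replaces L R B B') :
    Replaces R L B' B :=
  let ⟨X, h1, h2⟩ := h
  ⟨X, h2, h1⟩

/-- The move in the opposite direction. -/
def Move.inverse (m : Move) : Move := ⟨m.target⟩

theorem Move.Applies.symm {m : Move} {B B' : Blink} (h : m.Applies B B') :
    m.inverse.Applies B' B := by
  obtain ⟨⟨f, _ | _, n, s⟩⟩ := m <;> exact Replaces.symm h

theorem Move.inverse_mem_reducedMoves {m : Move} (h : m ∈ reducedMoves) :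
    m.inverse ∈ reducedMoves :=
  Finset.mem_filter.2 ⟨Finset.mem_univ _, (Finset.mem_filter.1 h).2⟩

theorem obtainable_equivalence : Equivalence (Obtainable reducedMoves) where
  refl _ := .refl
  trans := .trans
  symm {B B'} h := by
    induction h with
    | refl => exact .refl
    | tail _ h ih => exact .head (h.imp (·.symm) fun ⟨m, hm, hm'⟩ =>
        ⟨m.inverse, Move.inverse_mem_reducedMoves hm, hm'.symm⟩) ih

variable {k : ℕ}

theorem DerivationCheck.obtainable_of_isotopic {c c' : Coin k} {l : List (Place k × Coin k)}
    (h : DerivationCheck c l) (hc : c.DiskCheck) (hl : (l.getLast?.map Prod.snd).getD c = c')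
    {X : Exterior k} {B : Blink} (hB : B.Isotopic (fill X c.toPatch)) :
    ∃ hB' : (fill X c'.toPatch).IsPlane, Obtainable reducedMoves B ⟨_, hB'⟩ := by
  obtain ⟨h1, h2⟩ := h.obtainable hc hl X (c.toPatch_isLocal.isPlane_of_isotopic hB)
  exact ⟨h1, .head (Or.inl hB) h2⟩

theorem Family.DerivationCheck.obtainable {f : Family} {l : List (Place f.arity × Coin f.arity)}
    (h : f.DerivationCheck l) (n : Bool) {r s : Bool} (hl : (l.getLast?.map Prod.snd).getD
      (CoinName.coin ⟨f, false, false, true⟩) = CoinName.coin ⟨f, r, false, s⟩)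
    {X : Exterior f.arity} {B : Blink}
    (hB : B.Isotopic (fill X (CoinName.coin ⟨f, false, n, true⟩).toPatch)) :
    ∃ hB' : (fill X (CoinName.coin ⟨f, r, n, s⟩).toPatch).IsPlane,
      Obtainable reducedMoves B ⟨_, hB'⟩ := by
  cases n with
  | false => exact DerivationCheck.obtainable_of_isotopic h.2 h.1 hl hB
  | true =>
    refine DerivationCheck.obtainable_of_isotopic h.2.neg h.1.neg ?_ hB
    have h1 := CoinName.coin_neg ⟨f, r, false, s⟩
    refine Eq.trans ?_ h1.symm
    rw [← hl, List.getLast?_map]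
    cases l.getLast? <;> rfl

theorem Family.DerivationCheck.replaces {f : Family} {l : List (Place f.arity × Coin f.arity)}
    (h : f.DerivationCheck l) (n : Bool) (hl : (l.getLast?.map Prod.snd).getD
      (CoinName.coin ⟨f, false, false, true⟩) = CoinName.coin ⟨f, true, false, true⟩)
    {B B' : Blink} (hB : Replaces (CoinName.coin ⟨f, false, n, true⟩).toPatch
      (CoinName.coin ⟨f, true, n, true⟩).toPatch B B') : Obtainable reducedMoves B B' := by
  obtain ⟨X, hB, hB'⟩ := hB
  obtain ⟨h1, h2⟩ := h.obtainable n hl hB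
  exact h2.tail (Or.inl hB'.symm)

end BlinkCalculus

namespace BlinkCalculus

theorem coin_right_m10 (n s : Bool) :
    CoinName.coin ⟨.m10, true, n, s⟩ = CoinName.coin ⟨.m10, true, false, false⟩ := by
  have h (b : Fin 0 → Bool) (r : Equiv.Perm (CoinDart 0 0)) :
      (⟨0, r, b, none⟩ : Coin 0) = Family.right .m10 :=
    congrArg₂ (fun r b => (⟨0, r, b, none⟩ : Coin 0)) (Subsingleton.elim _ _)
      (Subsingleton.elim _ _)
  cases n <;> cases s <;> exact h _ _

theorem obtainable_of_replaces_starred (f : Family) (n : Bool) {B B' : Blink}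
    (h : Replaces (CoinName.coin ⟨f, false, n, true⟩).toPatch
      (CoinName.coin ⟨f, true, n, true⟩).toPatch B B') : Obtainable reducedMoves B B' := by
  cases f with
  | m20 => exact .single (Or.inr ⟨⟨⟨.m20, false, n, true⟩⟩,
      Finset.mem_filter.2 ⟨Finset.mem_univ _, Or.inr rfl⟩, h⟩)
  | m33 => exact derivationCheck33.replaces n rfl h
  | m10 =>
    obtain ⟨X, hB, hB'⟩ := h
    obtain ⟨h1, h2⟩ := derivationCheck10.obtainable n (r := false) (s := false) rfl hB
    refine h2.tail (Or.inr ⟨⟨⟨.m10, false, n, false⟩⟩,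
      Finset.mem_filter.2 ⟨Finset.mem_univ _, Or.inl rfl⟩, X, .refl _, ?_⟩)
    rw [coin_right_m10] at hB'
    exact (congrArg (fun c => B'.Isotopic (fill X (Coin.toPatch c)))
      (coin_right_m10 n false)).mpr hB'
  | m11 => exact derivationCheck11.replaces n rfl h
  | m31 => exact derivationCheck31.replaces n rfl h
  | m54 => exact derivationCheck54.replaces n rfl h
  | m66 => exact derivationCheck66.replaces n rfl h
  | m99 => exact derivationCheck99.replaces n rfl h

theorem Move.Applies.obtainable {m : Move} {B B' : Blink} (h : m.Applies B B') :
    Obtainable reducedMoves B B' := by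
  obtain ⟨⟨f, r, n, s⟩⟩ := m
  cases s with
  | false => exact .single (Or.inr ⟨_, Finset.mem_filter.2 ⟨Finset.mem_univ _, Or.inl rfl⟩, h⟩)
  | true =>
    cases r with
    | false => exact obtainable_of_replaces_starred f n h
    | true =>
      exact obtainable_equivalence.symm (obtainable_of_replaces_starred f n (Replaces.symm h))

end BlinkCalculus

theorem mainTheorem3 :
    (BlinkCalculus.allMoves.card = 64 ∧
      (BlinkCalculus.coinsOf BlinkCalculus.allMoves).card = 64) ∧
    (BlinkCalculus.reducedMoves.card = 36 ∧
      (BlinkCalculus.coinsOf BlinkCalculus.reducedMoves).card = 36) ∧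
    Equivalence (BlinkCalculus.Obtainable BlinkCalculus.reducedMoves) ∧
    ∀ B B' : BlinkCalculus.Blink,
      BlinkCalculus.Obtainable BlinkCalculus.reducedMoves B B' ↔
        BlinkCalculus.Obtainable BlinkCalculus.allMoves B B' := by
  refine ⟨⟨by decide +kernel, by decide +kernel⟩, ⟨by decide +kernel, by decide +kernel⟩,
    BlinkCalculus.obtainable_equivalence, fun B B' => ⟨fun h => ?_, fun h => ?_⟩⟩
  · exact Relation.ReflTransGen.mono (fun _ _ => Or.imp_right fun ⟨m, _, hm⟩ =>
      ⟨m, Finset.mem_univ m, hm⟩) _ _ h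
  · induction h with
    | refl => exact .refl
    | tail _ h ih =>
      rcases h with h | ⟨m, -, hm⟩
      · exact ih.tail (Or.inl h)
      · exact ih.trans hm.obtainable
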